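/- **Theorem 6.11.** Let $p:E\to B$ and $q:F\to C$ be $C^\infty$ vector bundles of finite rank over finite-dimensional $C^\infty$ manifolds (boundary and corners are allowed), with $B$ compact, and identify $B$ and $C$ with the zero sections. Put $m=\dim B$ and $n=\operatorname{rank}E$. Fix a smooth orthogonal structure on $E$ with norm $\|\cdot\|:E\to[0,\infty)$. Let $N\subset E$ be a compact neighbourhood of $B$ that is star-like ($tw\in N$ for $w\in N$, $t\in[0,1]$) and a smooth submanifold of codimension zero, possibly with boundary and corners (it is enough that in local charts of $E$ the tangent cones of $N$ at each of its points span a dense subspace, so that derivatives within $N$ are unique). Let $\varepsilon>0$ be such that $R_\varepsilon=\{w\in E:\|w\|\le\varepsilon\}\subset N$. Fix $0<p_0<q_0$ and a $C^\infty$ function $\mu:\mathbb R\to[0,1]$ with $\mu=0$ on $[0,p_0]$ and $\mu=1$ on $[q_0,\infty)$. For $r\in\{0,1,\dots,\infty\}$ let $W^r$ be the weak Whitney topology on $C^\infty(N,F)$ (uniform convergence on compact sets, in local charts, of all derivatives of finite order at most $r$) and the topology it induces on subsets. A homotopy equivalence is a $W^{\infty,\infty}$-homotopy equivalence if it is one when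 both spaces carry $W^\infty$. Let * $\mathcal C(N,F)$ be the set of $C^\infty$ maps $h:N\to F$ with $h(B)\subset C$; * $\mathcal C_{lin}(N,F)\subset\mathcal C(N,F)$ be the set of those $h$ that coincide on a neighbourhood of $B$ with some $C^\infty$ vector bundle morphism $E\to F$. For $h\in\mathcal C(N,F)$ and $x\in B$ the Jacobi matrix of $h$ at $x$ has, in local trivializations of $E$ and $F$, the form $\begin{pmatrix}P&Q\\0&S\end{pmatrix}$; the numbers $\operatorname{rank}P$ and $\operatorname{rank}S$ do not depend on the trivializations and are called the horizontal and the vertical rank of $h$ at $x$. Let $T_{fib}h:E\to F$ be the vector bundle morphism $T_{fib}h(w)=\lim_{t\to0}\frac1t h(tw)$, given in local trivializations by $(x,v)\mapsto(h(x),S(x)v)$. Put $\alpha_h(\tau,w)=\frac1\tau h(\tau w)$ for $\tau\in(0,1]$, $w\in N$, and $\alpha_h(0,w)=T_{fib}h(w)$. Let $\mathcal X$ be one of the following spaces: 1. the set of all $h\in\mathcal C(N,F)$ of horizontal rank $\ge a$ at every point of $B$, for some integer $a\ge0$; 2. the set of all $h\in\mathcal C(N,F)$ of vertical rank $\ge b$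 at every point of $B$, for some integer $b\ge0$; 3. the set of all $h\in\mathcal C(N,F)$ of horizontal rank $\ge a$ and vertical rank $\ge b$ at every point of $B$, for some integers $a,b\ge0$; 4. the set of all smooth embeddings $h\in\mathcal C(N,F)$ of horizontal rank $m$ and vertical rank $n$ at every point of $B$; 5. the set of all smooth embeddings $h\in\mathcal C(N,F)$, in the case when $\dim B=\dim C$ and $\dim E=\dim F$. Then there exists a $W^3$-continuous function $\delta:\mathcal X\to(0,\varepsilon)$ such that the $\delta$-linearizing homotopy $$H(h,t)(w)=\alpha_h\Bigl(t+(1-t)\,\mu\bigl(\tfrac{\|w\|}{\delta(h)}\bigr),\,w\Bigr),\qquad h\in\mathcal X,\ t\in[0,1],\ w\in N,$$ takes values in $\mathcal X$, i.e. defines a map $H:\mathcal X\times[0,1]\to\mathcal X$ (which is continuous for the topology $W^\infty$ on $\mathcal X$). Therefore the inclusion $\mathcal X\cap\mathcal C_{lin}(N,F)\subset\mathcal X$ is a $W^{\infty,\infty}$-homotopy equivalence. -/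

import Mathlib

open Set Topology Manifold ContDiff Bundle

namespace FiberLinearization

/-! ## Smooth maps on a subset of a manifold and the weak Whitney topologies -/

section Whitney

variable {E : Type*} [NormedAddCommGroup E] [NormedSpace ℝ E]
  {H : Type*} [TopologicalSpace H] (I : ModelWithCorners ℝ E H)
  {M : Type*} [TopologicalSpace M] [ChartedSpace H M]
  {E' : Type*} [NormedAddCommGroup E'] [NormedSpace ℝ E']
  {H' : Type*} [TopologicalSpace H'] (J : ModelWithCorners ℝ E' H')
  (N : Set M) (Y : Type*) [TopologicalSpace Y] [ChartedSpace H' Y]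

/-- The space `C^∞(N, Y)` of smooth maps from a subset `N` of a manifold `M` to a manifold `Y`:
functions defined on `N` only. Smoothness up to the boundary of `N` is `ContMDiffOn`, a condition
on the values on `N` alone; the function `g` serves only to have a function on all of `M`, and its
values outside `N` are arbitrary. -/
structure SmoothMapOn where
  toFun : N → Y
  smooth' : ∃ g : M → Y, ContMDiffOn I J ∞ g N ∧ ∀ w : N, g w = toFun w

namespace SmoothMapOn

variable {I J N Y}

instance : CoeFun (SmoothMapOn I J N Y) (fun _ => N → Y) := ⟨SmoothMapOn.toFun⟩

/-- Some function on all of `M` with restriction `f`. It is only ever evaluated, or differentiated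
within `N`, at points of `N`. -/
noncomputable def ext (f : SmoothMapOn I J N Y) : M → Y := Classical.choose f.smooth'

theorem contMDiffOn_ext (f : SmoothMapOn I J N Y) : ContMDiffOn I J ∞ f.ext N :=
  (Classical.choose_spec f.smooth').1

theorem ext_apply (f : SmoothMapOn I J N Y) (w : N) : f.ext w = f w :=
  (Classical.choose_spec f.smooth').2 w

theorem ext_of_mem (f : SmoothMapOn I J N Y) {w : M} (h : w ∈ N) : f.ext w = f ⟨w, h⟩ :=
  f.ext_apply ⟨w, h⟩

/-- The Jacobi matrix of `f` at a point `w` of `N` (tangent map of `f`, computed within `N`). -/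
noncomputable def tangentMapAt (f : SmoothMapOn I J N Y) (w : M) :
    TangentSpace I w →L[ℝ] TangentSpace J (f.ext w) :=
  mfderivWithin I J f.ext N w

/-- Smooth embeddings: topological embeddings with everywhere injective tangent map. -/
def IsSmoothEmbedding (f : SmoothMapOn I J N Y) : Prop :=
  IsEmbedding f.toFun ∧ ∀ w ∈ N, Function.Injective (f.tangentMapAt w)

/-- The local representation of `f` in the charts at `x` in the source and at `y` in the target. -/
noncomputable def localRep (f : SmoothMapOn I J N Y) (x : M) (y : Y) : E → E' :=
  extChartAt J y ∘ f.ext ∘ (extChartAt I x).symm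

/-- The part of `N` in the chart at `x`. -/
def chartDomain (I : ModelWithCorners ℝ E H) (N : Set M) (x : M) : Set E :=
  (extChartAt I x).target ∩ (extChartAt I x).symm ⁻¹' N

/-- The basic neighbourhood of `f` in the weak `C^k` topology: the maps `g` that send the compact
set `K` into the chart at `y` and whose local representation has on `K` all derivatives of order
at most `k` at distance less than `η` from those of `f`. -/
@[reducible] def whitneyNhd (f : SmoothMapOn I J N Y) (x : M) (y : Y) (K : Set M) (k : ℕ) (η : ℝ) :
    Set (SmoothMapOn I J N Y) :=
  {g | (∀ w ∈ K, g.ext w ∈ (extChartAt J y).source) ∧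
    ∀ j ≤ k, ∀ w ∈ K,
      ‖iteratedFDerivWithin ℝ j (g.localRep x y) (chartDomain I N x) (extChartAt I x w) -
        iteratedFDerivWithin ℝ j (f.localRep x y) (chartDomain I N x) (extChartAt I x w)‖ < η}

/-- The weak Whitney topology `W^r`, `r ∈ {0, 1, …, ∞}`, on `C^∞(N, Y)`; `W^∞` is generated by the
union of all `W^r` with `r` finite. -/
@[reducible] def whitney (r : ℕ∞) : TopologicalSpace (SmoothMapOn I J N Y) :=
  TopologicalSpace.generateFrom
    {S | ∃ (f : SmoothMapOn I J N Y) (x : M) (y : Y) (K : Set M) (k : ℕ) (η : ℝ),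
      IsCompact K ∧ K ⊆ N ∩ (extChartAt I x).source ∧
      (∀ w ∈ K, f.ext w ∈ (extChartAt J y).source) ∧ (k : ℕ∞) ≤ r ∧ 0 < η ∧
      S = whitneyNhd f x y K k η}

/-- The topology induced by `W^r` on a set of smooth maps. -/
@[reducible] def whitneyOn (r : ℕ∞) (X : Set (SmoothMapOn I J N Y)) : TopologicalSpace X :=
  (whitney r).induced Subtype.val

end SmoothMapOn

end Whitney

/-- `f` is a homotopy equivalence for the given topologies. -/
def IsHomotopyEquivalence {A B : Type*} (tA : TopologicalSpace A) (tB : TopologicalSpace B)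
    (f : A → B) : Prop :=
  ∃ e : ContinuousMap.HomotopyEquiv A B, ⇑e.toFun = f

/-! ## Vector bundles -/

section Fiber

variable {B F : Type*} {V : B → Type*} [∀ b, AddCommGroup (V b)] [∀ b, Module ℝ (V b)]

/-- Multiplication by scalars `(t, w) ↦ t w` on the total space of a vector bundle. -/
def scale (t : ℝ) (w : TotalSpace F V) : TotalSpace F V := ⟨w.proj, t • w.2⟩

/-- `N` is star-like: `t w ∈ N` for all `w ∈ N` and `t ∈ [0, 1]`. -/
def IsStarlike (N : Set (TotalSpace F V)) : Prop :=
  ∀ w ∈ N, ∀ t ∈ Icc (0 : ℝ) 1, scale t w ∈ N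

end Fiber

/-- The closed tubular neighbourhood `R_ε = {w | ‖w‖ ≤ ε}` of the zero section. -/
def closedTube {B F : Type*} (V : B → Type*) [∀ b, NormedAddCommGroup (V b)] (ε : ℝ) :
    Set (TotalSpace F V) :=
  {w | ‖w.2‖ ≤ ε}

section Maps

variable
  {EB : Type*} [NormedAddCommGroup EB] [NormedSpace ℝ EB]
  {HB : Type*} [TopologicalSpace HB] {IB : ModelWithCorners ℝ EB HB}
  {B : Type*} [TopologicalSpace B] [ChartedSpace HB B]
  {F : Type*} [NormedAddCommGroup F] [NormedSpace ℝ F]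
  {V : B → Type*} [TopologicalSpace (TotalSpace F V)]
  [∀ b, AddCommGroup (V b)] [∀ b, Module ℝ (V b)] [∀ b, TopologicalSpace (V b)]
  [FiberBundle F V] [VectorBundle ℝ F V]
  {EC : Type*} [NormedAddCommGroup EC] [NormedSpace ℝ EC]
  {HC : Type*} [TopologicalSpace HC] {IC : ModelWithCorners ℝ EC HC}
  {C : Type*} [TopologicalSpace C] [ChartedSpace HC C]
  {G : Type*} [NormedAddCommGroup G] [NormedSpace ℝ G]
  {W : C → Type*} [TopologicalSpace (TotalSpace G W)]
  [∀ c, AddCommGroup (W c)] [∀ c, Module ℝ (W c)] [∀ c, TopologicalSpace (W c)]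
  [FiberBundle G W] [VectorBundle ℝ G W]
  {N : Set (TotalSpace F V)}

/-- `g` is a smooth vector bundle morphism: smooth, covering a map `φ` of the bases, and linear on
the fibres. -/
def IsBundleMorphism (IB : ModelWithCorners ℝ EB HB) (IC : ModelWithCorners ℝ EC HC)
    (g : TotalSpace F V → TotalSpace G W) : Prop :=
  ContMDiff (IB.prod 𝓘(ℝ, F)) (IC.prod 𝓘(ℝ, G)) ∞ g ∧
    ∃ (φ : B → C) (L : ∀ b, V b →ₗ[ℝ] W (φ b)), ∀ b (v : V b), g ⟨b, v⟩ = ⟨φ b, L b v⟩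

/-- `C^∞(N, F)` for `N` a subset of the total space of the first bundle and `F` the total space of
the second one. -/
abbrev BundleMap (IB : ModelWithCorners ℝ EB HB) (IC : ModelWithCorners ℝ EC HC)
    (N : Set (TotalSpace F V)) (G : Type*) [NormedAddCommGroup G] [NormedSpace ℝ G]
    (W : C → Type*) [TopologicalSpace (TotalSpace G W)]
    [∀ c, AddCommGroup (W c)] [∀ c, Module ℝ (W c)] [∀ c, TopologicalSpace (W c)]
    [FiberBundle G W] [VectorBundle ℝ G W] :=
  SmoothMapOn (IB.prod 𝓘(ℝ, F)) (IC.prod 𝓘(ℝ, G)) N (TotalSpace G W)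

variable (IB IC N G W)

/-- `C(N, F)`: smooth maps that send the zero section into the zero section. -/
def pairMaps : Set (BundleMap IB IC N G W) :=
  {f | ∀ w : N, (w : TotalSpace F V) ∈ range (zeroSection F V) → f w ∈ range (zeroSection G W)}

/-- `C_lin(N, F)`: the maps in `C(N, F)` that coincide with some vector bundle morphism on a
neighbourhood of the zero section. -/
def linearNearZero : Set (BundleMap IB IC N G W) :=
  {f | f ∈ pairMaps IB IC G W N ∧
    ∃ g : TotalSpace F V → TotalSpace G W, IsBundleMorphism IB IC g ∧
      ∃ U ∈ 𝓝ˢ (range (zeroSection F V)), ∀ w : N, (w : TotalSpace F V) ∈ U → f w = g w}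

variable {IB IC N G W}

/-- The block `P` of the Jacobi matrix `(P Q; R S)` of `f` at the point `b` of the zero section:
the derivatives of the base coordinates of `f` in the base coordinates.

The charts of a total space are by construction trivialized local charts (a local trivialization
followed by a chart of the base), and tangent spaces are read in these charts, so that the tangent
map is the Jacobi matrix of a trivialized local representation of `f`. -/
noncomputable def horizontalBlock (f : BundleMap IB IC N G W) (b : B) : EB →L[ℝ] EC :=
  let A : (EB × F) →L[ℝ] (EC × G) := f.tangentMapAt (zeroSection F V b)
  (ContinuousLinearMap.fst ℝ EC G) ∘L A ∘L (ContinuousLinearMap.inl ℝ EB F)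

/-- The block `S` of the Jacobi matrix of `f` at the point `b` of the zero section: the derivatives
of the fibre coordinates of `f` in the fibre coordinates. -/
noncomputable def verticalBlock (f : BundleMap IB IC N G W) (b : B) : F →L[ℝ] G :=
  let A : (EB × F) →L[ℝ] (EC × G) := f.tangentMapAt (zeroSection F V b)
  (ContinuousLinearMap.snd ℝ EC G) ∘L A ∘L (ContinuousLinearMap.inr ℝ EB F)

/-- The horizontal rank of `f` at the point `b` of the zero section. -/
noncomputable def horizontalRank (f : BundleMap IB IC N G W) (b : B) : ℕ :=
  Module.finrank ℝ (LinearMap.range (horizontalBlock f b : EB →ₗ[ℝ] EC))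

/-- The vertical rank of `f` at the point `b` of the zero section. -/
noncomputable def verticalRank (f : BundleMap IB IC N G W) (b : B) : ℕ :=
  Module.finrank ℝ (LinearMap.range (verticalBlock f b : F →ₗ[ℝ] G))

/-- The tangent map `T_fib f : E → F` of `f` along the zero section in the direction of fibres, in
local trivializations `(x, v) ↦ (f (x, 0), S(x, 0) v)`. -/
noncomputable def fiberDeriv (f : BundleMap IB IC N G W) (w : TotalSpace F V) : TotalSpace G W :=
  let c : C := (f.ext (zeroSection F V w.proj)).proj
  ⟨c, (trivializationAt G W c).symm c
    (verticalBlock f w.proj (trivializationAt F V w.proj w).2)⟩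

open Classical in
/-- The homotopy `α_f(τ, w) = f(τ w) / τ` for `τ ≠ 0`, and `α_f(0, w) = T_fib f (w)`. -/
noncomputable def hadamardHomotopy (f : BundleMap IB IC N G W) (τ : ℝ) (w : TotalSpace F V) :
    TotalSpace G W :=
  if τ = 0 then fiberDeriv f w else scale τ⁻¹ (f.ext (scale τ w))

variable (IB IC N G W)

/-- Maps in `C(N, F)` with horizontal rank at least `a` along the zero section. -/
def horizontalRankGE (a : ℕ) : Set (BundleMap IB IC N G W) :=
  {f | f ∈ pairMaps IB IC G W N ∧ ∀ b : B, a ≤ horizontalRank f b}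

/-- Maps in `C(N, F)` with vertical rank at least `b` along the zero section. -/
def verticalRankGE (b : ℕ) : Set (BundleMap IB IC N G W) :=
  {f | f ∈ pairMaps IB IC G W N ∧ ∀ x : B, b ≤ verticalRank f x}

/-- Maps in `C(N, F)` with horizontal rank at least `a` and vertical rank at least `b` along the
zero section. -/
def bothRanksGE (a b : ℕ) : Set (BundleMap IB IC N G W) :=
  horizontalRankGE IB IC G W N a ∩ verticalRankGE IB IC G W N b

/-- Maps in `C(N, F)` that are embeddings. -/
def embeddings : Set (BundleMap IB IC N G W) :=
  {f | f ∈ pairMaps IB IC G W N ∧ f.IsSmoothEmbedding}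

/-- Embeddings with horizontal rank `dim B` and vertical rank `rank E` along the zero section. -/
noncomputable def maximalRankEmbeddings : Set (BundleMap IB IC N G W) :=
  {f | f ∈ bothRanksGE IB IC G W N (Module.finrank ℝ EB) (Module.finrank ℝ F) ∧
    f.IsSmoothEmbedding}

end Maps

section Linearizing

variable
  {EB : Type*} [NormedAddCommGroup EB] [NormedSpace ℝ EB]
  {HB : Type*} [TopologicalSpace HB] {IB : ModelWithCorners ℝ EB HB}
  {B : Type*} [TopologicalSpace B] [ChartedSpace HB B]
  {F : Type*} [NormedAddCommGroup F] [NormedSpace ℝ F]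
  {V : B → Type*} [TopologicalSpace (TotalSpace F V)]
  [∀ b, NormedAddCommGroup (V b)] [∀ b, InnerProductSpace ℝ (V b)]
  [FiberBundle F V] [VectorBundle ℝ F V]
  {EC : Type*} [NormedAddCommGroup EC] [NormedSpace ℝ EC]
  {HC : Type*} [TopologicalSpace HC] {IC : ModelWithCorners ℝ EC HC}
  {C : Type*} [TopologicalSpace C] [ChartedSpace HC C]
  {G : Type*} [NormedAddCommGroup G] [NormedSpace ℝ G]
  {W : C → Type*} [TopologicalSpace (TotalSpace G W)]
  [∀ c, AddCommGroup (W c)] [∀ c, Module ℝ (W c)] [∀ c, TopologicalSpace (W c)]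
  [FiberBundle G W] [VectorBundle ℝ G W]
  {N : Set (TotalSpace F V)}

/-- The function `φ(δ, t, w) = t + (1 - t) μ(‖w‖ / δ)`. -/
noncomputable def cutoffScale (μ : ℝ → ℝ) (δ t : ℝ) (w : TotalSpace F V) : ℝ :=
  t + (1 - t) * μ (‖w.2‖ / δ)

/-- The value `w ↦ α_f(φ(δ, t, w), w)`, `w ∈ N`, of the linearizing homotopy at the map `f`, the
width `δ > 0` and the time `t`. -/
noncomputable def linearizing (μ : ℝ → ℝ) (f : BundleMap IB IC N G W) (δ t : ℝ) (w : N) :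
    TotalSpace G W :=
  hadamardHomotopy f (cutoffScale μ δ t (w : TotalSpace F V)) w

end Linearizing

end FiberLinearization

/-!
The family `α_f(τ, w) = τ⁻¹ f(τ w)` extends to `τ = 0` by `T_fib f`, because `f` maps the zero
section to the zero section: in bundle charts, where `f = (f₁, f₂)` and `f₂(x, 0) = 0`, Hadamard's
lemma gives `τ⁻¹ f₂(x, τ v) = ∫₀¹ ∂₂f₂(x, s τ v) v ds`. The right hand side makes sense for all
`τ`, and its jets of order `n` in `(x, v)` depend continuously on `(τ, x, v)` and on the jets of
`f` of order `n + 1`. "Jets depend continuously on a parameter and on the point" is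
`JetConvergentAt`; it is stable under composition and integration, and continuity for the weak
Whitney topology is the same as `JetConvergentAt` in charts (`jetConvergentAt_localRep`,
`tendsto_whitney_of_jetConvergentAt`). Hence the linearizing homotopy is continuous for `W^∞` as
soon as the width `δ` is continuous (`jetConvergentAt_linearizing`, `continuous_linearizedMap`).

The homotopy changes neither the restriction of `f` to the zero section nor `T_fib f`, so the two
blocks `P` and `S` of the Jacobi matrix are constant along it. It starts at a map that is
`T_fib f` near the zero section, it ends at `f`, and it is stationary near the zero section if `f` is
linear there. So, whenever it preserves a space of maps, the inclusion of the maps linear near the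
zero section is a homotopy equivalence (`linearizing_conclusion`), and for the spaces defined by
rank conditions any constant width will do.

For embeddings of maximal rank the width has to be small. Conjugating `H(f, t)` with width `δ` by
the dilation `δ⁻¹` gives `w ↦ α_f(δ φ(w), w)` with `φ` independent of `δ`, and this tends to
`T_fib f₀` with its first derivatives as `δ → 0` and `f → f₀`. As `T_fib f₀` is an injective
immersion, so is the conjugated map on a fixed tube, and a compactness argument separates the
points of the tube from those outside (`exists_width_of_maximalRankEmbedding`). The widths found
near each `f₀` are glued by a partition of unity, which exists because `W^3` is pseudometrizable
(`SmoothMapOn.pseudoMetrizableSpace_whitney`, `exists_continuous_width`). Finally, if the base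
spaces have equal dimensions, then the Jacobi matrix of an embedding is injective and block
triangular with a square block `P`; so `P` is invertible, and then `S` is injective as well
(`embeddings_eq_maximalRankEmbeddings`).
-/

set_option linter.unusedSectionVars false

namespace FiberLinearization

open Filter

/-! ### Families with convergent jets -/

section Families

variable {A E F G : Type*} [NormedAddCommGroup E] [NormedSpace ℝ E]
  [NormedAddCommGroup F] [NormedSpace ℝ F] [NormedAddCommGroup G] [NormedSpace ℝ G]

/-- A family `g a`, `a → l`, of maps between normed spaces is *jet-convergent of order `n`* at the
point `z₀` of `S` if, on a neighbourhood of `z₀` in `S` that does not depend on `a`, the maps `g a`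
are eventually of class `C^n`, and their derivatives of order at most `n` at `z` converge as
`a → l` and `z → z₀` jointly. For `l = 𝓝 a₀` this says that the `n`-jet of `g a` at `z` depends
continuously on `(a, z)` at `(a₀, z₀)`. As in `ContDiffWithinAt`, derivatives are encoded by a
Taylor series, so that no unique differentiability of `S` is needed. -/
def JetConvergentAt (l : Filter A) (n : ℕ) (g : A → E → G) (S : Set E) (z₀ : E) : Prop :=
  ∃ p : A → E → FormalMultilinearSeries ℝ E G, ∃ p₀ : FormalMultilinearSeries ℝ E G,
    ∃ u ∈ 𝓝[S] z₀, (∀ᶠ a in l, HasFTaylorSeriesUpToOn n (g a) (p a) u) ∧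
      ∀ j ≤ n, Tendsto (fun q : A × E => p q.1 q.2 j) (l ×ˢ 𝓝[S] z₀) (𝓝 (p₀ j))

namespace JetConvergentAt

variable {l l' : Filter A} {n m : ℕ} {g : A → E → G} {S T : Set E} {z₀ : E}

theorem mono_filter (h : JetConvergentAt l n g S z₀) (hl : l' ≤ l) :
    JetConvergentAt l' n g S z₀ := by
  obtain ⟨p, p₀, u, hu, h1, h2⟩ := h
  exact ⟨p, p₀, u, hu, h1.filter_mono hl, fun j hj => (h2 j hj).mono_left (prod_mono_left _ hl)⟩

theorem comp_param {A' : Type*} {l' : Filter A'} {φ : A' → A} (h : JetConvergentAt l n g S z₀)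
    (hφ : Tendsto φ l' l) : JetConvergentAt l' n (fun a => g (φ a)) S z₀ := by
  obtain ⟨p, p₀, u, hu, h1, h2⟩ := h
  exact ⟨fun a => p (φ a), p₀, u, hu, hφ.eventually h1,
    fun j hj => (h2 j hj).comp (hφ.prodMap tendsto_id)⟩

theorem of_le (h : JetConvergentAt l n g S z₀) (hm : m ≤ n) : JetConvergentAt l m g S z₀ := by
  obtain ⟨p, p₀, u, hu, h1, h2⟩ := h
  exact ⟨p, p₀, u, hu, h1.mono fun a ha => ha.of_le (by exact_mod_cast hm),
    fun j hj => h2 j (hj.trans hm)⟩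

theorem mono_nhdsWithin (h : JetConvergentAt l n g S z₀) (hT : 𝓝[T] z₀ ≤ 𝓝[S] z₀) :
    JetConvergentAt l n g T z₀ := by
  obtain ⟨p, p₀, u, hu, h1, h2⟩ := h
  exact ⟨p, p₀, u, hT hu, h1, fun j hj => (h2 j hj).mono_left (prod_mono_right _ hT)⟩

theorem mono (h : JetConvergentAt l n g S z₀) (hT : T ⊆ S) : JetConvergentAt l n g T z₀ :=
  h.mono_nhdsWithin (nhdsWithin_mono _ hT)

theorem congr {g' : A → E → G} (h : JetConvergentAt l n g S z₀)
    (hg : ∀ᶠ q : A × E in l ×ˢ 𝓝[S] z₀, g' q.1 q.2 = g q.1 q.2) :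
    JetConvergentAt l n g' S z₀ := by
  obtain ⟨p, p₀, u, hu, h1, h2⟩ := h
  obtain ⟨P, hP, Q, hQ, hPQ⟩ := eventually_prod_iff.1 hg
  refine ⟨p, p₀, u ∩ {z | Q z}, inter_mem hu hQ, ?_, h2⟩
  filter_upwards [h1, hP] with a ha1 ha2
  exact (ha1.mono inter_subset_left).congr fun z hz => hPQ ha2 hz.2

theorem exists_tendsto (h : JetConvergentAt l n g S z₀) :
    ∃ y, Tendsto (fun q : A × E => g q.1 q.2) (l ×ˢ 𝓝[S] z₀) (𝓝 y) := by
  obtain ⟨p, p₀, u, hu, h1, h2⟩ := h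
  refine ⟨(p₀ 0).curry0, ?_⟩
  have := ((continuousMultilinearCurryFin0 ℝ E G).continuous.tendsto _).comp (h2 0 (Nat.zero_le _))
  refine this.congr' ?_
  filter_upwards [h1.prod_mk hu] with q hq
  exact hq.1.zero_eq _ hq.2

theorem tendsto_of_pure {a₀ : A} (h : JetConvergentAt l n g S z₀) (ha : pure a₀ ≤ l)
    (hz : z₀ ∈ S) : Tendsto (fun q : A × E => g q.1 q.2) (l ×ˢ 𝓝[S] z₀) (𝓝 (g a₀ z₀)) := by
  obtain ⟨y, hy⟩ := h.exists_tendsto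
  have h1 : pure (a₀, z₀) ≤ l ×ˢ 𝓝[S] z₀ := by
    rw [← prod_pure_pure]; exact prod_mono ha (pure_le_nhdsWithin hz)
  have h2 := hy.mono_left h1
  rwa [tendsto_nhds_unique h2 (tendsto_pure_nhds _ _)] at hy

theorem contDiffWithinAt {a₀ : A} (h : JetConvergentAt l n g S z₀) (ha : pure a₀ ≤ l)
    (hz : z₀ ∈ S) : ContDiffWithinAt ℝ n (g a₀) S z₀ := by
  obtain ⟨p, p₀, u, hu, h1, h2⟩ := h
  have h3 := ha h1
  have : HasFTaylorSeriesUpToOn n (g a₀) (p a₀) u := h3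
  exact (this.contDiffOn z₀ (mem_of_mem_nhdsWithin hz hu)).mono_of_mem_nhdsWithin hu

end JetConvergentAt

theorem _root_.ContDiffWithinAt.jetConvergentAt {n : ℕ} {f : E → G} {S : Set E} {z₀ : E}
    (h : ContDiffWithinAt ℝ n f S z₀) (hz : z₀ ∈ S) (l : Filter A) :
    JetConvergentAt l n (fun _ => f) S z₀ := by
  obtain ⟨u, hu, p, hp⟩ := contDiffWithinAt_nat.1 h
  rw [insert_eq_of_mem hz] at hu
  refine ⟨fun _ => p, p z₀, u, hu, Eventually.of_forall fun _ => hp, fun j hj => ?_⟩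
  have h1 := (hp.cont j (by exact_mod_cast hj)) z₀ (mem_of_mem_nhdsWithin hz hu)
  have h2 : 𝓝[S] z₀ ≤ 𝓝[u] z₀ := nhdsWithin_le_iff.2 hu
  exact (h1.mono_left h2).comp tendsto_snd

namespace JetConvergentAt

variable {l : Filter A} {n : ℕ} {S : Set E} {z₀ : E}

theorem tendsto_taylorComp {X : Type*} {L : Filter X} {q : X → FormalMultilinearSeries ℝ F G}
    {p : X → FormalMultilinearSeries ℝ E F} {q₀ : FormalMultilinearSeries ℝ F G}
    {p₀ : FormalMultilinearSeries ℝ E F} {n j : ℕ} (hj : j ≤ n)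
    (hq : ∀ i ≤ n, Tendsto (fun x => q x i) L (𝓝 (q₀ i)))
    (hp : ∀ i ≤ n, Tendsto (fun x => p x i) L (𝓝 (p₀ i))) :
    Tendsto (fun x => (q x).taylorComp (p x) j) L (𝓝 (q₀.taylorComp p₀ j)) := by
  simp only [FormalMultilinearSeries.taylorComp]
  refine tendsto_finsetSum _ fun c _ => ?_
  have hB := (c.compAlongOrderedFinpartitionL ℝ E F G).analyticOnNhd_uncurry_of_multilinear
    (s := univ)
  have hB' := (hB (q₀ c.length, fun m => p₀ (c.partSize m)) (mem_univ _)).continuousAt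
  refine hB'.tendsto.comp (f := fun x => (q x c.length, fun m => p x (c.partSize m))) ?_
  exact (hq _ (c.length_le.trans hj)).prodMk_nhds
    (tendsto_pi_nhds.2 fun m => hp _ ((c.partSize_le m).trans hj))

theorem comp {f : A → F → G} {g : A → E → F} {T : Set F} {y₀ : F}
    (hf : JetConvergentAt l n f T y₀) (hg : JetConvergentAt l n g S z₀)
    (ht : Tendsto (fun q : A × E => g q.1 q.2) (l ×ˢ 𝓝[S] z₀) (𝓝[T] y₀)) :
    JetConvergentAt l n (fun a z => f a (g a z)) S z₀ := by
  obtain ⟨p, p₀, u, hu, hp1, hp2⟩ := hf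
  obtain ⟨q, q₀, v, hv, hq1, hq2⟩ := hg
  obtain ⟨P, hP, Q, hQ, hPQ⟩ := eventually_prod_iff.1 (ht.eventually hu)
  refine ⟨fun a z => (p a (g a z)).taylorComp (q a z), p₀.taylorComp q₀, v ∩ {z | Q z},
    inter_mem hv hQ, ?_, fun j hj => ?_⟩
  · filter_upwards [hp1, hq1, hP] with a h1 h2 h3
    exact h1.comp (h2.mono inter_subset_left) fun z hz => hPQ h3 hz.2
  · refine tendsto_taylorComp hj (fun i hi => ?_) hq2
    exact (hp2 i hi).comp (tendsto_fst.prodMk ht)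

theorem prodMk {f : A → E → F} {g : A → E → G} (hf : JetConvergentAt l n f S z₀)
    (hg : JetConvergentAt l n g S z₀) : JetConvergentAt l n (fun a z => (f a z, g a z)) S z₀ := by
  obtain ⟨p, p₀, u, hu, hp1, hp2⟩ := hf
  obtain ⟨q, q₀, v, hv, hq1, hq2⟩ := hg
  refine ⟨fun a z k => (p a z k).prod (q a z k), fun k => (p₀ k).prod (q₀ k), u ∩ v,
    inter_mem hu hv, ?_, fun j hj => ?_⟩
  · filter_upwards [hp1, hq1] with a h1 h2
    exact (h1.mono inter_subset_left).prodMk (h2.mono inter_subset_right)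
  · exact ((ContinuousMultilinearMap.prodL ℝ (fun _ : Fin j => E) F G).continuous.tendsto _).comp
      ((hp2 j hj).prodMk_nhds (hq2 j hj))

theorem comp_contDiffWithinAt {f : F → G} {g : A → E → F} {T : Set F} {y₀ : F}
    (hf : ContDiffWithinAt ℝ n f T y₀) (hy : y₀ ∈ T) (hg : JetConvergentAt l n g S z₀)
    (ht : Tendsto (fun q : A × E => g q.1 q.2) (l ×ˢ 𝓝[S] z₀) (𝓝[T] y₀)) :
    JetConvergentAt l n (fun a z => f (g a z)) S z₀ :=
  (hf.jetConvergentAt hy l).comp hg ht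

/-- A family of constant maps. -/
theorem const {c : A → G} {y : G} (hc : Tendsto c l (𝓝 y)) :
    JetConvergentAt l n (fun a (_ : E) => c a) S z₀ := by
  refine ⟨fun a => _root_.ftaylorSeries ℝ (fun _ : E => c a),
    _root_.ftaylorSeries ℝ (fun _ : E => y) z₀, univ,
    univ_mem, Eventually.of_forall fun a => ?_, fun j _ => ?_⟩
  · have : ContDiff ℝ n (fun _ : E => c a) := contDiff_const
    exact (contDiff_iff_ftaylorSeries.1 this).hasFTaylorSeriesUpToOn _
  · rcases Nat.eq_zero_or_pos j with rfl | hj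
    · simp only [_root_.ftaylorSeries, iteratedFDeriv_zero_eq_comp]
      exact (((continuousMultilinearCurryFin0 ℝ E G).symm.continuous.tendsto _).comp hc).comp
        tendsto_fst
    · simp only [_root_.ftaylorSeries, iteratedFDeriv_const_of_ne (𝕜 := ℝ) (E := E) hj.ne']
      exact tendsto_const_nhds

/-- A smooth map of `(a, z)` is a jet-convergent family of maps of `z`. -/
theorem of_uncurry {P : Type*} [NormedAddCommGroup P] [NormedSpace ℝ P] {f : P × E → G}
    {SP : Set P} {p₀ : P} (hf : ContDiffWithinAt ℝ n f (SP ×ˢ S) (p₀, z₀)) (hp : p₀ ∈ SP)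
    (hz : z₀ ∈ S) {c : A → P} (hc : Tendsto c l (𝓝[SP] p₀)) :
    JetConvergentAt l n (fun a z => f (c a, z)) S z₀ := by
  have h1 : JetConvergentAt l n (fun a (z : E) => (c a, z)) S z₀ :=
    (const (hc.mono_right nhdsWithin_le_nhds)).prodMk
      (contDiffWithinAt_id.jetConvergentAt hz l)
  refine comp_contDiffWithinAt hf ⟨hp, hz⟩ h1 ?_
  rw [nhdsWithin_prod_eq]
  exact hc.prodMap tendsto_id

section UniqueDiff

variable {g : A → E → G}

theorem exists_isOpen_contDiffOn (h : JetConvergentAt l n g S z₀) :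
    ∃ o, IsOpen o ∧ z₀ ∈ o ∧ ∀ᶠ a in l, ContDiffOn ℝ n (g a) (S ∩ o) := by
  obtain ⟨p, p₀, u, hu, h1, -⟩ := h
  obtain ⟨o, ho, hz, hou⟩ := mem_nhdsWithin.1 hu
  refine ⟨o, ho, hz, h1.mono fun a ha => (ha.contDiffOn).mono ?_⟩
  rwa [inter_comm]

theorem exists_tendsto_iteratedFDerivWithin (h : JetConvergentAt l n g S z₀)
    (hS : UniqueDiffOn ℝ S) {j : ℕ} (hj : j ≤ n) :
    ∃ q, Tendsto (fun x : A × E => iteratedFDerivWithin ℝ j (g x.1) S x.2) (l ×ˢ 𝓝[S] z₀)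
      (𝓝 q) := by
  obtain ⟨p, p₀, u, hu, h1, h2⟩ := h
  obtain ⟨o, ho, hz, hou⟩ := mem_nhdsWithin.1 hu
  refine ⟨p₀ j, (h2 j hj).congr' ?_⟩
  have : S ∩ o ∈ 𝓝[S] z₀ := inter_mem_nhdsWithin _ (ho.mem_nhds hz)
  filter_upwards [h1.prod_mk this] with x hx
  rw [← iteratedFDerivWithin_inter_open ho hx.2.2]
  refine (hx.1.mono ?_).eq_iteratedFDerivWithin_of_uniqueDiffOn (by exact_mod_cast hj)
    (hS.inter ho) hx.2
  rwa [inter_comm]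

theorem of_iteratedFDerivWithin (hS : UniqueDiffOn ℝ S) {o : Set E} (ho : IsOpen o) (hz : z₀ ∈ o)
    (h1 : ∀ᶠ a in l, ContDiffOn ℝ n (g a) (S ∩ o))
    (h2 : ∀ j ≤ n, ∃ q, Tendsto (fun x : A × E => iteratedFDerivWithin ℝ j (g x.1) S x.2)
      (l ×ˢ 𝓝[S] z₀) (𝓝 q)) : JetConvergentAt l n g S z₀ := by
  have h3 : ∀ j, ∃ q, j ≤ n → Tendsto (fun x : A × E => iteratedFDerivWithin ℝ j (g x.1) S x.2)
      (l ×ˢ 𝓝[S] z₀) (𝓝 q) := fun j => by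
    by_cases hj : j ≤ n
    · exact (h2 j hj).imp fun q hq _ => hq
    · exact ⟨0, fun h => absurd h hj⟩
  choose q hq using h3
  refine ⟨fun a => ftaylorSeriesWithin ℝ (g a) (S ∩ o), q, S ∩ o,
    inter_mem_nhdsWithin _ (ho.mem_nhds hz), ?_, fun j hj => (hq j hj).congr' ?_⟩
  · filter_upwards [h1] with a ha
    exact ha.ftaylorSeriesWithin (hS.inter ho)
  · have : ∀ᶠ x : A × E in l ×ˢ 𝓝[S] z₀, x.2 ∈ o :=
      tendsto_snd.eventually (mem_nhdsWithin_of_mem_nhds (ho.mem_nhds hz))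
    filter_upwards [this] with x hx
    exact (iteratedFDerivWithin_inter_open ho hx).symm

theorem fderivWithin (h : JetConvergentAt l (n + 1) g S z₀) (hS : UniqueDiffOn ℝ S) :
    JetConvergentAt l n (fun a => _root_.fderivWithin ℝ (g a) S) S z₀ := by
  obtain ⟨p, p₀, u, hu, h1, h2⟩ := h
  obtain ⟨o, ho, hz, hou⟩ := mem_nhdsWithin.1 hu
  have hou' : S ∩ o ⊆ u := by rwa [inter_comm]
  refine ⟨fun a z => (p a z).shift, p₀.shift, S ∩ o, inter_mem_nhdsWithin _ (ho.mem_nhds hz), ?_,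
    fun j hj => ?_⟩
  · filter_upwards [h1] with a ha
    have ha' : HasFTaylorSeriesUpToOn ((n + 1 : ℕ) : WithTop ℕ∞) (g a) (p a) (S ∩ o) := ha.mono hou'
    refine ha'.shift_of_succ.congr fun z hz' => ?_
    have h3 := ha'.hasFDerivWithinAt (by simp) hz'
    exact (h3.mono_of_mem_nhdsWithin
      (inter_mem_nhdsWithin _ (ho.mem_nhds hz'.2))).fderivWithin (hS z hz'.1)
  · exact ((continuousMultilinearCurryRightEquiv' ℝ j E G).continuous.tendsto _).comp
      (h2 (j + 1) (by omega))

end UniqueDiff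

end JetConvergentAt

end Families

/-! ### Integrals of families with convergent jets -/

section Integral

open MeasureTheory intervalIntegral

variable {E V X : Type*} [NormedAddCommGroup E] [NormedSpace ℝ E]
  [NormedAddCommGroup V] [NormedSpace ℝ V]

/-- A jointly defined limit along a compact parameter interval is a uniform limit. -/
theorem tendstoUniformlyOn_of_tendsto_prod_nhdsWithin {L : Filter X} {φ : X → ℝ → V} {φ₀ : ℝ → V}
    {K : Set ℝ} (hK : IsCompact K)
    (h : ∀ s ∈ K, Tendsto (fun q : X × ℝ => φ q.1 q.2) (L ×ˢ 𝓝[K] s) (𝓝 (φ₀ s))) :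
    TendstoUniformlyOn φ φ₀ L K := by
  rcases L.eq_or_neBot with rfl | hL
  · intro u _; simp
  refine (tendstoLocallyUniformlyOn_iff_tendstoUniformlyOn_of_compact hK).1 ?_
  rw [Metric.tendstoLocallyUniformlyOn_iff]
  intro ε hε s hs
  have h1 := Metric.tendsto_nhds.1 (h s hs) (ε / 2) (half_pos hε)
  obtain ⟨P, hP, Q, hQ, hPQ⟩ := eventually_prod_iff.1 h1
  have h2 : ∀ s' ∈ K, Q s' → dist (φ₀ s') (φ₀ s) ≤ ε / 2 := fun s' hs' hq => by
    have h3 : Tendsto (fun x => φ x s') L (𝓝 (φ₀ s')) :=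
      (h s' hs').comp (tendsto_id.prodMk (tendsto_const_pure.mono_right (pure_le_nhdsWithin hs')))
    refine le_of_tendsto (h3.dist tendsto_const_nhds) ?_
    filter_upwards [hP] with x hx using (hPQ hx hq).le
  refine ⟨{s' | Q s'} ∩ K, inter_mem hQ self_mem_nhdsWithin, ?_⟩
  filter_upwards [hP] with x hx s' hs'
  have h4 := hPQ hx hs'.1
  have h5 := h2 s' hs'.2 hs'.1
  calc dist (φ₀ s') (φ x s') ≤ dist (φ₀ s') (φ₀ s) + dist (φ x s') (φ₀ s) :=
        dist_triangle_right _ _ _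
    _ < ε / 2 + ε / 2 := by simp only at h4; linarith
    _ = ε := add_halves ε

theorem tendsto_integral_of_tendstoUniformlyOn {L : Filter X} {φ : X → ℝ → V} {φ₀ : ℝ → V}
    (h : TendstoUniformlyOn φ φ₀ L (Icc 0 1)) (hφ : ∀ᶠ x in L, ContinuousOn (φ x) (Icc 0 1)) :
    Tendsto (fun x => ∫ s in (0 : ℝ)..1, φ x s) L (𝓝 (∫ s in (0 : ℝ)..1, φ₀ s)) := by
  rcases L.eq_or_neBot with rfl | hL
  · simp
  have h0 : ContinuousOn φ₀ (Icc 0 1) := h.continuousOn hφ.frequently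
  rw [Metric.tendsto_nhds]
  intro ε hε
  filter_upwards [Metric.tendstoUniformlyOn_iff.1 h (ε / 2) (half_pos hε), hφ] with x hx hc
  have i1 : IntervalIntegrable (φ x) volume 0 1 :=
    ContinuousOn.intervalIntegrable (by rwa [uIcc_of_le zero_le_one])
  have i2 : IntervalIntegrable φ₀ volume 0 1 :=
    ContinuousOn.intervalIntegrable (by rwa [uIcc_of_le zero_le_one])
  rw [dist_eq_norm, ← integral_sub i1 i2]
  have := norm_integral_le_of_norm_le_const (a := (0 : ℝ)) (b := 1) (C := ε / 2)
    (f := fun s => φ x s - φ₀ s) fun s hs => by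
      rw [uIoc_of_le zero_le_one] at hs
      rw [← dist_eq_norm, dist_comm]
      exact (hx s ⟨hs.1.le, hs.2⟩).le
  simp only [sub_zero, abs_one, mul_one] at this
  linarith

/-- Differentiation under the integral sign on a convex set, which may fail to be open: the mean
value inequality within the set replaces the usual argument on balls. -/
theorem hasFDerivWithinAt_integral_of_convex {φ : ℝ → E → V} {φ' : ℝ → E → E →L[ℝ] V} {u : Set E}
    {z₀ : E} (hu : Convex ℝ u) (hz₀ : z₀ ∈ u)
    (hd : ∀ s ∈ Icc (0 : ℝ) 1, ∀ z ∈ u, HasFDerivWithinAt (φ s) (φ' s z) u z)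
    (hc : ∀ z ∈ u, ContinuousOn (fun s => φ s z) (Icc 0 1))
    (hc' : ContinuousOn (fun q : ℝ × E => φ' q.1 q.2) (Icc 0 1 ×ˢ u)) :
    HasFDerivWithinAt (fun z => ∫ s in (0 : ℝ)..1, φ s z) (∫ s in (0 : ℝ)..1, φ' s z₀) u z₀ := by
  have hci : ∀ z ∈ u, IntervalIntegrable (fun s => φ s z) volume 0 1 := fun z hz =>
    ContinuousOn.intervalIntegrable (by rw [uIcc_of_le zero_le_one]; exact hc z hz)
  have hc1 : ContinuousOn (fun s => φ' s z₀) (Icc 0 1) :=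
    hc'.comp (f := fun s => (s, z₀)) (by fun_prop) fun s hs => ⟨hs, hz₀⟩
  have hci' : IntervalIntegrable (fun s => φ' s z₀) volume 0 1 :=
    ContinuousOn.intervalIntegrable (by rwa [uIcc_of_le zero_le_one])
  rw [hasFDerivWithinAt_iff_isLittleO, Asymptotics.isLittleO_iff]
  intro ε hε
  have hsw : ContinuousOn (Function.uncurry fun z s => φ' s z) (u ×ˢ Icc 0 1) :=
    hc'.comp (f := Prod.swap) (by fun_prop) fun q hq => ⟨hq.2, hq.1⟩
  obtain ⟨v, hv, hvε⟩ := isCompact_Icc.mem_uniformity_of_prod hsw hz₀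
    (Metric.dist_mem_uniformity hε)
  obtain ⟨r, hr, hrv⟩ := Metric.mem_nhdsWithin_iff.1 hv
  filter_upwards [inter_mem_nhdsWithin u (Metric.ball_mem_nhds z₀ hr)] with z hz
  have hconv : Convex ℝ (u ∩ Metric.ball z₀ r) := hu.inter (convex_ball _ _)
  have key : ∀ s ∈ Icc (0 : ℝ) 1, ‖φ s z - φ s z₀ - φ' s z₀ (z - z₀)‖ ≤ ε * ‖z - z₀‖ := by
    intro s hs
    refine hconv.norm_image_sub_le_of_norm_hasFDerivWithin_le' (f' := φ' s)
      (fun y hy => (hd s hs y hy.1).mono inter_subset_left) (fun y hy => ?_)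
      ⟨hz₀, Metric.mem_ball_self hr⟩ hz
    rw [← dist_eq_norm]
    exact (hvε y (hrv ⟨hy.2, hy.1⟩) s hs).le
  have e1 : (∫ s in (0 : ℝ)..1, φ' s z₀) (z - z₀) = ∫ s in (0 : ℝ)..1, φ' s z₀ (z - z₀) :=
    ContinuousLinearMap.intervalIntegral_apply hci' _
  have i3 : IntervalIntegrable (fun s => φ' s z₀ (z - z₀)) volume 0 1 :=
    ContinuousOn.intervalIntegrable (by
      rw [uIcc_of_le zero_le_one]; exact hc1.clm_apply continuousOn_const)
  rw [e1, ← integral_sub (hci z hz.1) (hci z₀ hz₀),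
    ← integral_sub ((hci z hz.1).sub (hci z₀ hz₀)) i3]
  have := norm_integral_le_of_norm_le_const (a := (0 : ℝ)) (b := 1) (C := ε * ‖z - z₀‖)
    (f := fun s => φ s z - φ s z₀ - φ' s z₀ (z - z₀)) fun s hs => by
      rw [uIoc_of_le zero_le_one] at hs
      exact key s ⟨hs.1.le, hs.2⟩
  simpa using this

theorem hasFDerivWithinAt_integral_comp_of_convex {V' : Type*} [NormedAddCommGroup V']
    [NormedSpace ℝ V'] [CompleteSpace V] [CompleteSpace V'] (C : V' →L[ℝ] E →L[ℝ] V)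
    {φ : ℝ → E → V} {ψ : ℝ → E → V'} {u : Set E}
    {z₀ : E} (hu : Convex ℝ u) (hz₀ : z₀ ∈ u)
    (hd : ∀ s ∈ Icc (0 : ℝ) 1, ∀ z ∈ u, HasFDerivWithinAt (φ s) (C (ψ s z)) u z)
    (hc : ∀ z ∈ u, ContinuousOn (fun s => φ s z) (Icc 0 1))
    (hc' : ContinuousOn (fun q : ℝ × E => ψ q.1 q.2) (Icc 0 1 ×ˢ u)) :
    HasFDerivWithinAt (fun z => ∫ s in (0 : ℝ)..1, φ s z) (C (∫ s in (0 : ℝ)..1, ψ s z₀)) u z₀ := by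
  have hi : IntervalIntegrable (fun s => ψ s z₀) volume 0 1 :=
    ContinuousOn.intervalIntegrable (by
      rw [uIcc_of_le zero_le_one]
      exact hc'.comp (f := fun s => (s, z₀)) (by fun_prop) fun s hs => ⟨hs, hz₀⟩)
  rw [← ContinuousLinearMap.intervalIntegral_comp_comm C hi]
  exact hasFDerivWithinAt_integral_of_convex (φ' := fun s z => C (ψ s z)) hu hz₀ hd hc
    (C.continuous.comp_continuousOn hc')

variable {A G : Type*} [NormedAddCommGroup G] [NormedSpace ℝ G] {l : Filter A} {n : ℕ} {S : Set E}
  {z₀ : E}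

/-- Restriction of a Taylor series in two variables to the second variable. -/
theorem _root_.HasFTaylorSeriesUpToOn.slice {k : ℝ × E → G} {n : WithTop ℕ∞}
    {R : ℝ × E → FormalMultilinearSeries ℝ (ℝ × E) G} {I : Set ℝ} {u : Set E}
    (h : HasFTaylorSeriesUpToOn n k R (I ×ˢ u)) {s : ℝ} (hs : s ∈ I) :
    HasFTaylorSeriesUpToOn n (fun z => k (s, z)) (fun z j => (R (s, z) j).compContinuousLinearMap
      (fun _ => ContinuousLinearMap.inr ℝ ℝ E)) u := by
  have hm : MapsTo (fun z : E => (s, z)) u (I ×ˢ u) := fun z hz => ⟨hs, hz⟩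
  constructor
  · intro z hz
    exact h.zero_eq _ (hm hz)
  · intro m hmn z hz
    have h1 := (h.fderivWithin m hmn (s, z) (hm hz)).comp (f := fun z : E => (s, z)) z
      ((hasFDerivAt_prodMk_right s z).hasFDerivWithinAt) hm
    have h2 := (ContinuousMultilinearMap.compContinuousLinearMapL (𝕜 := ℝ) (ι := Fin m) (F := G)
      (fun _ => ContinuousLinearMap.inr ℝ ℝ E)).hasFDerivAt.comp_hasFDerivWithinAt z h1
    refine h2.congr_fderiv ?_
    ext v w
    simp only [ContinuousLinearMap.comp_apply,
      ContinuousMultilinearMap.compContinuousLinearMapL_apply,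
      ContinuousMultilinearMap.compContinuousLinearMap_apply,
        ContinuousMultilinearMap.curryLeft_apply]
    congr 1
    ext i : 1
    refine Fin.cases ?_ (fun i => ?_) i <;> simp
  · intro m hmn
    exact (ContinuousMultilinearMap.compContinuousLinearMapL (𝕜 := ℝ) (ι := Fin m) (F := G)
      (fun _ => ContinuousLinearMap.inr ℝ ℝ E)).continuous.comp_continuousOn
      ((h.cont m hmn).comp (by fun_prop) hm)

/-- Integration over a parameter `s ∈ [0, 1]` preserves jet-convergence. -/
theorem JetConvergentAt.integral [CompleteSpace G] {k : A → ℝ × E → G}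
    (hk : ∀ s ∈ Icc (0 : ℝ) 1, JetConvergentAt l n k (Icc 0 1 ×ˢ S) (s, z₀)) (hS : Convex ℝ S)
    (hSu : UniqueDiffOn ℝ S) (hz₀ : z₀ ∈ S) :
    JetConvergentAt l n (fun a z => ∫ s in (0 : ℝ)..1, k a (s, z)) S z₀ := by
  have hT : UniqueDiffOn ℝ (Icc (0 : ℝ) 1 ×ˢ S) := (uniqueDiffOn_Icc zero_lt_one).prod hSu
  have h1 : ∀ s : Icc (0 : ℝ) 1, ∃ o, IsOpen o ∧ ((s : ℝ), z₀) ∈ o ∧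
      ∀ᶠ a in l, ContDiffOn ℝ n (k a) (Icc (0 : ℝ) 1 ×ˢ S ∩ o) :=
    fun s => (hk s s.2).exists_isOpen_contDiffOn
  choose o ho hzo hao using h1
  have hcov : Icc (0 : ℝ) 1 ×ˢ {z₀} ⊆ ⋃ s, o s := by
    rintro ⟨s, z⟩ ⟨hs, hz⟩
    obtain rfl : z = z₀ := hz
    exact mem_iUnion.2 ⟨⟨s, hs⟩, hzo _⟩
  obtain ⟨t, ht⟩ := (isCompact_Icc.prod isCompact_singleton).elim_finite_subcover o ho hcov
  obtain ⟨U, W, -, hW, hU, hzW, hUW⟩ := generalized_tube_lemma isCompact_Icc isCompact_singleton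
    (isOpen_biUnion fun s (_ : s ∈ t) => ho s) ht
  obtain ⟨r, hr, hrW⟩ := Metric.isOpen_iff.1 hW z₀ (hzW rfl)
  set u := S ∩ Metric.ball z₀ r with hu
  have hub : Icc (0 : ℝ) 1 ×ˢ u = (Icc (0 : ℝ) 1 ×ˢ S) ∩ (univ ×ˢ Metric.ball z₀ r) := by
    rw [prod_inter_prod, inter_univ]
  have huo : IsOpen ((univ : Set ℝ) ×ˢ Metric.ball z₀ r) := isOpen_univ.prod Metric.isOpen_ball
  have huT : UniqueDiffOn ℝ (Icc (0 : ℝ) 1 ×ˢ u) := by rw [hub]; exact hT.inter huo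
  have hz₀u : z₀ ∈ u := ⟨hz₀, Metric.mem_ball_self hr⟩
  have huc : Convex ℝ u := hS.inter (convex_ball _ _)
  have h2 : ∀ᶠ a in l, ContDiffOn ℝ n (k a) (Icc (0 : ℝ) 1 ×ˢ u) := by
    filter_upwards [(eventually_all_finset t).2 fun s _ => hao s] with a ha
    rintro ⟨s, z⟩ hsz
    obtain ⟨i, hi, hio⟩ := mem_iUnion₂.1 (hUW ⟨hU hsz.1, hrW hsz.2.2⟩)
    have hm : ((s, z) : ℝ × E) ∈ Icc (0 : ℝ) 1 ×ˢ S := ⟨hsz.1, hsz.2.1⟩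
    refine ((ha i hi (s, z) ⟨hm, hio⟩).mono_of_mem_nhdsWithin
      (inter_mem_nhdsWithin _ ((ho i).mem_nhds hio))).mono ?_
    exact prod_mono_right inter_subset_left
  have h3 : ∀ j, ∃ q : ℝ → ContinuousMultilinearMap ℝ (fun _ : Fin j => ℝ × E) G, j ≤ n →
      ∀ s ∈ Icc (0 : ℝ) 1,
      Tendsto (fun x : A × (ℝ × E) => iteratedFDerivWithin ℝ j (k x.1) (Icc 0 1 ×ˢ S) x.2)
        (l ×ˢ 𝓝[Icc 0 1 ×ˢ S] (s, z₀)) (𝓝 (q s)) := by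
    intro j
    by_cases hj : j ≤ n
    · have : ∀ s, ∃ q, s ∈ Icc (0 : ℝ) 1 → Tendsto (fun x : A × (ℝ × E) =>
          iteratedFDerivWithin ℝ j (k x.1) (Icc 0 1 ×ˢ S) x.2)
          (l ×ˢ 𝓝[Icc 0 1 ×ˢ S] (s, z₀)) (𝓝 q) := fun s => by
        by_cases hs : s ∈ Icc (0 : ℝ) 1
        · exact ((hk s hs).exists_tendsto_iteratedFDerivWithin hT hj).imp fun q hq _ => hq
        · exact ⟨0, fun h => absurd h hs⟩
      choose q hq using this
      exact ⟨q, fun _ => hq⟩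
    · exact ⟨0, fun h => absurd h hj⟩
  choose q hq using h3
  let Λ (j : ℕ) := ContinuousMultilinearMap.compContinuousLinearMapL (𝕜 := ℝ) (ι := Fin j) (F := G)
      (fun _ => ContinuousLinearMap.inr ℝ ℝ E)
  let P (a : A) (s : ℝ) (z : E) (j : ℕ) :=
    Λ j (iteratedFDerivWithin ℝ j (k a) (Icc (0 : ℝ) 1 ×ˢ u) (s, z))
  have hPc : ∀ᶠ a in l, ∀ j ≤ n,
      ContinuousOn (fun x : ℝ × E => P a x.1 x.2 j) (Icc (0 : ℝ) 1 ×ˢ u) := by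
    filter_upwards [h2] with a ha j hj
    exact (Λ j).continuous.comp_continuousOn
      ((ha.ftaylorSeriesWithin huT).cont j (by exact_mod_cast hj))
  have hslice : ∀ {z} (_ : z ∈ u),
      MapsTo (fun s : ℝ => (s, z)) (Icc (0 : ℝ) 1) (Icc (0 : ℝ) 1 ×ˢ u) :=
    fun hz s hs => ⟨hs, hz⟩
  have hPs : ∀ᶠ a in l, ∀ j ≤ n, ∀ z ∈ u, ContinuousOn (fun s => P a s z j) (Icc (0 : ℝ) 1) :=
    hPc.mono fun a ha j hj z hz => (ha j hj).comp (f := fun s : ℝ => (s, z)) (by fun_prop)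
      (hslice hz)
  have hPi : ∀ᶠ a in l, ∀ j ≤ n, ∀ z ∈ u, IntervalIntegrable (fun s => P a s z j) volume 0 1 :=
    hPs.mono fun a ha j hj z hz => ContinuousOn.intervalIntegrable (by
      rw [uIcc_of_le zero_le_one]; exact ha j hj z hz)
  refine ⟨fun a z j => ∫ s in (0 : ℝ)..1, P a s z j,
    fun j => ∫ s in (0 : ℝ)..1, Λ j (q j s), u,
    inter_mem_nhdsWithin _ (Metric.ball_mem_nhds _ hr), ?_, fun j hj => ?_⟩
  · filter_upwards [h2, hPc, hPs, hPi] with a ha hPc hPs hPi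
    have hR := ha.ftaylorSeriesWithin huT
    refine ⟨fun z hz => ?_, fun m hm z hz => ?_, fun m hm => ?_⟩
    · change (continuousMultilinearCurryFin0 ℝ E G : _ →L[ℝ] G) (∫ s in (0 : ℝ)..1, P a s z 0) = _
      rw [← ContinuousLinearMap.intervalIntegral_comp_comm _ (hPi 0 (Nat.zero_le _) z hz)]
      refine integral_congr fun s hs => ?_
      rw [uIcc_of_le zero_le_one] at hs
      exact (hR.slice hs).zero_eq z hz
    · have hm' : m + 1 ≤ n := by exact_mod_cast hm
      exact hasFDerivWithinAt_integral_comp_of_convex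
        (continuousMultilinearCurryLeftEquiv ℝ (fun _ : Fin (m + 1) => E) G
          |>.toContinuousLinearEquiv.toContinuousLinearMap)
        (φ := fun s z => P a s z m) (ψ := fun s z => P a s z (m + 1)) huc hz
        (fun s hs y hy => (hR.slice hs).fderivWithin m hm y hy)
        (fun y hy => hPs m (by omega) y hy) (hPc _ hm')
    · have hm' : m ≤ n := by exact_mod_cast hm
      intro z hz
      refine tendsto_integral_of_tendstoUniformlyOn
        (tendstoUniformlyOn_of_tendsto_prod_nhdsWithin isCompact_Icc fun s hs => ?_)
        (eventually_mem_nhdsWithin.mono fun y hy => hPs m hm' y hy)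
      have := hPc m hm' (s, z) ⟨hs, hz⟩
      rw [ContinuousWithinAt, nhdsWithin_prod_eq] at this
      exact this.comp (tendsto_snd.prodMk tendsto_fst)
  · refine tendsto_integral_of_tendstoUniformlyOn (L := l ×ˢ 𝓝[S] z₀)
      (φ := fun x s => P x.1 s x.2 j)
      (tendstoUniformlyOn_of_tendsto_prod_nhdsWithin isCompact_Icc fun s hs => ?_) ?_
    · have h4 := hq j hj s hs
      rw [nhdsWithin_prod_eq] at h4
      have h5 : Tendsto (fun x : (A × E) × ℝ => (x.1.1, (x.2, x.1.2)))
          ((l ×ˢ 𝓝[S] z₀) ×ˢ 𝓝[Icc 0 1] s) (l ×ˢ (𝓝[Icc 0 1] s ×ˢ 𝓝[S] z₀)) :=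
        (tendsto_fst.comp tendsto_fst).prodMk
          (tendsto_snd.prodMk (tendsto_snd.comp tendsto_fst))
      refine ((Λ j).continuous.tendsto _).comp ((h4.comp h5).congr' ?_)
      have h6 : ∀ᶠ x : (A × E) × ℝ in (l ×ˢ 𝓝[S] z₀) ×ˢ 𝓝[Icc 0 1] s,
          x.1.2 ∈ Metric.ball z₀ r :=
        (tendsto_snd.comp tendsto_fst).eventually
          (mem_nhdsWithin_of_mem_nhds (Metric.ball_mem_nhds _ hr))
      filter_upwards [h6] with x hx
      simp only [Function.comp]
      rw [hub, iteratedFDerivWithin_inter_open huo ⟨mem_univ _, hx⟩]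
    · have h7 : ∀ᶠ x : A × E in l ×ˢ 𝓝[S] z₀, x.2 ∈ u :=
        tendsto_snd.eventually (inter_mem_nhdsWithin _ (Metric.ball_mem_nhds _ hr))
      filter_upwards [tendsto_fst.eventually hPs, h7] with x hx hxu
      exact hx j hj _ hxu

end Integral

/-! ### Hadamard quotients, and injectivity near an injective derivative -/

section Hadamard

variable {A E F G : Type*} [NormedAddCommGroup E] [NormedSpace ℝ E]
  [NormedAddCommGroup F] [NormedSpace ℝ F] [NormedAddCommGroup G] [NormedSpace ℝ G]

/-- Hadamard's lemma: for a map `f` on a subset of `E × F` that vanishes for `v = 0`, the map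
`(τ, (x, v)) ↦ τ⁻¹ f (x, τ v)`, extended to `τ = 0` by the partial derivative. -/
noncomputable def hadamardQuotient (R : Set E) (f : E × F → G) (q : ℝ × (E × F)) : G :=
  open Classical in
  if q.1 = 0 then fderivWithin ℝ f (R ×ˢ univ) (q.2.1, 0) (0, q.2.2)
  else q.1⁻¹ • f (q.2.1, q.1 • q.2.2)

theorem hadamardQuotient_eq_integral [CompleteSpace G] {R : Set E} {f : E × F → G}
    (hR : UniqueDiffOn ℝ R) {o : Set (E × F)} (ho : IsOpen o)
    (hf : ContDiffOn ℝ 1 f (R ×ˢ univ ∩ o)) {τ : ℝ} {x : E} {v : F} (hx : x ∈ R)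
    (h0 : f (x, 0) = 0) (hseg : ∀ s ∈ Icc (0 : ℝ) 1, (x, (s * τ) • v) ∈ o) :
    hadamardQuotient R f (τ, (x, v)) =
      ∫ s in (0 : ℝ)..1, fderivWithin ℝ f (R ×ˢ univ) (x, (s * τ) • v) (0, v) := by
  have hU : UniqueDiffOn ℝ (R ×ˢ (univ : Set F)) := hR.prod uniqueDiffOn_univ
  have hmem : ∀ s ∈ Icc (0 : ℝ) 1, (x, (s * τ) • v) ∈ R ×ˢ (univ : Set F) ∩ o :=
    fun s hs => ⟨⟨hx, mem_univ _⟩, hseg s hs⟩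
  have hd : ∀ y ∈ R ×ˢ (univ : Set F) ∩ o, HasFDerivWithinAt f
      (fderivWithin ℝ f (R ×ˢ univ) y) (R ×ˢ univ ∩ o) y := fun y hy => by
    have := ((hf y hy).differentiableWithinAt one_ne_zero).hasFDerivWithinAt
    rwa [fderivWithin_inter (ho.mem_nhds hy.2)] at this
  unfold hadamardQuotient
  by_cases hτ : τ = 0
  · simp [hτ]
  simp only [hτ, if_false]
  have hc : ContinuousOn (fun s : ℝ => fderivWithin ℝ f (R ×ˢ univ) (x, (s * τ) • v) (0, v))
      (Icc 0 1) := by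
    have h1 : ContinuousOn (fderivWithin ℝ f (R ×ˢ univ)) (R ×ˢ univ ∩ o) :=
      (hf.continuousOn_fderivWithin (hU.inter ho) le_rfl).congr fun y hy =>
        (fderivWithin_inter (ho.mem_nhds hy.2)).symm
    exact (h1.comp (by fun_prop) hmem).clm_apply continuousOn_const
  have hder : ∀ s ∈ Icc (0 : ℝ) 1, HasDerivWithinAt (fun s : ℝ => τ⁻¹ • f (x, (s * τ) • v))
      (fderivWithin ℝ f (R ×ˢ univ) (x, (s * τ) • v) (0, v)) (Icc 0 1) s := fun s hs => by
    have h1 : HasDerivWithinAt (fun s : ℝ => (x, (s * τ) • v)) ((0 : E), τ • v) (Icc 0 1) s := by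
      refine (hasDerivWithinAt_const _ _ _).prodMk ?_
      simpa using (((hasDerivAt_id s).mul_const τ).smul_const v).hasDerivWithinAt
    have h2 := ((hd _ (hmem s hs)).comp_hasDerivWithinAt s h1 hmem).const_smul τ⁻¹
    have e : ((0 : E), τ • v) = τ • ((0 : E), v) := by simp
    rw [e, map_smul, smul_smul, inv_mul_cancel₀ hτ, one_smul] at h2
    exact h2
  have := intervalIntegral.integral_eq_sub_of_hasDerivAt_of_le zero_le_one
    (fun s hs => (hder s hs).continuousWithinAt)
    (fun s hs => (hder s (Ioo_subset_Icc_self hs)).hasDerivAt (Icc_mem_nhds hs.1 hs.2))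
    (ContinuousOn.intervalIntegrable (by rwa [uIcc_of_le zero_le_one]))
  rw [this]
  simp [h0]

/-- Hadamard's lemma for families: the quotients `τ⁻¹ f (x, τ v)` of a jet-convergent family of
order `n + 1` form a jet-convergent family of order `n`, also at `τ = 0`. -/
theorem JetConvergentAt.hadamardQuotient [CompleteSpace G] {l : Filter A} {n : ℕ}
    {f : A → E × F → G} {R : Set E} {x₀ : E}
    (hf : JetConvergentAt l (n + 1) f (R ×ˢ univ) (x₀, 0)) (hR : Convex ℝ R)
    (hRu : UniqueDiffOn ℝ R) (hx₀ : x₀ ∈ R)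
    (h0 : ∀ᶠ q : A × E in l ×ˢ 𝓝[R] x₀, f q.1 (q.2, 0) = 0) (v₀ : F) :
    JetConvergentAt l n (fun a => hadamardQuotient R (f a)) (univ ×ˢ (R ×ˢ univ))
      (0, (x₀, v₀)) := by
  have hU : UniqueDiffOn ℝ (R ×ˢ (univ : Set F)) := hRu.prod uniqueDiffOn_univ
  have hx₀' : (x₀, (0 : F)) ∈ R ×ˢ (univ : Set F) := ⟨hx₀, mem_univ _⟩
  let m : ℝ × (ℝ × (E × F)) → E × F := fun q => (q.2.2.1, (q.1 * q.2.1) • q.2.2.2)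
  have hm : ContDiff ℝ ∞ m := by fun_prop
  have hmaps : ∀ q, q.2.2.1 ∈ R → m q ∈ R ×ˢ (univ : Set F) := fun q hq => ⟨hq, mem_univ _⟩
  have hk : ∀ s ∈ Icc (0 : ℝ) 1, JetConvergentAt l n
      (fun a q => _root_.fderivWithin ℝ (f a) (R ×ˢ univ) (m q) (0, q.2.2.2))
      (Icc 0 1 ×ˢ (univ ×ˢ (R ×ˢ univ))) (s, (0, (x₀, v₀))) := by
    intro s hs
    have hmem : (s, ((0 : ℝ), (x₀, v₀))) ∈
        Icc (0 : ℝ) 1 ×ˢ ((univ : Set ℝ) ×ˢ (R ×ˢ (univ : Set F))) :=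
      ⟨hs, mem_univ _, hx₀, mem_univ _⟩
    have hD := hf.fderivWithin hU
    have hm1 : JetConvergentAt l n (fun _ => m) (Icc 0 1 ×ˢ (univ ×ˢ (R ×ˢ univ)))
        (s, ((0 : ℝ), (x₀, v₀))) :=
      (hm.of_le (by exact_mod_cast le_top)).contDiffWithinAt.jetConvergentAt hmem l
    have hmt : Tendsto m (𝓝[Icc 0 1 ×ˢ (univ ×ˢ (R ×ˢ univ))] (s, ((0 : ℝ), (x₀, v₀))))
        (𝓝[R ×ˢ univ] (x₀, 0)) := by
      have h1 : Tendsto m (𝓝 (s, ((0 : ℝ), (x₀, v₀)))) (𝓝 (x₀, 0)) := by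
        have := hm.continuous.tendsto (s, ((0 : ℝ), (x₀, v₀)))
        simpa [m] using this
      refine tendsto_nhdsWithin_iff.2 ⟨h1.mono_left nhdsWithin_le_nhds, ?_⟩
      filter_upwards [self_mem_nhdsWithin] with q hq using hmaps q hq.2.2.1
    have h3 := hD.comp hm1 (hmt.comp tendsto_snd)
    have hv : JetConvergentAt l n (fun _ (q : ℝ × (ℝ × (E × F))) => ((0 : E), q.2.2.2))
        (Icc 0 1 ×ˢ (univ ×ˢ (R ×ˢ univ))) (s, ((0 : ℝ), (x₀, v₀))) :=
      ContDiffWithinAt.jetConvergentAt (by fun_prop) hmem l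
    have h4 := h3.prodMk hv
    obtain ⟨y, hy⟩ := h4.exists_tendsto
    exact JetConvergentAt.comp_contDiffWithinAt (T := univ) (y₀ := y)
      (f := fun p : (E × F →L[ℝ] G) × (E × F) => p.1 p.2)
      (isBoundedBilinearMap_apply.contDiff.contDiffWithinAt) (mem_univ _) h4
      (by rwa [nhdsWithin_univ])
  have hcS : Convex ℝ ((univ : Set ℝ) ×ˢ (R ×ˢ (univ : Set F))) :=
    convex_univ.prod (hR.prod convex_univ)
  have hUS : UniqueDiffOn ℝ ((univ : Set ℝ) ×ˢ (R ×ˢ (univ : Set F))) :=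
    uniqueDiffOn_univ.prod hU
  have hz : ((0 : ℝ), (x₀, v₀)) ∈ (univ : Set ℝ) ×ˢ (R ×ˢ (univ : Set F)) :=
    ⟨mem_univ _, hx₀, mem_univ _⟩
  refine (JetConvergentAt.integral hk hcS hUS hz).congr ?_
  obtain ⟨o, ho, hzo, hao⟩ := hf.exists_isOpen_contDiffOn
  have hseg : ∀ᶠ q : ℝ × (E × F) in 𝓝 (0, (x₀, v₀)), ∀ s ∈ Icc (0 : ℝ) 1, m (s, q) ∈ o := by
    refine isCompact_Icc.eventually_forall_of_forall_eventually fun s _ => ?_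
    have h1 : m (s, ((0 : ℝ), (x₀, v₀))) ∈ o := by simpa [m] using hzo
    have h2 : ∀ᶠ p : (ℝ × (E × F)) × ℝ in 𝓝 ((0, (x₀, v₀)), s), m (p.2, p.1) ∈ o :=
      (hm.continuous.comp continuous_swap).continuousAt.preimage_mem_nhds (ho.mem_nhds h1)
    exact h2
  have h0' : ∀ᶠ q : A × (ℝ × (E × F)) in l ×ˢ 𝓝[univ ×ˢ (R ×ˢ univ)] (0, (x₀, v₀)),
      f q.1 (q.2.2.1, 0) = 0 := by
    refine Tendsto.eventually (f := fun q : A × (ℝ × (E × F)) => (q.1, q.2.2.1)) ?_ h0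
    refine tendsto_fst.prodMk
      (Tendsto.comp (g := fun p : ℝ × (E × F) => p.2.1) (f := Prod.snd) ?_ tendsto_snd)
    refine tendsto_nhdsWithin_iff.2 ⟨?_, ?_⟩
    · exact (Continuous.tendsto' (by fun_prop) _ _ rfl).mono_left nhdsWithin_le_nhds
    · filter_upwards [self_mem_nhdsWithin] with q hq using hq.2.1
  filter_upwards [h0', tendsto_fst.eventually hao,
    tendsto_snd.eventually (mem_nhdsWithin_of_mem_nhds hseg),
    tendsto_snd.eventually self_mem_nhdsWithin] with q h1 h2 h3 h4
  exact hadamardQuotient_eq_integral hRu ho (h2.of_le (by norm_cast; omega)) h4.2.1 h1 h3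

end Hadamard

section LocalInjectivity

variable {A E G : Type*} [NormedAddCommGroup E] [NormedSpace ℝ E] [FiniteDimensional ℝ E]
  [NormedAddCommGroup G] [NormedSpace ℝ G]

/-- Immersions are locally injective, uniformly for maps that are close in the `C^1` sense. -/
theorem JetConvergentAt.exists_injOn {l : Filter A} {g : A → E → G} {S : Set E} {z₀ : E} {a₀ : A}
    (hg : JetConvergentAt l 1 g S z₀) (hS : Convex ℝ S) (hSu : UniqueDiffOn ℝ S) (hz : z₀ ∈ S)
    (ha₀ : pure a₀ ≤ l) (hinj : Function.Injective (_root_.fderivWithin ℝ (g a₀) S z₀)) :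
    ∃ u ∈ 𝓝[S] z₀, ∀ᶠ a in l, InjOn (g a) u ∧
      ∀ z ∈ u, DifferentiableWithinAt ℝ (g a) S z ∧
        Function.Injective (_root_.fderivWithin ℝ (g a) S z) := by
  set L := _root_.fderivWithin ℝ (g a₀) S z₀ with hL
  obtain ⟨K, hK, hKL⟩ := (L : E →ₗ[ℝ] G).exists_antilipschitzWith (LinearMap.ker_eq_bot.2 hinj)
  have hK' : ∀ x, ‖x‖ ≤ K * ‖L x‖ := fun x => by
    simpa using hKL.le_mul_dist x 0
  have hKpos : (0 : ℝ) < K := by exact_mod_cast hK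
  have hD := (hg.fderivWithin hSu).tendsto_of_pure ha₀ hz
  rw [← hL] at hD
  have hclose := Metric.tendsto_nhds.1 hD (1 / (2 * K)) (by positivity)
  obtain ⟨P, hP, Q, hQ, hPQ⟩ := eventually_prod_iff.1 hclose
  obtain ⟨o, ho, hzo, hao⟩ := hg.exists_isOpen_contDiffOn
  obtain ⟨r, hr, hrQ⟩ := Metric.mem_nhdsWithin_iff.1
    (inter_mem hQ (inter_mem_nhdsWithin S (ho.mem_nhds hzo)))
  refine ⟨Metric.ball z₀ r ∩ S, inter_mem (mem_nhdsWithin_of_mem_nhds (Metric.ball_mem_nhds _ hr))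
    self_mem_nhdsWithin, ?_⟩
  filter_upwards [hP, hao] with a ha1 ha2
  have hb : ∀ z ∈ Metric.ball z₀ r ∩ S, ‖_root_.fderivWithin ℝ (g a) S z - L‖ ≤ 1 / (2 * K) :=
      fun z hz => by
    have := hPQ ha1 (hrQ hz).1
    rw [dist_eq_norm] at this
    exact this.le
  have hdiff : ∀ z ∈ Metric.ball z₀ r ∩ S, DifferentiableWithinAt ℝ (g a) S z := fun z hz =>
    ((ha2 z (hrQ hz).2).differentiableWithinAt one_ne_zero).mono_of_mem_nhdsWithin
      (inter_mem_nhdsWithin _ (ho.mem_nhds (hrQ hz).2.2))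
  have small : ∀ x : E, ‖L x‖ ≤ 1 / (2 * K) * ‖x‖ → x = 0 := fun x hx => by
    have h1 := hK' x
    have h2 : (K : ℝ) * ‖L x‖ ≤ K * (1 / (2 * K) * ‖x‖) := by gcongr
    have h3 : (K : ℝ) * (1 / (2 * K) * ‖x‖) = ‖x‖ / 2 := by field_simp
    have : ‖x‖ ≤ 0 := by linarith
    simpa using this
  refine ⟨fun x hx y hy hxy => ?_, fun z hz => ⟨hdiff z hz, ?_⟩⟩
  · have hc : Convex ℝ (Metric.ball z₀ r ∩ S) := (convex_ball _ _).inter hS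
    have := hc.norm_image_sub_le_of_norm_hasFDerivWithin_le'
      (fun w hw => ((hdiff w hw).hasFDerivWithinAt).mono inter_subset_right) hb hx hy
    rw [hxy, sub_self, zero_sub, norm_neg] at this
    exact (sub_eq_zero.1 (small _ this)).symm
  · rw [injective_iff_map_eq_zero]
    intro x hx
    refine small x ?_
    have := (_root_.fderivWithin ℝ (g a) S z - L).le_opNorm x
    rw [sub_apply, hx, zero_sub, norm_neg] at this
    exact this.trans (by gcongr; exact hb z hz)

end LocalInjectivity

/-! ### Convergence in charts and the weak Whitney topologies -/

section Charts

variable {E : Type*} [NormedAddCommGroup E] [NormedSpace ℝ E]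
  {H : Type*} [TopologicalSpace H] {I : ModelWithCorners ℝ E H}
  {M : Type*} [TopologicalSpace M] [ChartedSpace H M]
  {E' : Type*} [NormedAddCommGroup E'] [NormedSpace ℝ E']
  {H' : Type*} [TopologicalSpace H'] {J : ModelWithCorners ℝ E' H'}
  {N : Set M} {Y : Type*} [TopologicalSpace Y] [ChartedSpace H' Y] {A : Type*}

variable (I J) in
/-- The local representation of a function between manifolds in the charts at `x` and `y`. -/
noncomputable def chartRep (x : M) (y : Y) (g : M → Y) : E → E' :=
  extChartAt J y ∘ g ∘ (extChartAt I x).symm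

open SmoothMapOn

theorem mem_chartDomain {x w : M} (hw : w ∈ N) (hx : w ∈ (extChartAt I x).source) :
    extChartAt I x w ∈ chartDomain I N x :=
  ⟨(extChartAt I x).map_source hx, by rwa [mem_preimage, (extChartAt I x).left_inv hx]⟩

theorem tendsto_extChartAt_symm_chartDomain {x w : M} (hx : w ∈ (extChartAt I x).source) :
    Tendsto (extChartAt I x).symm (𝓝[chartDomain I N x] (extChartAt I x w)) (𝓝[N] w) := by
  refine tendsto_nhdsWithin_iff.2 ⟨?_, ?_⟩
  · have := (continuousAt_extChartAt_symm' hx).tendsto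
    rw [(extChartAt I x).left_inv hx] at this
    exact this.mono_left nhdsWithin_le_nhds
  · filter_upwards [self_mem_nhdsWithin] with z hz using hz.2

theorem tendsto_extChartAt_chartDomain {x w : M} (hx : w ∈ (extChartAt I x).source) :
    Tendsto (extChartAt I x) (𝓝[N] w) (𝓝[chartDomain I N x] (extChartAt I x w)) := by
  refine tendsto_nhdsWithin_iff.2 ⟨(continuousAt_extChartAt' hx).tendsto.mono_left
    nhdsWithin_le_nhds, ?_⟩
  filter_upwards [self_mem_nhdsWithin,
    mem_nhdsWithin_of_mem_nhds (extChartAt_source_mem_nhds' hx)] with w' h1 h2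
  exact mem_chartDomain h1 h2

theorem chartDomain_eventuallyEq {x w : M} (hx : w ∈ (extChartAt I x).source) :
    𝓝[(extChartAt I x).symm ⁻¹' N ∩ range I] (extChartAt I x w) =
      𝓝[chartDomain I N x] (extChartAt I x w) := by
  apply le_antisymm
  · refine nhdsWithin_le_iff.2 ?_
    have h1 := extChartAt_target_mem_nhdsWithin' hx
    filter_upwards [nhdsWithin_mono _ inter_subset_right h1, self_mem_nhdsWithin] with z h2 h3
    exact ⟨h2, h3.1⟩
  · exact nhdsWithin_mono _ fun z hz => ⟨hz.2, extChartAt_target_subset_range x hz.1⟩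

theorem contDiffWithinAt_chartRep [IsManifold I ∞ M] [IsManifold J ∞ Y] {g : M → Y} {x w : M}
    {y : Y} (hg : ContMDiffWithinAt I J ∞ g N w) (hx : w ∈ (extChartAt I x).source)
    (hy : g w ∈ (extChartAt J y).source) :
    ContDiffWithinAt ℝ ∞ (chartRep I J x y g) (chartDomain I N x) (extChartAt I x w) := by
  have hx' := hx
  rw [extChartAt_source] at hx hy
  exact ((contMDiffWithinAt_iff_of_mem_source hx hy).1 hg).2.mono_of_mem_nhdsWithin
    ((chartDomain_eventuallyEq hx').symm ▸ self_mem_nhdsWithin)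

theorem contMDiffWithinAt_of_chartRep [IsManifold I ∞ M] [IsManifold J ∞ Y] {g : M → Y} {x w : M}
    {y : Y} {n : WithTop ℕ∞} [IsManifold I n M] [IsManifold J n Y] (hc : ContinuousWithinAt g N w)
    (hx : w ∈ (extChartAt I x).source)
    (hy : g w ∈ (extChartAt J y).source)
    (h : ContDiffWithinAt ℝ n (chartRep I J x y g) (chartDomain I N x) (extChartAt I x w)) :
    ContMDiffWithinAt I J n g N w := by
  have hx' := hx
  rw [extChartAt_source] at hx hy
  exact (contMDiffWithinAt_iff_of_mem_source hx hy).2 ⟨hc, h.mono_of_mem_nhdsWithin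
    ((chartDomain_eventuallyEq hx') ▸ self_mem_nhdsWithin)⟩

/-- Jet-convergence of a family of maps between manifolds does not depend on the charts. -/
theorem JetConvergentAt.change_charts [IsManifold I ∞ M] [IsManifold J ∞ Y] {l : Filter A} {n : ℕ}
    {g : A → M → Y} {x x' w : M} {y y' y₀ : Y}
    (h : JetConvergentAt l n (fun a => chartRep I J x y (g a)) (chartDomain I N x)
      (extChartAt I x w))
    (hg : Tendsto (fun q : A × M => g q.1 q.2) (l ×ˢ 𝓝[N] w) (𝓝 y₀)) (hw : w ∈ N)
    (hx : w ∈ (extChartAt I x).source) (hx' : w ∈ (extChartAt I x').source)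
    (hy : y₀ ∈ (extChartAt J y).source) (hy' : y₀ ∈ (extChartAt J y').source) :
    JetConvergentAt l n (fun a => chartRep I J x' y' (g a)) (chartDomain I N x')
      (extChartAt I x' w) := by
  have hn : (n : WithTop ℕ∞) ≤ ∞ := by exact_mod_cast le_top
  -- the change of charts in the source
  have h1 : ContDiffWithinAt ℝ n (extChartAt I x ∘ (extChartAt I x').symm) (chartDomain I N x')
      (extChartAt I x' w) :=
    ((contDiffWithinAt_ext_coord_change (n := ∞) x x' (by
      simp only [PartialEquiv.trans_source, PartialEquiv.symm_source, mem_inter_iff, mem_preimage]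
      exact ⟨(extChartAt I x').map_source hx', by rwa [(extChartAt I x').left_inv hx']⟩)).of_le
      hn).mono fun z hz => extChartAt_target_subset_range x' hz.1
  have h1t : Tendsto (extChartAt I x ∘ (extChartAt I x').symm)
      (𝓝[chartDomain I N x'] (extChartAt I x' w)) (𝓝[chartDomain I N x] (extChartAt I x w)) :=
    (tendsto_extChartAt_chartDomain hx).comp (tendsto_extChartAt_symm_chartDomain hx')
  have h2 := h.comp (h1.jetConvergentAt (mem_chartDomain hw hx') l) (h1t.comp tendsto_snd)
  have hgt : Tendsto (fun q : A × E => g q.1 ((extChartAt I x').symm q.2))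
      (l ×ˢ 𝓝[chartDomain I N x'] (extChartAt I x' w)) (𝓝 y₀) :=
    hg.comp (tendsto_id.prodMap (tendsto_extChartAt_symm_chartDomain hx'))
  have hxs : ∀ᶠ q : A × E in l ×ˢ 𝓝[chartDomain I N x'] (extChartAt I x' w),
      (extChartAt I x').symm q.2 ∈ (extChartAt I x).source :=
    ((tendsto_extChartAt_symm_chartDomain (N := N) hx').comp tendsto_snd).eventually
      (mem_nhdsWithin_of_mem_nhds (extChartAt_source_mem_nhds' hx))
  have hys := hgt.eventually (extChartAt_source_mem_nhds' (I := J) hy)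
  have e : ∀ᶠ q : A × E in l ×ˢ 𝓝[chartDomain I N x'] (extChartAt I x' w),
      chartRep I J x y (g q.1) ((extChartAt I x ∘ (extChartAt I x').symm) q.2) =
        extChartAt J y (g q.1 ((extChartAt I x').symm q.2)) := by
    filter_upwards [hxs] with q hq
    simp only [chartRep, Function.comp_apply, (extChartAt I x).left_inv hq]
  -- the change of charts in the target
  have h3 : ContDiffWithinAt ℝ n (extChartAt J y' ∘ (extChartAt J y).symm) (range J)
      (extChartAt J y y₀) :=
    (contDiffWithinAt_ext_coord_change (n := ∞) y' y (by
      simp only [PartialEquiv.trans_source, PartialEquiv.symm_source, mem_inter_iff, mem_preimage]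
      exact ⟨(extChartAt J y).map_source hy, by rwa [(extChartAt J y).left_inv hy]⟩)).of_le hn
  have hyr : extChartAt J y y₀ ∈ range J :=
    extChartAt_target_subset_range y ((extChartAt J y).map_source hy)
  refine (JetConvergentAt.comp_contDiffWithinAt h3 hyr h2 ?_).congr ?_
  · refine tendsto_nhdsWithin_iff.2 ⟨?_, ?_⟩
    · refine (((continuousAt_extChartAt' hy).tendsto).comp hgt).congr' ?_
      filter_upwards [e] with q hq using hq.symm
    · filter_upwards [e, hys] with q hq hq'
      rw [hq]
      exact extChartAt_target_subset_range y ((extChartAt J y).map_source hq')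
  · filter_upwards [e, hys] with q hq hq'
    rw [hq, Function.comp_apply, (extChartAt J y).left_inv hq']
    rfl

/-- Convergence in charts gives convergence on the manifold only if the values are known to lie in
the chart eventually, since charts have junk values elsewhere. -/
theorem tendsto_of_tendsto_chartRep {l : Filter A} {g : A → M → Y} {x w : M} {y y₀ : Y}
    (h : Tendsto (fun q : A × E => chartRep I J x y (g q.1) q.2)
      (l ×ˢ 𝓝[chartDomain I N x] (extChartAt I x w)) (𝓝 (extChartAt J y y₀)))
    (hx : w ∈ (extChartAt I x).source) (hy : y₀ ∈ (extChartAt J y).source)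
    (hs : ∀ᶠ q : A × M in l ×ˢ 𝓝[N] w, g q.1 q.2 ∈ (extChartAt J y).source) :
    Tendsto (fun q : A × M => g q.1 q.2) (l ×ˢ 𝓝[N] w) (𝓝 y₀) := by
  have h2 := h.comp (tendsto_id.prodMap (tendsto_extChartAt_chartDomain (N := N) hx))
  have h3 := (continuousAt_extChartAt_symm' hy).tendsto.comp h2
  rw [(extChartAt J y).left_inv hy] at h3
  refine h3.congr' ?_
  have hxs : ∀ᶠ q : A × M in l ×ˢ 𝓝[N] w, q.2 ∈ (extChartAt I x).source :=
    tendsto_snd.eventually (mem_nhdsWithin_of_mem_nhds (extChartAt_source_mem_nhds' hx))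
  filter_upwards [hs, hxs] with q h4 h5
  simp only [Function.comp_apply, Prod.map_fst, Prod.map_snd, id_eq, chartRep,
    (extChartAt I x).left_inv h5,
    (extChartAt J y).left_inv h4]

end Charts

section Whitney

variable {E : Type*} [NormedAddCommGroup E] [NormedSpace ℝ E]
  {H : Type*} [TopologicalSpace H] {I : ModelWithCorners ℝ E H}
  {M : Type*} [TopologicalSpace M] [ChartedSpace H M]
  {E' : Type*} [NormedAddCommGroup E'] [NormedSpace ℝ E']
  {H' : Type*} [TopologicalSpace H'] {J : ModelWithCorners ℝ E' H'}
  {N : Set M} {Y : Type*} [TopologicalSpace Y] [ChartedSpace H' Y] {A : Type*}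

open SmoothMapOn

theorem exists_isCompact_subset_inter [T2Space M] (hN : IsCompact N) {w : M} (hw : w ∈ N)
    {O : Set M} (hO : O ∈ 𝓝[N] w) : ∃ K, IsCompact K ∧ K ⊆ N ∧ K ⊆ O ∧ K ∈ 𝓝[N] w := by
  have := isCompact_iff_compactSpace.1 hN
  have h1 : (Subtype.val : N → M) ⁻¹' O ∈ 𝓝 (⟨w, hw⟩ : N) := by
    rw [nhds_subtype_eq_comap_nhdsWithin]; exact preimage_mem_comap hO
  obtain ⟨K, hK, hKO, hKc⟩ := local_compact_nhds h1
  refine ⟨Subtype.val '' K, hKc.image continuous_subtype_val, ?_, ?_, ?_⟩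
  · rintro _ ⟨k, -, rfl⟩; exact k.2
  · rintro _ ⟨k, hk, rfl⟩; exact hKO hk
  · rw [nhdsWithin_eq_map_subtype_coe hw]; exact image_mem_map hK

/-- A property that holds locally uniformly holds uniformly on compact sets. -/
theorem eventually_forall_mem_of_isCompact {X : Type*} [TopologicalSpace X] {K : Set X}
    (hK : IsCompact K) {l : Filter A} {P : A → X → Prop}
    (h : ∀ w ∈ K, ∀ᶠ q : A × X in l ×ˢ 𝓝[K] w, P q.1 q.2) : ∀ᶠ a in l, ∀ w ∈ K, P a w := by
  refine hK.induction_on (p := fun s => ∀ᶠ a in l, ∀ w ∈ s, P a w) (by simp)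
    (fun s t hst ht => ht.mono fun a ha w hw => ha w (hst hw))
    (fun s t hs ht => (hs.and ht).mono fun a ha w hw => hw.elim (ha.1 w) (ha.2 w)) ?_
  intro w hw
  obtain ⟨p, hp, q, hq, hpq⟩ := eventually_prod_iff.1 (h w hw)
  exact ⟨{w | q w}, hq, hp.mono fun a ha w hw => hpq ha hw⟩

theorem contDiffWithinAt_localRep [IsManifold I ∞ M] [IsManifold J ∞ Y] (f : SmoothMapOn I J N Y)
    {x w : M} {y : Y} (hw : w ∈ N) (hx : w ∈ (extChartAt I x).source)
    (hy : f.ext w ∈ (extChartAt J y).source) :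
    ContDiffWithinAt ℝ ∞ (f.localRep x y) (chartDomain I N x) (extChartAt I x w) :=
  contDiffWithinAt_chartRep (f.contMDiffOn_ext w hw) hx hy

variable [T2Space M] [IsManifold I ∞ M] [IsManifold J ∞ Y]

/-- The evaluation map of `C^∞(N, Y)` depends continuously on the map and the point, together with
its derivatives of order at most `n` with respect to the point, for the topology `W^n`. -/
theorem jetConvergentAt_localRep (hN : IsCompact N) (hNu : UniqueMDiffOn I N) {r : ℕ∞} {n : ℕ}
    (hn : (n : ℕ∞) ≤ r) (f₀ : SmoothMapOn I J N Y) {x w : M} {y : Y} (hw : w ∈ N)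
    (hx : w ∈ (extChartAt I x).source) (hy : f₀.ext w ∈ (extChartAt J y).source) :
    JetConvergentAt (@nhds _ (whitney r) f₀) n (fun f => f.localRep x y) (chartDomain I N x)
        (extChartAt I x w) ∧
      Tendsto (fun q : SmoothMapOn I J N Y × M => q.1.ext q.2)
        (@nhds _ (whitney r) f₀ ×ˢ 𝓝[N] w) (𝓝 (f₀.ext w)) := by
  have : IsManifold I 1 M := IsManifold.of_le (n := ∞) (by norm_cast)
  have hD : UniqueDiffOn ℝ (chartDomain I N x) := hNu.uniqueDiffOn_target_inter x
  have hO : (extChartAt I x).source ∩ f₀.ext ⁻¹' (extChartAt J y).source ∈ 𝓝[N] w :=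
    inter_mem (mem_nhdsWithin_of_mem_nhds (extChartAt_source_mem_nhds' hx))
      ((f₀.contMDiffOn_ext w hw).continuousWithinAt.preimage_mem_nhdsWithin
        (extChartAt_source_mem_nhds' hy))
  obtain ⟨K, hK, hKN, hKO, hKw⟩ := exists_isCompact_subset_inter hN hw hO
  have hmem : ∀ η > 0, whitneyNhd f₀ x y K n η ∈ @nhds _ (whitney r) f₀ := fun η hη => by
    let : TopologicalSpace (SmoothMapOn I J N Y) := whitney r
    refine IsOpen.mem_nhds (TopologicalSpace.isOpen_generateFrom_of_mem
      ⟨f₀, x, y, K, n, η, hK, fun k hk => ⟨hKN hk, (hKO hk).1⟩, fun k hk => (hKO hk).2, hn, hη,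
        rfl⟩) ⟨fun k hk => (hKO hk).2, fun j _ k _ => by simpa using hη⟩
  have hwK : w ∈ K := mem_of_mem_nhdsWithin hw hKw
  have hKD : (extChartAt I x).symm ⁻¹' K ∈ 𝓝[chartDomain I N x] (extChartAt I x w) :=
    tendsto_extChartAt_symm_chartDomain hx hKw
  obtain ⟨o, ho, hzo, hoK⟩ := mem_nhdsWithin.1 hKD
  have hjet : JetConvergentAt (@nhds _ (whitney r) f₀) n (fun f => f.localRep x y)
      (chartDomain I N x) (extChartAt I x w) := by
    refine JetConvergentAt.of_iteratedFDerivWithin hD ho hzo ?_ fun j hj =>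
      ⟨iteratedFDerivWithin ℝ j (f₀.localRep x y) (chartDomain I N x) (extChartAt I x w), ?_⟩
    · filter_upwards [hmem 1 one_pos] with f hf z hz
      have hzK : (extChartAt I x).symm z ∈ K := hoK ⟨hz.2, hz.1⟩
      have := contDiffWithinAt_localRep f hz.1.2 ((extChartAt I x).map_target hz.1.1) (hf.1 _ hzK)
      rw [(extChartAt I x).right_inv hz.1.1] at this
      exact (this.of_le (by exact_mod_cast le_top)).mono inter_subset_left
    · rw [Metric.tendsto_nhds]
      intro η hη
      have h0 := contDiffWithinAt_localRep f₀ hw hx hy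
      obtain ⟨o', ho', hzo', hc⟩ := (h0.of_le (m := (j : ℕ)) (by exact_mod_cast le_top)
        |>.jetConvergentAt (A := Unit) (mem_chartDomain hw hx) ⊤).exists_isOpen_contDiffOn
      have hcont : ContinuousWithinAt (iteratedFDerivWithin ℝ j (f₀.localRep x y)
          (chartDomain I N x)) (chartDomain I N x) (extChartAt I x w) := by
        have h1 : ContDiffOn ℝ j (f₀.localRep x y) (chartDomain I N x ∩ o') := by simpa using hc
        have h2 := (h1.continuousOn_iteratedFDerivWithin le_rfl (hD.inter ho')) (extChartAt I x w)
          ⟨mem_chartDomain hw hx, hzo'⟩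
        have h3 := h2.congr_of_eventuallyEq (g := iteratedFDerivWithin ℝ j (f₀.localRep x y)
          (chartDomain I N x)) (eventually_mem_nhdsWithin.mono fun z hz =>
            (iteratedFDerivWithin_inter_open ho' hz.2).symm)
            (iteratedFDerivWithin_inter_open ho' hzo').symm
        exact h3.mono_of_mem_nhdsWithin (inter_mem_nhdsWithin _ (ho'.mem_nhds hzo'))
      have h4 := Metric.tendsto_nhds.1 hcont (η / 2) (half_pos hη)
      filter_upwards [prod_mem_prod (hmem (η / 2) (half_pos hη))
        (inter_mem (inter_mem h4 hKD) self_mem_nhdsWithin)] with q hq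
      have h5 := hq.1.2 j hj _ hq.2.1.2
      rw [(extChartAt I x).right_inv hq.2.2.1, ← dist_eq_norm] at h5
      have h6 := hq.2.1.1
      exact (dist_triangle _ _ _).trans_lt ((add_lt_add h5 h6).trans_eq (add_halves η))
  refine ⟨hjet, ?_⟩
  have h1 := hjet.tendsto_of_pure (a₀ := f₀) (by
    let : TopologicalSpace (SmoothMapOn I J N Y) := whitney r
    exact pure_le_nhds f₀) (mem_chartDomain hw hx)
  have e : f₀.localRep x y (extChartAt I x w) = extChartAt J y (f₀.ext w) := by
    simp only [localRep, Function.comp_apply, (extChartAt I x).left_inv hx]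
  rw [e] at h1
  refine tendsto_of_tendsto_chartRep (g := fun f : SmoothMapOn I J N Y => f.ext) h1 hx hy ?_
  filter_upwards [prod_mem_prod (hmem 1 one_pos) hKw] with q hq using hq.1.1 _ hq.2

/-- A family of smooth maps whose jets depend continuously on the parameter and the point is
continuous for the weak Whitney topology. -/
theorem tendsto_whitney_of_jetConvergentAt (hNu : UniqueMDiffOn I N) {r : ℕ∞}
    {l : Filter A} {g : A → SmoothMapOn I J N Y} {a₀ : A} (ha₀ : pure a₀ ≤ l)
    (ht : ∀ w ∈ N, Tendsto (fun q : A × M => (g q.1).ext q.2) (l ×ˢ 𝓝[N] w) (𝓝 ((g a₀).ext w)))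
    (hg : ∀ n : ℕ, (n : ℕ∞) ≤ r → ∀ w ∈ N, ∃ x y, w ∈ (extChartAt I x).source ∧
      (g a₀).ext w ∈ (extChartAt J y).source ∧
      JetConvergentAt l n (fun a => (g a).localRep x y) (chartDomain I N x) (extChartAt I x w)) :
    Tendsto g l (@nhds _ (whitney r) (g a₀)) := by
  have : IsManifold I 1 M := IsManifold.of_le (n := ∞) (by norm_cast)
  rw [TopologicalSpace.tendsto_nhds_generateFrom_iff]
  rintro _ ⟨f, x, y, K, k, η, hK, hKN, hfK, hkr, hη, rfl⟩ hmem
  have hD : UniqueDiffOn ℝ (chartDomain I N x) := hNu.uniqueDiffOn_target_inter x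
  have hKN' : K ⊆ N := fun w hw => (hKN hw).1
  have h1 : ∀ᶠ a in l, ∀ w ∈ K, (g a).ext w ∈ (extChartAt J y).source := by
    refine eventually_forall_mem_of_isCompact hK fun w hw => ?_
    exact ((ht w (hKN' hw)).mono_left (prod_mono_right _ (nhdsWithin_mono _ hKN'))).eventually
      (extChartAt_source_mem_nhds' (hmem.1 w hw))
  have h2 : ∀ j ∈ Finset.range (k + 1), ∀ᶠ a in l, ∀ w ∈ K,
      ‖iteratedFDerivWithin ℝ j ((g a).localRep x y) (chartDomain I N x) (extChartAt I x w) -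
        iteratedFDerivWithin ℝ j (f.localRep x y) (chartDomain I N x) (extChartAt I x w)‖ < η := by
    intro j hj
    have hj' : j ≤ k := Nat.lt_succ_iff.1 (Finset.mem_range.1 hj)
    refine eventually_forall_mem_of_isCompact hK fun w hw => ?_
    obtain ⟨x', y', hx', hy', hJ⟩ := hg k hkr w (hKN' hw)
    have hwD := mem_chartDomain (I := I) (hKN' hw) (hKN hw).2
    have hJ2 : JetConvergentAt l k (fun a => (g a).localRep x y) (chartDomain I N x)
        (extChartAt I x w) :=
      hJ.change_charts (ht w (hKN' hw)) (hKN' hw) hx' (hKN hw).2 hy' (hmem.1 w hw)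
    have hf2 : JetConvergentAt l k (fun _ => f.localRep x y) (chartDomain I N x)
        (extChartAt I x w) :=
      ((contDiffWithinAt_localRep f (hKN' hw) (hKN hw).2 (hfK w hw)).of_le
        (by exact_mod_cast le_top)).jetConvergentAt hwD l
    have lim : ∀ {G : A → E → E'}, JetConvergentAt l k G (chartDomain I N x) (extChartAt I x w) →
        Tendsto (fun q : A × E => iteratedFDerivWithin ℝ j (G q.1) (chartDomain I N x) q.2)
          (l ×ˢ 𝓝[chartDomain I N x] (extChartAt I x w))
          (𝓝 (iteratedFDerivWithin ℝ j (G a₀) (chartDomain I N x) (extChartAt I x w))) := by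
      intro G hG
      obtain ⟨q, hq⟩ := hG.exists_tendsto_iteratedFDerivWithin hD hj'
      have h1 : pure (a₀, extChartAt I x w) ≤ l ×ˢ 𝓝[chartDomain I N x] (extChartAt I x w) := by
        rw [← prod_pure_pure]; exact prod_mono ha₀ (pure_le_nhdsWithin hwD)
      have h2 := hq.mono_left h1
      rwa [tendsto_nhds_unique h2 (tendsto_pure_nhds _ _)] at hq
    have h3 := ((lim hJ2).sub (lim hf2)).norm
    have h4 := h3.eventually (gt_mem_nhds (hmem.2 j hj' w hw))
    have h5 : Tendsto (fun q : A × M => (q.1, extChartAt I x q.2)) (l ×ˢ 𝓝[K] w)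
        (l ×ˢ 𝓝[chartDomain I N x] (extChartAt I x w)) :=
      tendsto_id.prodMap ((tendsto_extChartAt_chartDomain (hKN hw).2).mono_left
        (nhdsWithin_mono _ hKN'))
    exact h5.eventually h4
  filter_upwards [h1, (eventually_all_finset _).2 h2] with a ha1 ha2
  exact ⟨ha1, fun j hj => ha2 j (Finset.mem_range.2 (by omega))⟩

end Whitney

/-! ### Charts of total spaces of vector bundles -/

section Scale

variable {B F : Type*} {V : B → Type*} [∀ b, AddCommGroup (V b)] [∀ b, Module ℝ (V b)]

theorem scale_one (w : TotalSpace F V) : scale 1 w = w :=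
  congrArg (TotalSpace.mk w.proj) (one_smul ℝ w.2)

theorem scale_scale (s t : ℝ) (w : TotalSpace F V) : scale s (scale t w) = scale (s * t) w :=
  congrArg (TotalSpace.mk w.proj) (smul_smul s t w.2)

theorem scale_zero (w : TotalSpace F V) : scale 0 w = zeroSection F V w.proj :=
  congrArg (TotalSpace.mk w.proj) (zero_smul ℝ w.2)

theorem scale_zeroSection (t : ℝ) (b : B) : scale t (zeroSection F V b) = zeroSection F V b :=
  congrArg (TotalSpace.mk b) (smul_zero t)

end Scale

section TotalSpaceCharts

variable
  {EB : Type*} [NormedAddCommGroup EB] [NormedSpace ℝ EB]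
  {HB : Type*} [TopologicalSpace HB] {IB : ModelWithCorners ℝ EB HB}
  {B : Type*} [TopologicalSpace B] [ChartedSpace HB B]
  {F : Type*} [NormedAddCommGroup F] [NormedSpace ℝ F]
  {V : B → Type*} [TopologicalSpace (TotalSpace F V)]
  [∀ b, AddCommGroup (V b)] [∀ b, Module ℝ (V b)] [∀ b, TopologicalSpace (V b)]
  [FiberBundle F V]

theorem t2Space_totalSpace [T2Space B] : T2Space (TotalSpace F V) := by
  refine ⟨fun w w' hne => ?_⟩
  by_cases h : w.proj = w'.proj
  · set e := trivializationAt F V w.proj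
    have h1 : w ∈ e.source := e.mem_source.2 (mem_baseSet_trivializationAt F V w.proj)
    have h2 : w' ∈ e.source := e.mem_source.2 (h ▸ mem_baseSet_trivializationAt F V w.proj)
    obtain ⟨u, v, hu, hv, hwu, hwv, huv⟩ := t2_separation (e.injOn.ne h1 h2 hne)
    exact ⟨_, _, e.continuousOn.isOpen_inter_preimage e.open_source hu,
      e.continuousOn.isOpen_inter_preimage e.open_source hv, ⟨h1, hwu⟩, ⟨h2, hwv⟩,
      (huv.preimage e).mono inter_subset_right inter_subset_right⟩
  · obtain ⟨u, v, hu, hv, hwu, hwv, huv⟩ := t2_separation h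
    exact ⟨_, _, hu.preimage (FiberBundle.continuous_proj F V),
      hv.preimage (FiberBundle.continuous_proj F V), hwu, hwv, huv.preimage _⟩

variable (IB F V) in
/-- The chart of the total space that consists of the preferred trivialization and the preferred
chart of the base at `b`. It is the preferred chart at every point of the fibre over `b`. -/
noncomputable abbrev bundleChart (b : B) : PartialEquiv (TotalSpace F V) (EB × F) :=
  extChartAt (IB.prod 𝓘(ℝ, F)) (zeroSection F V b)

theorem extChartAt_eq_bundleChart (w : TotalSpace F V) :
    extChartAt (IB.prod 𝓘(ℝ, F)) w = bundleChart IB F V w.proj := by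
  rw [bundleChart, FiberBundle.extChartAt, FiberBundle.extChartAt]; rfl

theorem mem_bundleChart_source {b : B} {w : TotalSpace F V} :
    w ∈ (bundleChart IB F V b).source ↔
      w.proj ∈ (trivializationAt F V b).baseSet ∧ w.proj ∈ (extChartAt IB b).source := by
  rw [bundleChart, FiberBundle.extChartAt]
  simp only [PartialEquiv.trans_source, mem_inter_iff, mem_preimage, PartialEquiv.prod_source,
    PartialEquiv.refl_source, mem_prod, mem_univ, and_true, zeroSection_proj]
  constructor
  · rintro ⟨h1, h2⟩
    have h1' : w ∈ (trivializationAt F V b).source := h1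
    refine ⟨(Trivialization.mem_source _).1 h1', ?_⟩
    have : (trivializationAt F V b w).1 = w.proj := Trivialization.coe_fst _ h1'
    rwa [← this]
  · rintro ⟨h1, h2⟩
    have h1' : w ∈ (trivializationAt F V b).source := (Trivialization.mem_source _).2 h1
    refine ⟨h1', ?_⟩
    have : (trivializationAt F V b w).1 = w.proj := Trivialization.coe_fst _ h1'
    change (trivializationAt F V b w).1 ∈ _
    rwa [this]

theorem bundleChart_apply {b : B} {w : TotalSpace F V}
    (hw : w.proj ∈ (trivializationAt F V b).baseSet) :
    bundleChart IB F V b w = (extChartAt IB b w.proj, (trivializationAt F V b w).2) := by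
  rw [bundleChart, FiberBundle.extChartAt]
  have : (trivializationAt F V b w).1 = w.proj :=
    Trivialization.coe_fst _ ((Trivialization.mem_source _).2 hw)
  simp only [PartialEquiv.coe_trans, Function.comp_apply, PartialEquiv.prod_coe,
    PartialEquiv.refl_coe, id_eq, zeroSection_proj]
  change (extChartAt IB b (trivializationAt F V b w).1, _) = _
  rw [this]
  rfl

theorem mem_bundleChart_source_of_proj_eq {b : B} {w w' : TotalSpace F V} (h : w'.proj = w.proj)
    (hw : w ∈ (bundleChart IB F V b).source) : w' ∈ (bundleChart IB F V b).source := by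
  rw [mem_bundleChart_source] at hw ⊢
  rwa [h]

theorem scale_mem_bundleChart_source {b : B} {w : TotalSpace F V} {t : ℝ}
    (hw : w ∈ (bundleChart IB F V b).source) : scale t w ∈ (bundleChart IB F V b).source :=
  mem_bundleChart_source_of_proj_eq (w := w) rfl hw

theorem self_mem_bundleChart_source (w : TotalSpace F V) :
    w ∈ (bundleChart IB F V w.proj).source := by
  rw [← extChartAt_eq_bundleChart]; exact mem_extChartAt_source w

variable [VectorBundle ℝ F V]

theorem bundleChart_scale {b : B} {w : TotalSpace F V} {t : ℝ}
    (hw : w ∈ (bundleChart IB F V b).source) :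
    bundleChart IB F V b (scale t w) =
      ((bundleChart IB F V b w).1, t • (bundleChart IB F V b w).2) := by
  have hw1 := (mem_bundleChart_source.1 hw).1
  rw [bundleChart_apply hw1, bundleChart_apply (w := scale t w) hw1]
  have := ((trivializationAt F V b).linear ℝ hw1).map_smul t w.2
  exact Prod.ext rfl this

theorem range_prod_self : range (IB.prod 𝓘(ℝ, F)) = range IB ×ˢ univ := by
  rw [modelWithCorners_prod_coe, range_prodMap]; simp

/-- The chart domains of a total space are products with the whole model fibre. -/
theorem bundleChart_target {b : B} : ∃ R : Set EB,
    (bundleChart IB F V b).target = R ×ˢ univ ∧ R ⊆ range IB ∧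
      ∀ w ∈ (bundleChart IB F V b).source, R ∈ 𝓝[range IB] (bundleChart IB F V b w).1 := by
  refine ⟨_, FiberBundle.extChartAt_target (IB := IB) (zeroSection F V b), fun x hx =>
    extChartAt_target_subset_range b hx.1, fun w hw => ?_⟩
  have hw' := mem_bundleChart_source.1 hw
  rw [bundleChart_apply hw'.1]
  refine inter_mem (extChartAt_target_mem_nhdsWithin' hw'.2) (mem_nhdsWithin_of_mem_nhds ?_)
  apply (continuousAt_extChartAt_symm' hw'.2).preimage_mem_nhds
  rw [(extChartAt IB b).left_inv hw'.2]
  exact (trivializationAt F V b).open_baseSet.mem_nhds hw'.1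

theorem bundleChart_symm_smul {b : B} {z : EB × F} (hz : z ∈ (bundleChart IB F V b).target)
    (t : ℝ) : (bundleChart IB F V b).symm (z.1, t • z.2) =
      scale t ((bundleChart IB F V b).symm z) := by
  have h1 := (bundleChart IB F V b).map_target hz
  have h2 := scale_mem_bundleChart_source (t := t) h1
  have h3 := bundleChart_scale (t := t) h1
  rw [(bundleChart IB F V b).right_inv hz] at h3
  rw [← h3, (bundleChart IB F V b).left_inv h2]

theorem bundleChart_zeroSection {b b' : B}
    (hw : zeroSection F V b' ∈ (bundleChart IB F V b).source) :
    bundleChart IB F V b (zeroSection F V b') = (extChartAt IB b b', 0) := by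
  have h := bundleChart_scale (t := 0) hw
  rw [scale_zeroSection, zero_smul] at h
  rw [h, bundleChart_apply (mem_bundleChart_source.1 hw).1]
  rfl

theorem tendsto_of_tendsto_bundleChart {X : Type*} {L : Filter X} {φ : X → TotalSpace F V}
    {y : TotalSpace F V} {c : B} (hy : y ∈ (bundleChart IB F V c).source)
    (h : Tendsto (fun x => bundleChart IB F V c (φ x)) L (𝓝 (bundleChart IB F V c y)))
    (hs : ∀ᶠ x in L, φ x ∈ (bundleChart IB F V c).source) : Tendsto φ L (𝓝 y) := by
  have h3 := (continuousAt_extChartAt_symm' hy).tendsto.comp h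
  rw [(bundleChart IB F V c).left_inv hy] at h3
  refine h3.congr' ?_
  filter_upwards [hs] with x hx using (bundleChart IB F V c).left_inv hx

end TotalSpaceCharts

/-! ### The fibre derivative and the Jacobi matrix in charts -/

section Homotopy

variable
  {EB : Type*} [NormedAddCommGroup EB] [NormedSpace ℝ EB]
  {HB : Type*} [TopologicalSpace HB] {IB : ModelWithCorners ℝ EB HB}
  {B : Type*} [TopologicalSpace B] [ChartedSpace HB B]
  {F : Type*} [NormedAddCommGroup F] [NormedSpace ℝ F]
  {V : B → Type*} [TopologicalSpace (TotalSpace F V)]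
  [∀ b, AddCommGroup (V b)] [∀ b, Module ℝ (V b)] [∀ b, TopologicalSpace (V b)]
  [FiberBundle F V] [VectorBundle ℝ F V]
  {EC : Type*} [NormedAddCommGroup EC] [NormedSpace ℝ EC]
  {HC : Type*} [TopologicalSpace HC] {IC : ModelWithCorners ℝ EC HC}
  {C : Type*} [TopologicalSpace C] [ChartedSpace HC C]
  {G : Type*} [NormedAddCommGroup G] [NormedSpace ℝ G]
  {W : C → Type*} [TopologicalSpace (TotalSpace G W)]
  [∀ c, AddCommGroup (W c)] [∀ c, Module ℝ (W c)] [∀ c, TopologicalSpace (W c)]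
  [FiberBundle G W] [VectorBundle ℝ G W]
  {N : Set (TotalSpace F V)}
  [IsManifold IB ∞ B] [ContMDiffVectorBundle ∞ F V IB]
  [IsManifold IC ∞ C] [ContMDiffVectorBundle ∞ G W IC] [T2Space C]

variable (IB IC) in
/-- The local representation of a map between total spaces in bundle charts. -/
noncomputable abbrev bundleRep (b : B) (c : C) (g : TotalSpace F V → TotalSpace G W) :
    EB × F → EC × G :=
  chartRep (IB.prod 𝓘(ℝ, F)) (IC.prod 𝓘(ℝ, G)) (zeroSection F V b) (zeroSection G W c) g

variable (IB) in
/-- The part of the chart at `b` that lies in `N`. -/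
abbrev bundleDomain (N : Set (TotalSpace F V)) (b : B) : Set (EB × F) :=
  SmoothMapOn.chartDomain (IB.prod 𝓘(ℝ, F)) N (zeroSection F V b)

theorem zeroSection_mem (hN : N ∈ 𝓝ˢ (range (zeroSection F V))) (b : B) :
    zeroSection F V b ∈ N := subset_of_mem_nhdsSet hN (mem_range_self b)

theorem mem_nhds_zeroSection (hN : N ∈ 𝓝ˢ (range (zeroSection F V))) (b : B) :
    N ∈ 𝓝 (zeroSection F V b) := mem_nhdsSet_iff_forall.1 hN _ (mem_range_self b)

theorem ext_zeroSection (hN : N ∈ 𝓝ˢ (range (zeroSection F V))) {f : BundleMap IB IC N G W}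
    (hf : f ∈ pairMaps IB IC G W N) (b : B) :
    f.ext (zeroSection F V b) = zeroSection G W (f.ext (zeroSection F V b)).proj := by
  have hb := zeroSection_mem hN b
  obtain ⟨c, hc⟩ := hf ⟨_, hb⟩ (mem_range_self b)
  rw [f.ext_of_mem hb, ← hc]; rfl

/-- Near interior points of `N`, the chart domain is the whole model domain. -/
theorem nhdsWithin_bundleDomain {w : TotalSpace F V} {b : B}
    (hw : w ∈ (bundleChart IB F V b).source) (hN : N ∈ 𝓝 w) :
    𝓝[bundleDomain IB N b] (bundleChart IB F V b w) =
      𝓝[range IB ×ˢ univ] (bundleChart IB F V b w) := by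
  rw [← chartDomain_eventuallyEq hw, ← range_prod_self]
  apply le_antisymm (nhdsWithin_mono _ inter_subset_right)
  rw [nhdsWithin_le_iff, inter_comm]
  refine inter_mem_nhdsWithin _ ((continuousAt_extChartAt_symm' hw).preimage_mem_nhds ?_)
  rwa [(bundleChart IB F V b).left_inv hw]

/-- At points of the zero section the local representation is smooth on the whole model domain
`range IB ×ˢ univ`, and not only on the part in `N`: `N` is a neighbourhood of the zero section. -/
theorem contDiffWithinAt_bundleRep_zero (hN : N ∈ 𝓝ˢ (range (zeroSection F V)))
    (f : BundleMap IB IC N G W) {b₀ b : B} {c : C}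
    (hb : zeroSection F V b ∈ (bundleChart IB F V b₀).source)
    (hc : f.ext (zeroSection F V b) ∈ (bundleChart IC G W c).source) :
    ContDiffWithinAt ℝ ∞ (bundleRep IB IC b₀ c f.ext) (range IB ×ˢ univ)
      (extChartAt IB b₀ b, 0) := by
  have h := contDiffWithinAt_localRep f (zeroSection_mem hN b) hb hc
  have h2 := h.mono_of_mem_nhdsWithin (t := range IB ×ˢ univ)
    (nhdsWithin_bundleDomain hb (mem_nhds_zeroSection hN b) ▸ self_mem_nhdsWithin)
  rwa [bundleChart_zeroSection hb] at h2

theorem bundleRep_zero (hN : N ∈ 𝓝ˢ (range (zeroSection F V))) {f : BundleMap IB IC N G W}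
    (hf : f ∈ pairMaps IB IC G W N) {b₀ b : B} {c : C}
    (hb : zeroSection F V b ∈ (bundleChart IB F V b₀).source)
    (hc : f.ext (zeroSection F V b) ∈ (bundleChart IC G W c).source) :
    bundleRep IB IC b₀ c f.ext (extChartAt IB b₀ b, 0) =
      (extChartAt IC c (f.ext (zeroSection F V b)).proj, 0) := by
  rw [← bundleChart_zeroSection hb]
  simp only [bundleRep, chartRep, Function.comp_apply, (bundleChart IB F V b₀).left_inv hb]
  rw [ext_zeroSection hN hf] at hc ⊢
  exact bundleChart_zeroSection hc

/-- In bundle charts, the limit of `τ⁻¹ f(τ w)` as `τ → 0` is given by the derivative of the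
fibre part in the direction of the fibre. -/
theorem tendsto_scale_inv (hN : N ∈ 𝓝ˢ (range (zeroSection F V))) {f : BundleMap IB IC N G W}
    (hf : f ∈ pairMaps IB IC G W N) {w : TotalSpace F V} {b₀ : B} {c : C}
    (hw : w ∈ (bundleChart IB F V b₀).source)
    (hc : f.ext (zeroSection F V w.proj) ∈ (bundleChart IC G W c).source) :
    (extChartAt IC c (f.ext (zeroSection F V w.proj)).proj,
        fderivWithin ℝ (fun z => (bundleRep IB IC b₀ c f.ext z).2) (range IB ×ˢ univ)
          (extChartAt IB b₀ w.proj, 0) (0, (bundleChart IB F V b₀ w).2)) ∈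
        (bundleChart IC G W c).target ∧
      Tendsto (fun τ : ℝ => scale τ⁻¹ (f.ext (scale τ w))) (𝓝[>] 0)
        (𝓝 ((bundleChart IC G W c).symm (extChartAt IC c (f.ext (zeroSection F V w.proj)).proj,
          fderivWithin ℝ (fun z => (bundleRep IB IC b₀ c f.ext z).2) (range IB ×ˢ univ)
          (extChartAt IB b₀ w.proj, 0) (0, (bundleChart IB F V b₀ w).2)))) := by
  have hb : zeroSection F V w.proj ∈ (bundleChart IB F V b₀).source :=
    mem_bundleChart_source_of_proj_eq (w := w) rfl hw
  set x := extChartAt IB b₀ w.proj with hx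
  set v := (bundleChart IB F V b₀ w).2 with hv
  set φ := bundleRep IB IC b₀ c f.ext with hφ
  have hwx : bundleChart IB F V b₀ w = (x, v) := by
    rw [hv, bundleChart_apply (mem_bundleChart_source.1 hw).1]
  have hxr : x ∈ range IB :=
    extChartAt_target_subset_range b₀
      ((extChartAt IB b₀).map_source (mem_bundleChart_source.1 hw).2)
  have hφ0 : φ (x, 0) = (extChartAt IC c (f.ext (zeroSection F V w.proj)).proj, 0) :=
    bundleRep_zero hN hf hb hc
  have hdiff : ContDiffWithinAt ℝ ∞ φ (range IB ×ˢ univ) (x, 0) :=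
    contDiffWithinAt_bundleRep_zero hN f hb hc
  obtain ⟨R, hR, hRr, hRn⟩ := bundleChart_target (IB := IC) (F := G) (V := W) (b := c)
  have htar : ∀ g : G, (extChartAt IC c (f.ext (zeroSection F V w.proj)).proj, g) ∈
      (bundleChart IC G W c).target := fun g => by
    rw [hR]
    refine ⟨?_, mem_univ _⟩
    have h1 := (bundleChart IC G W c).map_source hc
    rw [bundleChart_apply (mem_bundleChart_source.1 hc).1, hR] at h1
    exact h1.1
  refine ⟨htar _, ?_⟩
  -- the path `τ ↦ (x, τ v)` in the chart
  have hpath : HasDerivWithinAt (fun τ : ℝ => (x, τ • v)) ((0 : EB), v) (Ioi 0) 0 := by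
    refine (hasDerivWithinAt_const _ _ _).prodMk ?_
    simpa using ((hasDerivAt_id (0 : ℝ)).smul_const v).hasDerivWithinAt
  have h2 : HasFDerivWithinAt (fun z => (φ z).2) (fderivWithin ℝ (fun z => (φ z).2)
      (range IB ×ˢ univ) (x, (0 : ℝ) • v)) (range IB ×ˢ univ) (x, (0 : ℝ) • v) := by
    rw [zero_smul]
    exact ((hdiff.snd).differentiableWithinAt (by simp)).hasFDerivWithinAt
  have h3 := h2.comp_hasDerivWithinAt (0 : ℝ) hpath 
    fun τ _ => (⟨hxr, mem_univ _⟩ : (x, τ • v) ∈ range IB ×ˢ (univ : Set F))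
  have h4 : Tendsto (fun τ : ℝ => τ⁻¹ • (φ (x, τ • v)).2) (𝓝[>] 0)
      (𝓝 (fderivWithin ℝ (fun z => (φ z).2) (range IB ×ˢ univ) (x, 0) (0, v))) := by
    have := hasDerivWithinAt_iff_tendsto_slope' (self_notMem_Ioi) |>.1 h3
    rw [zero_smul] at this
    refine this.congr fun τ => ?_
    simp [slope, hφ0]
  have hpc : Tendsto (fun τ : ℝ => (x, τ • v)) (𝓝[>] 0) (𝓝[range IB ×ˢ univ] (x, 0)) := by
    refine tendsto_nhdsWithin_iff.2 ⟨?_, Eventually.of_forall fun τ => ⟨hxr, mem_univ _⟩⟩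
    have := hpath.continuousWithinAt.tendsto
    rwa [zero_smul] at this
  have h5 : Tendsto (fun τ : ℝ => (φ (x, τ • v)).1) (𝓝[>] 0)
      (𝓝 (extChartAt IC c (f.ext (zeroSection F V w.proj)).proj)) := by
    have := hdiff.continuousWithinAt.tendsto.comp hpc
    rw [hφ0] at this
    exact (continuous_fst.tendsto _).comp this
  have h6 := (h5.prodMk_nhds h4)
  have hsymm : ContinuousAt (bundleChart IC G W c).symm
      (extChartAt IC c (f.ext (zeroSection F V w.proj)).proj,
        fderivWithin ℝ (fun z => (φ z).2) (range IB ×ˢ univ) (x, 0) (0, v)) :=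
    continuousAt_extChartAt_symm'' (htar _)
  refine (hsymm.tendsto.comp h6).congr' ?_
  -- for small `τ > 0` the point `f (τ w)` lies in the chart
  have h7 : ∀ᶠ τ : ℝ in 𝓝[>] 0, f.ext (scale τ w) ∈ (bundleChart IC G W c).source := by
    have hcont : ContinuousWithinAt f.ext N (zeroSection F V w.proj) :=
      (f.contMDiffOn_ext _ (zeroSection_mem hN _)).continuousWithinAt
    have h8 := hcont.continuousAt (mem_nhds_zeroSection hN _) |>.preimage_mem_nhds
      (extChartAt_source_mem_nhds' hc)
    have h9 : Tendsto (fun τ : ℝ => (bundleChart IB F V b₀).symm (x, τ • v)) (𝓝[>] 0)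
        (𝓝 (zeroSection F V w.proj)) := by
      have h10 := (continuousAt_extChartAt_symm' hb).tendsto
      rw [(bundleChart IB F V b₀).left_inv hb, bundleChart_zeroSection hb] at h10
      exact h10.comp (hpc.mono_right nhdsWithin_le_nhds)
    have h11 := h9.eventually h8
    filter_upwards [h11] with τ hτ
    have h12 := bundleChart_symm_smul ((bundleChart IB F V b₀).map_source hw) τ
    rw [(bundleChart IB F V b₀).left_inv hw, hwx] at h12
    rw [← h12]; exact hτ
  filter_upwards [h7] with τ hτ
  have h12 := bundleChart_symm_smul ((bundleChart IB F V b₀).map_source hw) τ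
  rw [(bundleChart IB F V b₀).left_inv hw, hwx] at h12
  have h13 : φ (x, τ • v) = bundleChart IC G W c (f.ext (scale τ w)) := by
    simp only [hφ, bundleRep, chartRep, Function.comp_apply, h12]
  have h14 := bundleChart_symm_smul ((bundleChart IC G W c).map_source hτ) τ⁻¹
  rw [(bundleChart IC G W c).left_inv hτ] at h14
  simp only [Function.comp_apply, h13, h14]

theorem mfderivWithin_zeroSection (hN : N ∈ 𝓝ˢ (range (zeroSection F V)))
    (f : BundleMap IB IC N G W) (hf : f ∈ pairMaps IB IC G W N) (b : B) :
    (f.tangentMapAt (zeroSection F V b) : EB × F →L[ℝ] EC × G) =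
      fderivWithin ℝ (bundleRep IB IC b (f.ext (zeroSection F V b)).proj f.ext)
        (range IB ×ˢ univ) (extChartAt IB b b, 0) := by
  have hb : zeroSection F V b ∈ (bundleChart IB F V b).source :=
    self_mem_bundleChart_source (IB := IB) (zeroSection F V b)
  have hd : MDifferentiableWithinAt (IB.prod 𝓘(ℝ, F)) (IC.prod 𝓘(ℝ, G)) f.ext N
      (zeroSection F V b) :=
    (f.contMDiffOn_ext _ (zeroSection_mem hN b)).mdifferentiableWithinAt (by simp)
  have e1 : writtenInExtChartAt (IB.prod 𝓘(ℝ, F)) (IC.prod 𝓘(ℝ, G)) (zeroSection F V b) f.ext =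
      bundleRep IB IC b (f.ext (zeroSection F V b)).proj f.ext := by
    rw [bundleRep, chartRep, ← ext_zeroSection hN hf b]; rfl
  refine hd.mfderivWithin.trans ?_
  rw [e1, ← bundleChart_zeroSection hb]
  exact fderivWithin_congr_set (nhdsWithin_eq_iff_eventuallyEq.1
    ((chartDomain_eventuallyEq (N := N) hb).trans
      (nhdsWithin_bundleDomain hb (mem_nhds_zeroSection hN b))))

/-- The block `S` of the Jacobi matrix as a derivative in bundle charts. -/
theorem verticalBlock_eq (hN : N ∈ 𝓝ˢ (range (zeroSection F V)))
    {f : BundleMap IB IC N G W} (hf : f ∈ pairMaps IB IC G W N) (b : B) (v : F) :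
    verticalBlock f b v = fderivWithin ℝ
      (fun z => (bundleRep IB IC b (f.ext (zeroSection F V b)).proj f.ext z).2)
      (range IB ×ˢ univ) (extChartAt IB b b, 0) (0, v) := by
  have hb : zeroSection F V b ∈ (bundleChart IB F V b).source :=
    self_mem_bundleChart_source (IB := IB) (zeroSection F V b)
  have hc := self_mem_bundleChart_source (IB := IC) (f.ext (zeroSection F V b))
  have hx : (extChartAt IB b b, (0 : F)) ∈ range IB ×ˢ (univ : Set F) :=
    ⟨mem_range_self _, mem_univ _⟩
  have hd := (contDiffWithinAt_bundleRep_zero hN f hb hc).differentiableWithinAt (by simp)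
  have hu : UniqueDiffWithinAt ℝ (range IB ×ˢ (univ : Set F)) (extChartAt IB b b, 0) :=
    (IB.uniqueDiffOn.prod uniqueDiffOn_univ) _ hx
  rw [(hd.hasFDerivWithinAt.snd).fderivWithin hu]
  have := mfderivWithin_zeroSection hN f hf b
  simp only [verticalBlock, this]
  rfl

/-- The block `P` of the Jacobi matrix as a derivative in bundle charts. -/
theorem horizontalBlock_eq (hN : N ∈ 𝓝ˢ (range (zeroSection F V)))
    {f : BundleMap IB IC N G W} (hf : f ∈ pairMaps IB IC G W N) (b : B) (u : EB) :
    horizontalBlock f b u = fderivWithin ℝ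
      (fun z => (bundleRep IB IC b (f.ext (zeroSection F V b)).proj f.ext z).1)
      (range IB ×ˢ univ) (extChartAt IB b b, 0) (u, 0) := by
  have hb : zeroSection F V b ∈ (bundleChart IB F V b).source :=
    self_mem_bundleChart_source (IB := IB) (zeroSection F V b)
  have hc := self_mem_bundleChart_source (IB := IC) (f.ext (zeroSection F V b))
  have hx : (extChartAt IB b b, (0 : F)) ∈ range IB ×ˢ (univ : Set F) :=
    ⟨mem_range_self _, mem_univ _⟩
  have hd := (contDiffWithinAt_bundleRep_zero hN f hb hc).differentiableWithinAt (by simp)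
  have hu : UniqueDiffWithinAt ℝ (range IB ×ˢ (univ : Set F)) (extChartAt IB b b, 0) :=
    (IB.uniqueDiffOn.prod uniqueDiffOn_univ) _ hx
  rw [(hd.hasFDerivWithinAt.fst).fderivWithin hu]
  have := mfderivWithin_zeroSection hN f hf b
  simp only [horizontalBlock, this]
  rfl

/-- `T_fib f (w)` is the limit of `τ⁻¹ f(τ w)` as `τ → 0`. -/
theorem tendsto_fiberDeriv (hN : N ∈ 𝓝ˢ (range (zeroSection F V))) {f : BundleMap IB IC N G W}
    (hf : f ∈ pairMaps IB IC G W N) (w : TotalSpace F V) :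
    Tendsto (fun τ : ℝ => scale τ⁻¹ (f.ext (scale τ w))) (𝓝[>] 0) (𝓝 (fiberDeriv f w)) := by
  have hb := self_mem_bundleChart_source (IB := IB) w
  set c := (f.ext (zeroSection F V w.proj)).proj with hc'
  have hc := self_mem_bundleChart_source (IB := IC) (f.ext (zeroSection F V w.proj))
  obtain ⟨h1, h2⟩ := tendsto_scale_inv hN hf hb hc
  convert h2 using 2
  rw [← hc', ← verticalBlock_eq hN hf,
    bundleChart_apply (mem_baseSet_trivializationAt F V w.proj)]
  have h3 : fiberDeriv f w ∈ (bundleChart IC G W c).source :=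
    mem_bundleChart_source_of_proj_eq (w := f.ext (zeroSection F V w.proj)) rfl hc
  rw [← (bundleChart IC G W c).left_inv h3]
  congr 1
  have hcb : c ∈ (trivializationAt G W c).baseSet := mem_baseSet_trivializationAt G W c
  rw [bundleChart_apply (w := fiberDeriv f w) hcb]
  have h5 := congrArg Prod.snd ((trivializationAt G W c).apply_mk_symm hcb
    (verticalBlock f w.proj (trivializationAt F V w.proj w).2))
  exact Prod.ext rfl h5

/-- The local representation of `T_fib f` in arbitrary bundle charts. -/
theorem fiberDeriv_chart (hN : N ∈ 𝓝ˢ (range (zeroSection F V))) {f : BundleMap IB IC N G W}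
    (hf : f ∈ pairMaps IB IC G W N) {w : TotalSpace F V} {b₀ : B} {c : C}
    (hw : w ∈ (bundleChart IB F V b₀).source)
    (hc : f.ext (zeroSection F V w.proj) ∈ (bundleChart IC G W c).source) :
    bundleChart IC G W c (fiberDeriv f w) =
      (extChartAt IC c (f.ext (zeroSection F V w.proj)).proj,
        fderivWithin ℝ (fun z => (bundleRep IB IC b₀ c f.ext z).2) (range IB ×ˢ univ)
          (extChartAt IB b₀ w.proj, 0) (0, (bundleChart IB F V b₀ w).2)) := by
  have := t2Space_totalSpace (F := G) (V := W)
  obtain ⟨h1, h2⟩ := tendsto_scale_inv hN hf hw hc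
  rw [tendsto_nhds_unique (tendsto_fiberDeriv hN hf w) h2, (bundleChart IC G W c).right_inv h1]

theorem fiberDeriv_proj (f : BundleMap IB IC N G W) (w : TotalSpace F V) :
    (fiberDeriv f w).proj = (f.ext (zeroSection F V w.proj)).proj := rfl

end Homotopy

/-! ### The Hadamard homotopy at time zero -/

section HadamardFamilies

variable
  {EB : Type*} [NormedAddCommGroup EB] [NormedSpace ℝ EB]
  {HB : Type*} [TopologicalSpace HB] {IB : ModelWithCorners ℝ EB HB}
  {B : Type*} [TopologicalSpace B] [ChartedSpace HB B]
  {F : Type*} [NormedAddCommGroup F] [NormedSpace ℝ F]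
  {V : B → Type*} [TopologicalSpace (TotalSpace F V)]
  [∀ b, AddCommGroup (V b)] [∀ b, Module ℝ (V b)] [∀ b, TopologicalSpace (V b)]
  [FiberBundle F V] [VectorBundle ℝ F V]
  {EC : Type*} [NormedAddCommGroup EC] [NormedSpace ℝ EC]
  {HC : Type*} [TopologicalSpace HC] {IC : ModelWithCorners ℝ EC HC}
  {C : Type*} [TopologicalSpace C] [ChartedSpace HC C]
  {G : Type*} [NormedAddCommGroup G] [NormedSpace ℝ G]
  {W : C → Type*} [TopologicalSpace (TotalSpace G W)]
  [∀ c, AddCommGroup (W c)] [∀ c, Module ℝ (W c)] [∀ c, TopologicalSpace (W c)]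
  [FiberBundle G W] [VectorBundle ℝ G W]
  {N : Set (TotalSpace F V)}
  [IsManifold IB ∞ B] [ContMDiffVectorBundle ∞ F V IB]
  [IsManifold IC ∞ C] [ContMDiffVectorBundle ∞ G W IC] [T2Space C]
  [T2Space B] [CompleteSpace G]

variable (IB IC) in
/-- The local representation of `(τ, w) ↦ α_f(τ, w)` in bundle charts. -/
noncomputable def hadamardRep (b : B) (c : C) (f : BundleMap IB IC N G W) (q : ℝ × (EB × F)) :
    EC × G :=
  bundleChart IC G W c (hadamardHomotopy f q.1 ((bundleChart IB F V b).symm q.2))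

theorem hadamardHomotopy_zero (f : BundleMap IB IC N G W) (w : TotalSpace F V) :
    hadamardHomotopy f 0 w = fiberDeriv f w := if_pos rfl

theorem hadamardHomotopy_of_ne (f : BundleMap IB IC N G W) {τ : ℝ} (hτ : τ ≠ 0)
    (w : TotalSpace F V) : hadamardHomotopy f τ w = scale τ⁻¹ (f.ext (scale τ w)) := if_neg hτ

theorem hadamardHomotopy_proj (f : BundleMap IB IC N G W) (τ : ℝ) (w : TotalSpace F V) :
    (hadamardHomotopy f τ w).proj = (f.ext (scale τ w)).proj := by
  by_cases hτ : τ = 0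
  · subst hτ; rw [hadamardHomotopy_zero, fiberDeriv_proj, scale_zero]
  · rw [hadamardHomotopy_of_ne f hτ]; rfl

theorem hadamardHomotopy_mem_source {f : BundleMap IB IC N G W} {τ : ℝ} {w : TotalSpace F V}
    {c : C} (hc : f.ext (scale τ w) ∈ (bundleChart IC G W c).source) :
    hadamardHomotopy f τ w ∈ (bundleChart IC G W c).source :=
  mem_bundleChart_source_of_proj_eq (hadamardHomotopy_proj f τ w) hc

theorem bundleRep_smul {b : B} {c : C} {g : TotalSpace F V → TotalSpace G W} {z : EB × F}
    (hz : z ∈ (bundleChart IB F V b).target) (τ : ℝ) : bundleRep IB IC b c g (z.1, τ • z.2) =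
      bundleChart IC G W c (g (scale τ ((bundleChart IB F V b).symm z))) := by
  simp only [bundleRep, chartRep, Function.comp_apply, bundleChart_symm_smul hz]

theorem hadamardRep_of_ne {f : BundleMap IB IC N G W} {b : B} {c : C} {τ : ℝ} {z : EB × F}
    (hτ : τ ≠ 0) (hz : z ∈ (bundleChart IB F V b).target)
    (hc : f.ext (scale τ ((bundleChart IB F V b).symm z)) ∈ (bundleChart IC G W c).source) :
    hadamardRep IB IC b c f (τ, z) = ((bundleRep IB IC b c f.ext (z.1, τ • z.2)).1,
      τ⁻¹ • (bundleRep IB IC b c f.ext (z.1, τ • z.2)).2) := by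
  rw [hadamardRep, hadamardHomotopy_of_ne f hτ, bundleChart_scale hc, bundleRep_smul hz]

theorem hadamardRep_eq (hN : N ∈ 𝓝ˢ (range (zeroSection F V))) {f : BundleMap IB IC N G W}
    (hf : f ∈ pairMaps IB IC G W N) {b : B} {c : C} {τ : ℝ} {z : EB × F}
    (hz : z ∈ (bundleChart IB F V b).target)
    (hc : f.ext (scale τ ((bundleChart IB F V b).symm z)) ∈ (bundleChart IC G W c).source) :
    hadamardRep IB IC b c f (τ, z) = ((bundleRep IB IC b c f.ext (z.1, τ • z.2)).1,
      hadamardQuotient (range IB) (fun z => (bundleRep IB IC b c f.ext z).2) (τ, z)) := by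
  by_cases hτ : τ = 0
  · subst hτ
    have hs := (bundleChart IB F V b).map_target hz
    rw [scale_zero] at hc
    rw [hadamardRep, hadamardHomotopy_zero, fiberDeriv_chart hN hf hs hc,
      (bundleChart IB F V b).right_inv hz]
    have h1 : bundleRep IB IC b c f.ext (z.1, (0 : ℝ) • z.2) = _ := bundleRep_smul hz 0
    rw [scale_zero, ext_zeroSection hN hf, bundleChart_zeroSection (by
      rwa [← ext_zeroSection hN hf])] at h1
    have h2 : extChartAt IB b ((bundleChart IB F V b).symm z).proj = z.1 := by
      have := (bundleChart IB F V b).right_inv hz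
      rw [bundleChart_apply (mem_bundleChart_source.1 hs).1] at this
      exact congrArg Prod.fst this
    rw [h1, h2]
    simp [hadamardQuotient]
  · rw [hadamardRep_of_ne hτ hz hc]
    simp [hadamardQuotient, hτ]

variable (IB IC N G W) in
/-- The filter of neighbourhoods of `f₀` in `C(N, F)` for the topology `W^r`. -/
noncomputable def pairNhds (r : ℕ∞) (f₀ : BundleMap IB IC N G W) : Filter (BundleMap IB IC N G W) :=
  @nhds _ (SmoothMapOn.whitney r) f₀ ⊓ 𝓟 (pairMaps IB IC G W N)

theorem pure_le_pairNhds {r : ℕ∞} {f₀ : BundleMap IB IC N G W} (hf₀ : f₀ ∈ pairMaps IB IC G W N) :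
    pure f₀ ≤ pairNhds IB IC G W N r f₀ := by
  let : TopologicalSpace (BundleMap IB IC N G W) := SmoothMapOn.whitney r
  exact le_inf (pure_le_nhds f₀) ((pure_le_principal _).2 hf₀)

/-- Joint jet-continuity of `(f, τ, w) ↦ α_f(τ, w)` at `τ = 0`. Here `w` need not lie in `N`. One
derivative is lost, since `α_f(τ, ·)` is an integral of the vertical derivative of `f`. -/
theorem jetConvergentAt_hadamardRep_zero (hNc : IsCompact N)
    (hNu : UniqueMDiffOn (IB.prod 𝓘(ℝ, F)) N)
    (hN : N ∈ 𝓝ˢ (range (zeroSection F V))) {r : ℕ∞} {n : ℕ} (hn : ((n + 1 : ℕ) : ℕ∞) ≤ r)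
    {f₀ : BundleMap IB IC N G W} (hf₀ : f₀ ∈ pairMaps IB IC G W N) {w₀ : TotalSpace F V} {b : B}
    {c : C} (hb : w₀ ∈ (bundleChart IB F V b).source)
    (hc : f₀.ext (zeroSection F V w₀.proj) ∈ (bundleChart IC G W c).source) :
    JetConvergentAt (pairNhds IB IC G W N r f₀) n (hadamardRep IB IC b c)
        (univ ×ˢ (range IB ×ˢ univ)) (0, bundleChart IB F V b w₀) ∧
      Tendsto (fun q : BundleMap IB IC N G W × (ℝ × TotalSpace F V) =>
        hadamardHomotopy q.1 q.2.1 q.2.2) (pairNhds IB IC G W N r f₀ ×ˢ 𝓝 (0, w₀))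
        (𝓝 (fiberDeriv f₀ w₀)) := by
  have := t2Space_totalSpace (F := F) (V := V)
  set l := pairNhds IB IC G W N r f₀ with hl
  have hpure : pure f₀ ≤ l := pure_le_pairNhds hf₀
  obtain ⟨x₀, v₀, hxv⟩ : ∃ x₀ v₀, bundleChart IB F V b w₀ = (x₀, v₀) := ⟨_, _, rfl⟩
  have hb0 : zeroSection F V w₀.proj ∈ (bundleChart IB F V b).source :=
    mem_bundleChart_source_of_proj_eq (w := w₀) rfl hb
  have hx₀ : extChartAt IB b w₀.proj = x₀ := by
    rw [bundleChart_apply (mem_bundleChart_source.1 hb).1] at hxv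
    exact congrArg Prod.fst hxv
  have hz0 : bundleChart IB F V b (zeroSection F V w₀.proj) = (x₀, 0) := by
    rw [bundleChart_zeroSection hb0, hx₀]
  have hx₀r : x₀ ∈ range IB :=
    hx₀ ▸ extChartAt_target_subset_range b
      ((extChartAt IB b).map_source (mem_bundleChart_source.1 hb).2)
  obtain ⟨R, hR, hRr, hRn⟩ := bundleChart_target (IB := IB) (F := F) (V := V) (b := b)
  have hRx : R ∈ 𝓝[range IB] x₀ := by have := hRn w₀ hb; rwa [hxv] at this
  obtain ⟨hj, ht⟩ := jetConvergentAt_localRep hNc hNu hn f₀ (zeroSection_mem hN w₀.proj) hb0 hc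
  have hj1 : JetConvergentAt l (n + 1) (fun f => bundleRep IB IC b c f.ext) (range IB ×ˢ univ)
      (x₀, 0) := by
    have := (hj.mono_filter (l' := l) inf_le_left).mono_nhdsWithin (T := range IB ×ˢ univ)
      (nhdsWithin_bundleDomain hb0 (mem_nhds_zeroSection hN _)).ge
    rwa [hz0] at this
  have ht1 : Tendsto (fun q : BundleMap IB IC N G W × TotalSpace F V => q.1.ext q.2)
      (l ×ˢ 𝓝 (zeroSection F V w₀.proj)) (𝓝 (f₀.ext (zeroSection F V w₀.proj))) := by
    rw [nhdsWithin_eq_nhds.2 (mem_nhds_zeroSection hN _)] at ht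
    exact ht.mono_left (prod_mono_left _ inf_le_left)
  have hsrc : ∀ᶠ q : BundleMap IB IC N G W × TotalSpace F V in l ×ˢ 𝓝 (zeroSection F V w₀.proj),
      q.1.ext q.2 ∈ (bundleChart IC G W c).source := ht1.eventually (extChartAt_source_mem_nhds' hc)
  -- the rescaled point tends to the zero section
  have hm : ContDiff ℝ ∞ (fun q : ℝ × (EB × F) => (q.2.1, q.1 • q.2.2)) := by fun_prop
  have hmem : ((0 : ℝ), (x₀, v₀)) ∈ (univ : Set ℝ) ×ˢ (range IB ×ˢ (univ : Set F)) :=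
    ⟨mem_univ _, hx₀r, mem_univ _⟩
  have hmt : Tendsto (fun q : ℝ × (EB × F) => (q.2.1, q.1 • q.2.2))
      (𝓝[univ ×ˢ (range IB ×ˢ univ)] (0, (x₀, v₀))) (𝓝[range IB ×ˢ univ] (x₀, 0)) := by
    refine tendsto_nhdsWithin_iff.2 ⟨?_, ?_⟩
    · exact (hm.continuous.tendsto' _ _ (by simp)).mono_left nhdsWithin_le_nhds
    · filter_upwards [self_mem_nhdsWithin] with q hq using ⟨hq.2.1, mem_univ _⟩
  have htar : ∀ᶠ q : ℝ × (EB × F) in 𝓝[univ ×ˢ (range IB ×ˢ univ)] (0, (x₀, v₀)),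
      q.2 ∈ (bundleChart IB F V b).target := by
    have h1 : Tendsto (fun q : ℝ × (EB × F) => q.2.1)
        (𝓝[univ ×ˢ (range IB ×ˢ univ)] (0, (x₀, v₀))) (𝓝[range IB] x₀) := by
      refine tendsto_nhdsWithin_iff.2 ⟨?_, ?_⟩
      · exact (Continuous.tendsto' (by fun_prop) _ _ rfl).mono_left nhdsWithin_le_nhds
      · filter_upwards [self_mem_nhdsWithin] with q hq using hq.2.1
    filter_upwards [h1.eventually hRx] with q hq
    rw [hR]; exact ⟨hq, mem_univ _⟩
  have hsymm : Tendsto (bundleChart IB F V b).symm (𝓝[range IB ×ˢ univ] (x₀, 0))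
      (𝓝 (zeroSection F V w₀.proj)) := by
    have := (continuousAt_extChartAt_symm' hb0).tendsto
    rw [(bundleChart IB F V b).left_inv hb0, hz0] at this
    exact this.mono_left nhdsWithin_le_nhds
  have hsrc2 : ∀ᶠ p : BundleMap IB IC N G W × (ℝ × (EB × F)) in
      l ×ˢ 𝓝[univ ×ˢ (range IB ×ˢ univ)] (0, (x₀, v₀)),
      p.1.ext (scale p.2.1 ((bundleChart IB F V b).symm p.2.2)) ∈
        (bundleChart IC G W c).source := by
    have h1 := (tendsto_id.prodMap (hsymm.comp hmt) : Tendsto _ (l ×ˢ _) (l ×ˢ _)).eventually hsrc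
    filter_upwards [h1, tendsto_snd.eventually htar] with p hp hp2
    rw [← bundleChart_symm_smul hp2]
    exact hp
  have hpm : ∀ᶠ f in l, f ∈ pairMaps IB IC G W N :=
    mem_inf_of_right (mem_principal_self _)
  -- the second component vanishes on the zero section
  have hvan : ∀ᶠ q : BundleMap IB IC N G W × EB in l ×ˢ 𝓝[range IB] x₀,
      (bundleRep IB IC b c q.1.ext (q.2, (0 : F))).2 = 0 := by
    have h1 : Tendsto (fun q : BundleMap IB IC N G W × EB => (q.1, (q.2, (0 : F))))
        (l ×ˢ 𝓝[range IB] x₀) (l ×ˢ 𝓝[range IB ×ˢ univ] (x₀, 0)) := by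
      refine tendsto_fst.prodMk (Tendsto.comp (g := fun x : EB => (x, (0 : F))) (f := Prod.snd) ?_
        tendsto_snd)
      refine tendsto_nhdsWithin_iff.2 ⟨?_, ?_⟩
      · exact (Continuous.tendsto' (by fun_prop) _ _ rfl).mono_left nhdsWithin_le_nhds
      · filter_upwards [self_mem_nhdsWithin] with q hq using ⟨hq, mem_univ _⟩
    have h2 := h1.eventually ((tendsto_id.prodMap hsymm).eventually hsrc)
    filter_upwards [h2, tendsto_fst.eventually hpm, tendsto_snd.eventually hRx] with q h3 h4 h5
    have h6 : (q.2, (0 : F)) ∈ (bundleChart IB F V b).target := by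
      rw [hR]; exact ⟨h5, mem_univ _⟩
    have h7 : bundleRep IB IC b c q.1.ext (q.2, (0 : ℝ) • (0 : F)) = _ := bundleRep_smul h6 0
    have h8 := bundleChart_symm_smul h6 0
    rw [smul_zero] at h7 h8
    simp only [Prod.map_apply, id_eq] at h3
    rw [h8] at h3
    rw [scale_zero, ext_zeroSection hN h4] at h3
    rw [h7, scale_zero, ext_zeroSection hN h4, bundleChart_zeroSection h3]
  have hj2 : JetConvergentAt l (n + 1) (fun f z => (bundleRep IB IC b c f.ext z).2)
      (range IB ×ˢ univ) (x₀, 0) := by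
    obtain ⟨y, hy⟩ := hj1.exists_tendsto
    exact JetConvergentAt.comp_contDiffWithinAt (T := univ) (y₀ := y) (f := Prod.snd)
      contDiff_snd.contDiffWithinAt (mem_univ _) hj1 (by rwa [nhdsWithin_univ])
  have hq := hj2.hadamardQuotient IB.convex_range IB.uniqueDiffOn hx₀r hvan v₀
  have hj3 : JetConvergentAt l n (fun f (q : ℝ × (EB × F)) =>
      (bundleRep IB IC b c f.ext (q.2.1, q.1 • q.2.2)).1) (univ ×ˢ (range IB ×ˢ univ))
      (0, (x₀, v₀)) := by
    have h1 := (hj1.of_le (Nat.le_succ n)).comp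
      ((hm.of_le (by exact_mod_cast le_top)).contDiffWithinAt.jetConvergentAt hmem l)
      (hmt.comp tendsto_snd)
    obtain ⟨y, hy⟩ := h1.exists_tendsto
    exact JetConvergentAt.comp_contDiffWithinAt (T := univ) (y₀ := y) (f := Prod.fst)
      contDiff_fst.contDiffWithinAt (mem_univ _) h1 (by rwa [nhdsWithin_univ])
  rw [hxv]
  have hmain : JetConvergentAt l n (hadamardRep IB IC b c)
      (univ ×ˢ (range IB ×ˢ univ)) (0, (x₀, v₀)) := by
    refine (hj3.prodMk hq).congr ?_
    filter_upwards [hsrc2, tendsto_fst.eventually hpm, tendsto_snd.eventually htar] with p h1 h2 h3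
    exact hadamardRep_eq hN h2 h3 h1
  refine ⟨hmain, ?_⟩
  have h0s : fiberDeriv f₀ w₀ ∈ (bundleChart IC G W c).source :=
    mem_bundleChart_source_of_proj_eq (w := f₀.ext (zeroSection F V w₀.proj)) rfl hc
  have hchart : Tendsto (fun q : BundleMap IB IC N G W × (ℝ × TotalSpace F V) =>
      (q.1, (q.2.1, bundleChart IB F V b q.2.2))) (l ×ˢ 𝓝 (0, w₀))
      (l ×ˢ 𝓝[univ ×ˢ (range IB ×ˢ univ)] (0, (x₀, v₀))) := by
    refine tendsto_fst.prodMk ((?_ : Tendsto (fun q : ℝ × TotalSpace F V =>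
      (q.1, bundleChart IB F V b q.2)) _ _).comp tendsto_snd)
    refine tendsto_nhdsWithin_iff.2 ⟨?_, ?_⟩
    · rw [nhds_prod_eq, nhds_prod_eq, ← hxv]
      exact tendsto_id.prodMap (continuousAt_extChartAt' hb).tendsto
    · have h1 : ∀ᶠ q : ℝ × TotalSpace F V in 𝓝 (0, w₀), q.2 ∈ (bundleChart IB F V b).source :=
        continuous_snd.continuousAt.preimage_mem_nhds (extChartAt_source_mem_nhds' hb)
      filter_upwards [h1] with q hq
      refine ⟨mem_univ _, ?_⟩
      rw [← range_prod_self]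
      exact extChartAt_target_subset_range _ ((bundleChart IB F V b).map_source hq)
  have hws : ∀ᶠ q : BundleMap IB IC N G W × (ℝ × TotalSpace F V) in l ×ˢ 𝓝 (0, w₀),
      q.2.2 ∈ (bundleChart IB F V b).source :=
    tendsto_snd.eventually (continuous_snd.continuousAt.preimage_mem_nhds
      (extChartAt_source_mem_nhds' hb) : ∀ᶠ q : ℝ × TotalSpace F V in 𝓝 (0, w₀),
        q.2 ∈ (bundleChart IB F V b).source)
  have e : hadamardRep IB IC b c f₀ (0, (x₀, v₀)) = bundleChart IC G W c (fiberDeriv f₀ w₀) := by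
    rw [hadamardRep, ← hxv, (bundleChart IB F V b).left_inv hb, hadamardHomotopy_zero]
  refine tendsto_of_tendsto_bundleChart h0s ?_ ?_
  · rw [← e]
    refine ((hmain.tendsto_of_pure hpure hmem).comp hchart).congr' ?_
    filter_upwards [hws] with q hq
    simp only [Function.comp_apply, hadamardRep, (bundleChart IB F V b).left_inv hq]
  · filter_upwards [hchart.eventually hsrc2, hws] with q hq hq2
    rw [(bundleChart IB F V b).left_inv hq2] at hq
    exact hadamardHomotopy_mem_source hq

end HadamardFamilies

/-! ### The Hadamard homotopy at positive times, and the cut-off -/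

section HadamardNonzero

variable
  {EB : Type*} [NormedAddCommGroup EB] [NormedSpace ℝ EB]
  {HB : Type*} [TopologicalSpace HB] {IB : ModelWithCorners ℝ EB HB}
  {B : Type*} [TopologicalSpace B] [ChartedSpace HB B]
  {F : Type*} [NormedAddCommGroup F] [NormedSpace ℝ F]
  {V : B → Type*} [TopologicalSpace (TotalSpace F V)]
  [∀ b, AddCommGroup (V b)] [∀ b, Module ℝ (V b)] [∀ b, TopologicalSpace (V b)]
  [FiberBundle F V] [VectorBundle ℝ F V]
  {EC : Type*} [NormedAddCommGroup EC] [NormedSpace ℝ EC]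
  {HC : Type*} [TopologicalSpace HC] {IC : ModelWithCorners ℝ EC HC}
  {C : Type*} [TopologicalSpace C] [ChartedSpace HC C]
  {G : Type*} [NormedAddCommGroup G] [NormedSpace ℝ G]
  {W : C → Type*} [TopologicalSpace (TotalSpace G W)]
  [∀ c, AddCommGroup (W c)] [∀ c, Module ℝ (W c)] [∀ c, TopologicalSpace (W c)]
  [FiberBundle G W] [VectorBundle ℝ G W]
  {N : Set (TotalSpace F V)}
  [IsManifold IB ∞ B] [ContMDiffVectorBundle ∞ F V IB]
  [IsManifold IC ∞ C] [ContMDiffVectorBundle ∞ G W IC] [T2Space C]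
  [T2Space B] [CompleteSpace G]

variable (F V) in
theorem continuous_scale (IB : ModelWithCorners ℝ EB HB) [IsManifold IB ∞ B]
    [ContMDiffVectorBundle ∞ F V IB] : Continuous fun q : ℝ × TotalSpace F V => scale q.1 q.2 := by
  refine continuous_iff_continuousAt.2 fun ⟨t, w⟩ => ?_
  have hw := self_mem_bundleChart_source (IB := IB) w
  have hs : ∀ᶠ q : ℝ × TotalSpace F V in 𝓝 (t, w),
      q.2 ∈ (bundleChart IB F V w.proj).source :=
    continuous_snd.continuousAt.preimage_mem_nhds (extChartAt_source_mem_nhds' hw)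
  have hc : Tendsto (fun q : ℝ × TotalSpace F V => bundleChart IB F V w.proj q.2) (𝓝 (t, w))
      (𝓝 (bundleChart IB F V w.proj w)) :=
    (continuousAt_extChartAt' hw).tendsto.comp continuous_snd.continuousAt
  refine tendsto_of_tendsto_bundleChart (scale_mem_bundleChart_source hw) ?_
    (hs.mono fun q hq => scale_mem_bundleChart_source hq)
  rw [bundleChart_scale hw]
  have h1 := ((continuous_fst.tendsto _).comp hc).prodMk_nhds
    ((continuous_fst.tendsto (t, w)).smul ((continuous_snd.tendsto _).comp hc))
  refine h1.congr' (hs.mono fun q hq => ?_)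
  simp only [Function.comp_apply, bundleChart_scale hq]

/-- Joint jet-continuity of `(f, τ, w) ↦ α_f(τ, w)` on `[0, 1] × N`. -/
theorem jetConvergentAt_hadamardRep (hNc : IsCompact N) (hNu : UniqueMDiffOn (IB.prod 𝓘(ℝ, F)) N)
    (hN : N ∈ 𝓝ˢ (range (zeroSection F V))) (hs : IsStarlike N) {r : ℕ∞} {n : ℕ}
    (hn : ((n + 1 : ℕ) : ℕ∞) ≤ r) {f₀ : BundleMap IB IC N G W} (hf₀ : f₀ ∈ pairMaps IB IC G W N)
    {τ₀ : ℝ} (hτ₀ : τ₀ ∈ Icc (0 : ℝ) 1) {w₀ : TotalSpace F V} (hw₀ : w₀ ∈ N) {b : B} {c : C}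
    (hb : w₀ ∈ (bundleChart IB F V b).source)
    (hc : f₀.ext (scale τ₀ w₀) ∈ (bundleChart IC G W c).source) :
    JetConvergentAt (pairNhds IB IC G W N r f₀) n (hadamardRep IB IC b c)
        (Icc 0 1 ×ˢ bundleDomain IB N b) (τ₀, bundleChart IB F V b w₀) ∧
      Tendsto (fun q : BundleMap IB IC N G W × (ℝ × TotalSpace F V) =>
        hadamardHomotopy q.1 q.2.1 q.2.2) (pairNhds IB IC G W N r f₀ ×ˢ 𝓝[Icc 0 1 ×ˢ N] (τ₀, w₀))
        (𝓝 (hadamardHomotopy f₀ τ₀ w₀)) := by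
  have := t2Space_totalSpace (F := F) (V := V)
  rcases eq_or_ne τ₀ 0 with rfl | h0
  · rw [scale_zero] at hc
    obtain ⟨h1, h2⟩ := jetConvergentAt_hadamardRep_zero hNc hNu hN hn hf₀ hb hc
    refine ⟨h1.mono (prod_mono (subset_univ _) ?_), ?_⟩
    · rw [← range_prod_self]
      exact inter_subset_left.trans (extChartAt_target_subset_range _)
    · rw [hadamardHomotopy_zero]
      exact h2.mono_left (prod_mono_right _ nhdsWithin_le_nhds)
  set l := pairNhds IB IC G W N r f₀ with hl
  have hw1 : scale τ₀ w₀ ∈ N := hs _ hw₀ _ hτ₀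
  have hb1 : scale τ₀ w₀ ∈ (bundleChart IB F V b).source := scale_mem_bundleChart_source hb
  obtain ⟨hj, ht⟩ := jetConvergentAt_localRep hNc hNu
    (((Nat.cast_le (α := ℕ∞)).2 n.le_succ).trans hn) f₀ hw1 hb1 hc
  replace hj := hj.mono_filter (l' := l) inf_le_left
  replace ht := ht.mono_left (prod_mono_left (𝓝[N] (scale τ₀ w₀)) (inf_le_left : l ≤ _))
  have hsrc : ∀ᶠ q : BundleMap IB IC N G W × TotalSpace F V in l ×ˢ 𝓝[N] (scale τ₀ w₀),
      q.1.ext q.2 ∈ (bundleChart IC G W c).source := ht.eventually (extChartAt_source_mem_nhds' hc)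
  rw [bundleChart_scale hb] at hj
  obtain ⟨z₀, hz₀⟩ : ∃ z₀, bundleChart IB F V b w₀ = z₀ := ⟨_, rfl⟩
  have hzw : (bundleChart IB F V b).symm z₀ = w₀ := hz₀ ▸ (bundleChart IB F V b).left_inv hb
  have hzD : z₀ ∈ bundleDomain IB N b := hz₀ ▸ mem_chartDomain hw₀ hb
  rw [hz₀] at hj ⊢
  have hm : ContDiff ℝ ∞ (fun q : ℝ × (EB × F) => (q.2.1, q.1 • q.2.2)) := by fun_prop
  have hsm : Tendsto (fun q : ℝ × TotalSpace F V => scale q.1 q.2) (𝓝[Icc 0 1 ×ˢ N] (τ₀, w₀))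
      (𝓝[N] (scale τ₀ w₀)) := by
    refine tendsto_nhdsWithin_iff.2 ⟨?_, ?_⟩
    · exact (continuous_scale F V IB).continuousAt.tendsto.mono_left nhdsWithin_le_nhds
    · filter_upwards [self_mem_nhdsWithin] with q hq using hs _ hq.2 _ hq.1
  have hzm : Tendsto (fun q : ℝ × (EB × F) => (q.1, (bundleChart IB F V b).symm q.2))
      (𝓝[Icc 0 1 ×ˢ bundleDomain IB N b] (τ₀, z₀)) (𝓝[Icc 0 1 ×ˢ N] (τ₀, w₀)) := by
    rw [nhdsWithin_prod_eq, nhdsWithin_prod_eq]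
    have := tendsto_extChartAt_symm_chartDomain (N := N) hb
    rw [hz₀] at this
    exact tendsto_id.prodMap this
  have hsrc1 : ∀ᶠ q : BundleMap IB IC N G W × (ℝ × TotalSpace F V) in
      l ×ˢ 𝓝[Icc 0 1 ×ˢ N] (τ₀, w₀),
      q.1.ext (scale q.2.1 q.2.2) ∈ (bundleChart IC G W c).source :=
    (tendsto_id.prodMap hsm).eventually hsrc
  have hne : ∀ᶠ q : ℝ × TotalSpace F V in 𝓝[Icc 0 1 ×ˢ N] (τ₀, w₀), q.1 ≠ 0 :=
    nhdsWithin_le_nhds (continuous_fst.continuousAt.eventually_ne h0)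
  have hne2 : ∀ᶠ q : ℝ × (EB × F) in 𝓝[Icc 0 1 ×ˢ bundleDomain IB N b] (τ₀, z₀), q.1 ≠ 0 :=
    nhdsWithin_le_nhds (continuous_fst.continuousAt.eventually_ne h0)
  have hmem : (τ₀, z₀) ∈ Icc (0 : ℝ) 1 ×ˢ bundleDomain IB N b := ⟨hτ₀, hzD⟩
  have hmt : Tendsto (fun q : ℝ × (EB × F) => (q.2.1, q.1 • q.2.2))
      (𝓝[Icc 0 1 ×ˢ bundleDomain IB N b] (τ₀, z₀))
      (𝓝[bundleDomain IB N b] (z₀.1, τ₀ • z₀.2)) := by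
    refine tendsto_nhdsWithin_iff.2 ⟨?_, ?_⟩
    · exact (hm.continuous.tendsto' _ _ rfl).mono_left nhdsWithin_le_nhds
    · filter_upwards [self_mem_nhdsWithin] with q hq
      obtain ⟨R, hR, -⟩ := bundleChart_target (IB := IB) (F := F) (V := V) (b := b)
      refine ⟨?_, ?_⟩
      · have := hq.2.1
        change q.2 ∈ (bundleChart IB F V b).target at this
        change _ ∈ (bundleChart IB F V b).target
        rw [hR] at this ⊢
        exact ⟨this.1, mem_univ _⟩
      · change (bundleChart IB F V b).symm (q.2.1, q.1 • q.2.2) ∈ N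
        rw [bundleChart_symm_smul hq.2.1]
        exact hs _ hq.2.2 _ hq.1
  have h1 := hj.comp ((hm.of_le (by exact_mod_cast le_top)).contDiffWithinAt.jetConvergentAt hmem l)
    (hmt.comp tendsto_snd)
  have h2 := ((contDiff_fst (𝕜 := ℝ) (E := ℝ) (F := EB × F)
    (n := n)).contDiffWithinAt.jetConvergentAt hmem l).prodMk h1
  have h3 : JetConvergentAt l n (fun f (q : ℝ × (EB × F)) =>
      ((f.localRep (zeroSection F V b) (zeroSection G W c) (q.2.1, q.1 • q.2.2)).1,
        q.1⁻¹ • (f.localRep (zeroSection F V b) (zeroSection G W c) (q.2.1, q.1 • q.2.2)).2))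
      (Icc 0 1 ×ˢ bundleDomain IB N b) (τ₀, z₀) := by
    obtain ⟨y, hy⟩ := h1.exists_tendsto
    refine JetConvergentAt.comp_contDiffWithinAt (T := univ) (y₀ := (τ₀, y))
      (f := fun p : ℝ × (EC × G) => (p.2.1, p.1⁻¹ • p.2.2)) ?_ (mem_univ _) h2 ?_
    · refine ContDiffAt.contDiffWithinAt ?_
      have : ContDiffAt ℝ n (fun p : ℝ × (EC × G) => p.1⁻¹) (τ₀, y) :=
        contDiffAt_fst.inv h0
      fun_prop
    · rw [nhdsWithin_univ, nhds_prod_eq]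
      refine Tendsto.prodMk ?_ hy
      exact ((continuous_fst.tendsto (τ₀, z₀)).mono_left nhdsWithin_le_nhds).comp tendsto_snd
  have hmain : JetConvergentAt l n (hadamardRep IB IC b c)
      (Icc 0 1 ×ˢ bundleDomain IB N b) (τ₀, z₀) := by
    refine h3.congr ?_
    filter_upwards [(tendsto_id.prodMap hzm : Tendsto _ (l ×ˢ _) (l ×ˢ _)).eventually hsrc1,
      tendsto_snd.eventually hne2,
      tendsto_snd.eventually (self_mem_nhdsWithin : ∀ᶠ q in 𝓝[Icc 0 1 ×ˢ bundleDomain IB N b]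
        (τ₀, z₀), q ∈ Icc 0 1 ×ˢ bundleDomain IB N b)] with q hq1 hq2 hq3
    exact hadamardRep_of_ne hq2 hq3.2.1 hq1
  refine ⟨hmain, ?_⟩
  have hchart : Tendsto (fun q : BundleMap IB IC N G W × (ℝ × TotalSpace F V) =>
      (q.1, (q.2.1, bundleChart IB F V b q.2.2))) (l ×ˢ 𝓝[Icc 0 1 ×ˢ N] (τ₀, w₀))
      (l ×ˢ 𝓝[Icc 0 1 ×ˢ bundleDomain IB N b] (τ₀, z₀)) := by
    rw [nhdsWithin_prod_eq, nhdsWithin_prod_eq]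
    have := tendsto_extChartAt_chartDomain (N := N) hb
    rw [hz₀] at this
    exact tendsto_id.prodMap (tendsto_id.prodMap this)
  have hws : ∀ᶠ q : ℝ × TotalSpace F V in 𝓝[Icc 0 1 ×ˢ N] (τ₀, w₀),
      q.2 ∈ (bundleChart IB F V b).source :=
    nhdsWithin_le_nhds (continuous_snd.continuousAt.preimage_mem_nhds
      (extChartAt_source_mem_nhds' hb))
  refine tendsto_of_tendsto_bundleChart (hadamardHomotopy_mem_source hc) ?_
    (hsrc1.mono fun q hq => hadamardHomotopy_mem_source hq)
  have e : hadamardRep IB IC b c f₀ (τ₀, z₀) =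
      bundleChart IC G W c (hadamardHomotopy f₀ τ₀ w₀) := by rw [hadamardRep, hzw]
  rw [← e]
  refine ((hmain.tendsto_of_pure (pure_le_pairNhds hf₀) hmem).comp hchart).congr' ?_
  filter_upwards [tendsto_snd.eventually hws] with q hq
  simp only [Function.comp_apply, hadamardRep, (bundleChart IB F V b).left_inv hq]

/-- Substitution of a jet-convergent family of scalar functions into `α`. -/
theorem JetConvergentAt.comp_hadamardRep {A : Type*} {l : Filter A}
    {l' : Filter (BundleMap IB IC N G W)} {n : ℕ} {b : B} {c : C} {T : Set ℝ} {S : Set (EB × F)}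
    {τ₀ : ℝ} {z₀ : EB × F} (hα : JetConvergentAt l' n (hadamardRep IB IC b c) (T ×ˢ S) (τ₀, z₀))
    {f : A → BundleMap IB IC N G W} (hf : Tendsto f l l') {τ : A → TotalSpace F V → ℝ}
    (hτ : JetConvergentAt l n (fun a z => τ a ((bundleChart IB F V b).symm z)) S z₀)
    (ht : Tendsto (fun q : A × (EB × F) => τ q.1 ((bundleChart IB F V b).symm q.2))
      (l ×ˢ 𝓝[S] z₀) (𝓝[T] τ₀)) (hz : z₀ ∈ S) :
    JetConvergentAt l n (fun a => bundleRep IB IC b c fun w => hadamardHomotopy (f a) (τ a w) w)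
      S z₀ := by
  have h1 := hτ.prodMk ((contDiff_id (𝕜 := ℝ) (n := n)).contDiffWithinAt.jetConvergentAt hz l)
  have h2 : Tendsto (fun q : A × (EB × F) =>
      (τ q.1 ((bundleChart IB F V b).symm q.2), id q.2)) (l ×ˢ 𝓝[S] z₀) (𝓝[T ×ˢ S] (τ₀, z₀)) := by
    rw [nhdsWithin_prod_eq]
    exact ht.prodMk tendsto_snd
  have h3 : JetConvergentAt l n (fun a => hadamardRep IB IC b c (f a)) (T ×ˢ S) (τ₀, z₀) :=
    hα.comp_param hf
  exact h3.comp (g := fun a z => (τ a ((bundleChart IB F V b).symm z), id z)) h1 h2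

end HadamardNonzero

section Cutoff

variable
  {EB : Type*} [NormedAddCommGroup EB] [NormedSpace ℝ EB]
  {HB : Type*} [TopologicalSpace HB] {IB : ModelWithCorners ℝ EB HB}
  {B : Type*} [TopologicalSpace B] [ChartedSpace HB B]
  {F : Type*} [NormedAddCommGroup F] [NormedSpace ℝ F]
  {V : B → Type*} [TopologicalSpace (TotalSpace F V)]
  [∀ b, NormedAddCommGroup (V b)] [∀ b, InnerProductSpace ℝ (V b)]
  [FiberBundle F V] [VectorBundle ℝ F V] [IsManifold IB ∞ B] [ContMDiffVectorBundle ∞ F V IB]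
  [IsContMDiffRiemannianBundle IB ∞ F V]

variable (IB F V) in
theorem contMDiff_norm_sq : ContMDiff (IB.prod 𝓘(ℝ, F)) 𝓘(ℝ, ℝ) ∞
    fun w : TotalSpace F V => ‖w.2‖ ^ 2 := by
  have h : ContMDiff (IB.prod 𝓘(ℝ, F)) (IB.prod 𝓘(ℝ, F)) ∞
      fun w : TotalSpace F V => (⟨w.proj, w.2⟩ : TotalSpace F V) := contMDiff_id
  have := ContMDiff.inner_bundle h h
  simpa only [real_inner_self_eq_norm_sq] using this

variable (F V) in
theorem continuous_fiberNorm (IB : ModelWithCorners ℝ EB HB) [IsManifold IB ∞ B]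
    [ContMDiffVectorBundle ∞ F V IB] [IsContMDiffRiemannianBundle IB ∞ F V] :
    Continuous fun w : TotalSpace F V => ‖w.2‖ := by
  have := (contMDiff_norm_sq IB F V).continuous.sqrt
  simpa only [Real.sqrt_sq (norm_nonneg _)] using this

theorem norm_scale (t : ℝ) (w : TotalSpace F V) : ‖(scale t w).2‖ = |t| * ‖w.2‖ :=
  norm_smul t w.2

variable {p : ℝ} {μ : ℝ → ℝ}

theorem cutoffScale_mem (hμ : ∀ s, μ s ∈ Icc (0 : ℝ) 1) (δ : ℝ) {t : ℝ} (ht : t ∈ Icc (0 : ℝ) 1)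
    (w : TotalSpace F V) : cutoffScale μ δ t w ∈ Icc (0 : ℝ) 1 := by
  have h := hμ (‖w.2‖ / δ)
  have h1 := mul_nonneg (sub_nonneg.2 ht.2) h.1
  have h2 := mul_le_of_le_one_right (sub_nonneg.2 ht.2) h.2
  exact ⟨by unfold cutoffScale; linarith [ht.1], by unfold cutoffScale; linarith⟩

/-- The function `(δ, t, w) ↦ φ(δ, t, w)` is smooth for `δ > 0`: the norm is smooth off the zero
section, and `μ` vanishes near `0`. -/
theorem contDiffWithinAt_cutoffScale (hp : 0 < p) (hμ : ContDiff ℝ ∞ μ)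
    (hμ0 : ∀ s ∈ Icc 0 p, μ s = 0) {δ₀ : ℝ} (hδ : 0 < δ₀) (t₀ : ℝ) {b : B} {w₀ : TotalSpace F V}
    (hb : w₀ ∈ (bundleChart IB F V b).source) :
    ContDiffWithinAt ℝ ∞ (fun q : (ℝ × ℝ) × (EB × F) =>
      cutoffScale μ q.1.1 q.1.2 ((bundleChart IB F V b).symm q.2)) (univ ×ˢ (range IB ×ˢ univ))
      ((δ₀, t₀), bundleChart IB F V b w₀) := by
  have hn : ContDiffWithinAt ℝ ∞ (fun z => ‖((bundleChart IB F V b).symm z).2‖ ^ 2)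
      (range IB ×ˢ univ) (bundleChart IB F V b w₀) := by
    have h1 := ((contMDiff_norm_sq IB F V).contMDiffOn (s := univ) w₀ (mem_univ _))
    have h2 := contDiffWithinAt_chartRep (N := univ) h1 (x := zeroSection F V b) hb
      (y := (0 : ℝ)) (by rw [extChartAt_source]; exact mem_univ _)
    refine ContDiffWithinAt.mono_of_mem_nhdsWithin h2 ?_
    rw [← nhdsWithin_bundleDomain hb univ_mem]
    exact self_mem_nhdsWithin
  have hsn : ContDiffWithinAt ℝ ∞ (fun q : (ℝ × ℝ) × (EB × F) =>
      ‖((bundleChart IB F V b).symm q.2).2‖ ^ 2) (univ ×ˢ (range IB ×ˢ univ))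
      ((δ₀, t₀), bundleChart IB F V b w₀) :=
    ContDiffWithinAt.comp (t := range IB ×ˢ univ) (f := Prod.snd)
      (g := fun z => ‖((bundleChart IB F V b).symm z).2‖ ^ 2)
      ((δ₀, t₀), bundleChart IB F V b w₀) hn contDiff_snd.contDiffWithinAt fun q hq => hq.2
  have hval : (bundleChart IB F V b).symm (bundleChart IB F V b w₀) = w₀ :=
    (bundleChart IB F V b).left_inv hb
  have hsqrt : ∀ w : TotalSpace F V, ‖w.2‖ = √(‖w.2‖ ^ 2) :=
    fun w => (Real.sqrt_sq (norm_nonneg _)).symm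
  rcases eq_or_ne ‖w₀.2‖ 0 with h0 | h0
  · -- near the zero section the cut-off function vanishes
    have hc : Tendsto (fun q : (ℝ × ℝ) × (EB × F) =>
        ‖((bundleChart IB F V b).symm q.2).2‖ / q.1.1)
        (𝓝[univ ×ˢ (range IB ×ˢ univ)] ((δ₀, t₀), bundleChart IB F V b w₀)) (𝓝 0) := by
      have h1 := (Real.continuous_sqrt.tendsto _).comp hsn.continuousWithinAt.tendsto
      rw [hval, ← hsqrt, h0] at h1
      have h2 : Tendsto (fun q : (ℝ × ℝ) × (EB × F) => q.1.1)
          (𝓝[univ ×ˢ (range IB ×ˢ univ)] ((δ₀, t₀), bundleChart IB F V b w₀)) (𝓝 δ₀) :=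
        (Continuous.tendsto' (by fun_prop) _ _ rfl).mono_left nhdsWithin_le_nhds
      have h3 := h1.div h2 hδ.ne'
      rw [zero_div] at h3
      refine h3.congr fun q => ?_
      simp only [Function.comp_apply, Pi.div_apply, ← hsqrt]
    have hδ' : ∀ᶠ q : (ℝ × ℝ) × (EB × F) in
        𝓝[univ ×ˢ (range IB ×ˢ univ)] ((δ₀, t₀), bundleChart IB F V b w₀), 0 < q.1.1 :=
      nhdsWithin_le_nhds ((continuous_fst.comp continuous_fst).continuousAt.eventually_mem
        (Ioi_mem_nhds hδ))
    have h4 : ContDiffWithinAt ℝ ∞ (fun q : (ℝ × ℝ) × (EB × F) => q.1.2)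
        (univ ×ˢ (range IB ×ˢ univ)) ((δ₀, t₀), bundleChart IB F V b w₀) := by fun_prop
    refine h4.congr_of_eventuallyEq ?_ ?_
    · filter_upwards [hc.eventually (gt_mem_nhds hp), hδ'] with q h5 h6
      simp only [cutoffScale]
      rw [hμ0 _ ⟨by positivity, h5.le⟩, mul_zero, add_zero]
    · simp only [cutoffScale]
      rw [hval, h0, zero_div, hμ0 0 ⟨le_rfl, hp.le⟩, mul_zero, add_zero]
  · have h1 : ContDiffWithinAt ℝ ∞ (fun q : (ℝ × ℝ) × (EB × F) =>
        ‖((bundleChart IB F V b).symm q.2).2‖) (univ ×ˢ (range IB ×ˢ univ))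
        ((δ₀, t₀), bundleChart IB F V b w₀) := by
      have := hsn.sqrt (by rw [hval]; exact pow_ne_zero 2 h0)
      simpa only [← hsqrt] using this
    have h2 : ContDiffWithinAt ℝ ∞ (fun q : (ℝ × ℝ) × (EB × F) =>
        ‖((bundleChart IB F V b).symm q.2).2‖ / q.1.1) (univ ×ˢ (range IB ×ˢ univ))
        ((δ₀, t₀), bundleChart IB F V b w₀) :=
      h1.div (by fun_prop) hδ.ne'
    have h3 := (hμ.contDiffAt (x := ‖((bundleChart IB F V b).symm
      (bundleChart IB F V b w₀)).2‖ / δ₀)).comp_contDiffWithinAt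
      ((δ₀, t₀), bundleChart IB F V b w₀) h2
    simp only [cutoffScale]
    have h4 : ContDiffWithinAt ℝ ∞ (fun q : (ℝ × ℝ) × (EB × F) => q.1.2)
        (univ ×ˢ (range IB ×ˢ univ)) ((δ₀, t₀), bundleChart IB F V b w₀) := by fun_prop
    exact h4.add ((contDiffWithinAt_const.sub h4).mul h3)

end Cutoff

/-! ### Blocks of the Jacobi matrix and linear limits -/

section Domain

/-- A compact star-like neighbourhood of the zero section, with unique derivatives within it. -/
structure IsTubularDomain {EB : Type*} [NormedAddCommGroup EB] [NormedSpace ℝ EB]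
    {HB : Type*} [TopologicalSpace HB] (IB : ModelWithCorners ℝ EB HB)
    {B : Type*} [TopologicalSpace B] [ChartedSpace HB B]
    {F : Type*} [NormedAddCommGroup F] [NormedSpace ℝ F]
    {V : B → Type*} [TopologicalSpace (TotalSpace F V)]
    [∀ b, AddCommGroup (V b)] [∀ b, Module ℝ (V b)] [∀ b, TopologicalSpace (V b)]
    [FiberBundle F V] [VectorBundle ℝ F V] (N : Set (TotalSpace F V)) : Prop where
  isCompact : IsCompact N
  isStarlike : IsStarlike N
  mem_nhdsSet : N ∈ 𝓝ˢ (range (zeroSection F V))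
  uniqueMDiffOn : UniqueMDiffOn (IB.prod 𝓘(ℝ, F)) N

/-- A smooth cut-off function with values in `[0, 1]` that vanishes on `[0, p]`. -/
structure IsCutoff (p : ℝ) (μ : ℝ → ℝ) : Prop where
  pos : 0 < p
  contDiff : ContDiff ℝ ∞ μ
  mem_Icc : ∀ s, μ s ∈ Icc (0 : ℝ) 1
  eq_zero : ∀ s ∈ Icc 0 p, μ s = 0

end Domain

section Blocks

variable
  {EB : Type*} [NormedAddCommGroup EB] [NormedSpace ℝ EB]
  {HB : Type*} [TopologicalSpace HB] {IB : ModelWithCorners ℝ EB HB}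
  {B : Type*} [TopologicalSpace B] [ChartedSpace HB B]
  {F : Type*} [NormedAddCommGroup F] [NormedSpace ℝ F]
  {V : B → Type*} [TopologicalSpace (TotalSpace F V)]
  [∀ b, AddCommGroup (V b)] [∀ b, Module ℝ (V b)] [∀ b, TopologicalSpace (V b)]
  [FiberBundle F V] [VectorBundle ℝ F V]
  {EC : Type*} [NormedAddCommGroup EC] [NormedSpace ℝ EC]
  {HC : Type*} [TopologicalSpace HC] {IC : ModelWithCorners ℝ EC HC}
  {C : Type*} [TopologicalSpace C] [ChartedSpace HC C]
  {G : Type*} [NormedAddCommGroup G] [NormedSpace ℝ G]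
  {W : C → Type*} [TopologicalSpace (TotalSpace G W)]
  [∀ c, AddCommGroup (W c)] [∀ c, Module ℝ (W c)] [∀ c, TopologicalSpace (W c)]
  [FiberBundle G W] [VectorBundle ℝ G W]
  {N : Set (TotalSpace F V)}
  [IsManifold IB ∞ B] [ContMDiffVectorBundle ∞ F V IB]
  [IsManifold IC ∞ C] [ContMDiffVectorBundle ∞ G W IC] [T2Space C]
  [T2Space B] [CompleteSpace G]

theorem hadamardHomotopy_one (f : BundleMap IB IC N G W) (w : TotalSpace F V) :
    hadamardHomotopy f 1 w = f.ext w := by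
  rw [hadamardHomotopy_of_ne f one_ne_zero, scale_one, inv_one, scale_one]

theorem fiberDeriv_scale (f : BundleMap IB IC N G W) (s : ℝ) (w : TotalSpace F V) :
    fiberDeriv f (scale s w) = scale s (fiberDeriv f w) := by
  obtain ⟨b, v⟩ := w
  have h1 : (trivializationAt F V b ⟨b, s • v⟩).2 = s • (trivializationAt F V b ⟨b, v⟩).2 :=
    ((trivializationAt F V b).linear ℝ (FiberBundle.mem_baseSet_trivializationAt' b)).map_smul s v
  have h2 : ∀ (c : C) (u : G), (trivializationAt G W c).symm c (s • u) =
      s • (trivializationAt G W c).symm c u :=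
    fun c u => by
      have := ((trivializationAt G W c).symmₗ ℝ c).map_smul s u
      rwa [Trivialization.coe_symmₗ (hb := FiberBundle.mem_baseSet_trivializationAt' c)] at this
  simp only [fiberDeriv, scale, h1, map_smul, h2]
  rfl

theorem scale_inv_hadamardHomotopy (f : BundleMap IB IC N G W) (σ : ℝ) {τ : ℝ} (hτ : τ ≠ 0)
    (w : TotalSpace F V) :
    scale τ⁻¹ (hadamardHomotopy f σ (scale τ w)) = hadamardHomotopy f (σ * τ) w := by
  by_cases hσ : σ = 0
  · rw [hσ, zero_mul, hadamardHomotopy_zero, hadamardHomotopy_zero, fiberDeriv_scale, scale_scale,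
      inv_mul_cancel₀ hτ, scale_one]
  · rw [hadamardHomotopy_of_ne f hσ, hadamardHomotopy_of_ne f (mul_ne_zero hσ hτ), scale_scale,
      scale_scale, mul_inv, mul_comm τ⁻¹]

theorem hadamardHomotopy_zeroSection (hN : N ∈ 𝓝ˢ (range (zeroSection F V)))
    {f : BundleMap IB IC N G W} (hf : f ∈ pairMaps IB IC G W N) (τ : ℝ) (b : B) :
    hadamardHomotopy f τ (zeroSection F V b) = f.ext (zeroSection F V b) := by
  by_cases hτ : τ = 0
  · rw [hτ, hadamardHomotopy_zero]
    have h := fiberDeriv_scale f 0 (zeroSection F V b)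
    rw [scale_zeroSection, scale_zero, fiberDeriv_proj] at h
    rw [h]
    exact (ext_zeroSection hN hf b).symm
  · rw [hadamardHomotopy_of_ne f hτ, scale_zeroSection, ext_zeroSection hN hf, scale_zeroSection]

/-- The vertical block of the Jacobi matrix can be read off from `T_fib f`. -/
theorem verticalBlock_congr (hN : N ∈ 𝓝ˢ (range (zeroSection F V)))
    {f k : BundleMap IB IC N G W} (hf : f ∈ pairMaps IB IC G W N) (hk : k ∈ pairMaps IB IC G W N)
    (h : fiberDeriv k = fiberDeriv f) (b : B) : verticalBlock k b = verticalBlock f b := by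
  have hp : ∀ b, (k.ext (zeroSection F V b)).proj = (f.ext (zeroSection F V b)).proj := fun b => by
    have := congrArg TotalSpace.proj (congrFun h (zeroSection F V b))
    rwa [fiberDeriv_proj, fiberDeriv_proj] at this
  ext v
  have key : ∀ g : BundleMap IB IC N G W, g ∈ pairMaps IB IC G W N → verticalBlock g b v =
      (bundleChart IC G W (g.ext (zeroSection F V b)).proj
        (fiberDeriv g ((bundleChart IB F V b).symm (extChartAt IB b b, v)))).2 := fun g hg => by
    have hb0 : zeroSection F V b ∈ (bundleChart IB F V b).source :=
      self_mem_bundleChart_source (zeroSection F V b)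
    have hz : (extChartAt IB b b, v) ∈ (bundleChart IB F V b).target := by
      obtain ⟨R, hR, -⟩ := bundleChart_target (IB := IB) (F := F) (V := V) (b := b)
      have := (bundleChart IB F V b).map_source hb0
      rw [hR] at this ⊢
      rw [bundleChart_zeroSection hb0] at this
      exact ⟨this.1, mem_univ _⟩
    have hws := (bundleChart IB F V b).map_target hz
    have hbr := (bundleChart IB F V b).right_inv hz
    have hx := hbr
    rw [bundleChart_apply (mem_bundleChart_source.1 hws).1] at hx
    have hproj : ((bundleChart IB F V b).symm (extChartAt IB b b, v)).proj = b :=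
      (extChartAt IB b).injOn (mem_bundleChart_source.1 hws).2 (mem_extChartAt_source (I := IB) b)
        (congrArg Prod.fst hx)
    rw [fiberDeriv_chart hN hg hws (c := (g.ext (zeroSection F V b)).proj) (by
      rw [hproj]; exact self_mem_bundleChart_source _), hproj, hbr, verticalBlock_eq hN hg]
  rw [key k hk, key f hf, h, hp]

/-- The horizontal block of the Jacobi matrix depends only on the restriction to the zero
section. -/
theorem horizontalBlock_congr (hN : N ∈ 𝓝ˢ (range (zeroSection F V)))
    {f k : BundleMap IB IC N G W} (hf : f ∈ pairMaps IB IC G W N) (hk : k ∈ pairMaps IB IC G W N)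
    (h : ∀ b, k.ext (zeroSection F V b) = f.ext (zeroSection F V b)) (b : B) :
    horizontalBlock k b = horizontalBlock f b := by
  have hb0 : zeroSection F V b ∈ (bundleChart IB F V b).source :=
      self_mem_bundleChart_source (zeroSection F V b)
  have hx : extChartAt IB b b ∈ range IB := extChartAt_target_subset_range b
    (mem_extChartAt_target b)
  have key : ∀ g : BundleMap IB IC N G W, g ∈ pairMaps IB IC G W N → ∀ u,
      horizontalBlock g b u = fderivWithin ℝ (fun x : EB =>
        (bundleRep IB IC b (g.ext (zeroSection F V b)).proj g.ext (x, (0 : F))).1) (range IB)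
        (extChartAt IB b b) u := fun g hg u => by
    have h1 := contDiffWithinAt_bundleRep_zero hN g hb0
      (self_mem_bundleChart_source (IB := IC) (g.ext (zeroSection F V b)))
    have h2 := (h1.differentiableWithinAt (by simp)).hasFDerivWithinAt.fst
    have h3 : HasFDerivWithinAt (fun x : EB => (x, (0 : F)))
      (ContinuousLinearMap.inl ℝ EB F) (range IB) (extChartAt IB b b) :=
      ((ContinuousLinearMap.inl ℝ EB F).hasFDerivAt).hasFDerivWithinAt
    have h4 := h2.comp (extChartAt IB b b) h3
      (fun x hx => (⟨hx, mem_univ _⟩ : (x, (0 : F)) ∈ range IB ×ˢ univ))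
    have h5 := h4.fderivWithin (IB.uniqueDiffOn _ hx)
    rw [horizontalBlock_eq hN hg, h2.fderivWithin
      ((IB.uniqueDiffOn.prod uniqueDiffOn_univ) _ ⟨hx, mem_univ _⟩)]
    exact (DFunLike.congr_fun h5 u).symm
  ext u
  rw [key k hk, key f hf, h]
  congr 1
  have hR : ∀ᶠ x in 𝓝[range IB] (extChartAt IB b b), (x, (0 : F)) ∈
      (bundleChart IB F V b).target := by
    obtain ⟨R, hR, -, hn⟩ := bundleChart_target (IB := IB) (F := F) (V := V) (b := b)
    have := hn _ hb0
    rw [bundleChart_zeroSection hb0] at this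
    filter_upwards [this] with x hx
    rw [hR]; exact ⟨hx, mem_univ _⟩
  have e : ∀ x : EB, (x, (0 : F)) ∈ (bundleChart IB F V b).target →
      (bundleRep IB IC b (f.ext (zeroSection F V b)).proj k.ext (x, (0 : F))).1 =
      (bundleRep IB IC b (f.ext (zeroSection F V b)).proj f.ext (x, (0 : F))).1 := fun x hx => by
    have hz : ∀ g : BundleMap IB IC N G W, bundleRep IB IC b (f.ext (zeroSection F V b)).proj g.ext
        (x, (0 : ℝ) • (0 : F)) = _ := fun g => bundleRep_smul hx 0
    have hf1 := hz f
    have hk1 := hz k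
    rw [smul_zero, scale_zero] at hf1 hk1
    rw [hf1, hk1, h]
  refine Filter.EventuallyEq.fderivWithin_eq (hR.mono e) (e _ ?_)
  have := (bundleChart IB F V b).map_source hb0
  rwa [bundleChart_zeroSection hb0] at this

/-- `τ⁻¹ f(τ w)` tends to `T_fib f (w)` also along variable small scalars. -/
theorem tendsto_hadamardHomotopy_zero (hN : IsTubularDomain IB N) {f : BundleMap IB IC N G W}
    (hf : f ∈ pairMaps IB IC G W N) (w : TotalSpace F V) :
    Tendsto (fun τ => hadamardHomotopy f τ w) (𝓝 0) (𝓝 (fiberDeriv f w)) := by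
  have h := (jetConvergentAt_hadamardRep_zero hN.isCompact hN.uniqueMDiffOn hN.mem_nhdsSet
    (r := ⊤) (n := 0) le_top hf (self_mem_bundleChart_source w)
    (self_mem_bundleChart_source (f.ext (zeroSection F V w.proj)))).2
  have h1 : Tendsto (fun τ : ℝ => (f, (τ, w))) (𝓝 0) (pairNhds IB IC G W N ⊤ f ×ˢ 𝓝 (0, w)) :=
    (tendsto_const_pure.mono_right (pure_le_pairNhds hf)).prodMk
      (Continuous.tendsto' (by fun_prop) _ _ rfl)
  exact h.comp h1

theorem isBundleMorphism_fiberDeriv (hN : IsTubularDomain IB N) {f : BundleMap IB IC N G W}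
    (hf : f ∈ pairMaps IB IC G W N) : IsBundleMorphism IB IC (fiberDeriv f) := by
  refine ⟨fun w => ?_, fun b => (f.ext (zeroSection F V b)).proj, fun b =>
    ((trivializationAt G W (f.ext (zeroSection F V b)).proj).symmₗ ℝ _).comp
      ((verticalBlock f b : F →ₗ[ℝ] G).comp ((trivializationAt F V b).linearMapAt ℝ b)),
    fun b v => ?_⟩
  · have key := fun n : ℕ => jetConvergentAt_hadamardRep_zero hN.isCompact hN.uniqueMDiffOn
      hN.mem_nhdsSet (r := ⊤) (n := n) le_top hf (self_mem_bundleChart_source w)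
      (self_mem_bundleChart_source (f.ext (zeroSection F V w.proj)))
    have hw := self_mem_bundleChart_source (IB := IB) w
    have hzr : bundleChart IB F V w.proj w ∈ range IB ×ˢ (univ : Set F) := by
      rw [← range_prod_self]
      exact extChartAt_target_subset_range _ ((bundleChart IB F V w.proj).map_source hw)
    have hj : ∀ n : ℕ, ContDiffWithinAt ℝ n (bundleRep IB IC w.proj
        (f.ext (zeroSection F V w.proj)).proj (fiberDeriv f)) (range IB ×ˢ univ)
        (bundleChart IB F V w.proj w) := fun n => by
      have h1 := ((key n).1.mono_filter (pure_le_pairNhds hf)).contDiffWithinAt le_rfl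
        ⟨mem_univ _, hzr⟩
      have h2 : ContDiffWithinAt ℝ n (fun z : EB × F => ((0 : ℝ), z)) (range IB ×ˢ univ)
        (bundleChart IB F V w.proj w) := by fun_prop
      refine (ContDiffWithinAt.comp _ h1 h2 (fun z hz => ⟨mem_univ _, hz⟩)).congr
        (fun z _ => ?_) ?_
      all_goals simp only [hadamardRep, Function.comp_apply, hadamardHomotopy_zero, bundleRep,
        chartRep]
    have hc : ContinuousWithinAt (fiberDeriv f) univ w := by
      rw [continuousWithinAt_univ]
      have h1 : Tendsto (fun w' : TotalSpace F V => (f, ((0 : ℝ), w'))) (𝓝 w)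
          (pairNhds IB IC G W N ⊤ f ×ˢ 𝓝 (0, w)) :=
        (tendsto_const_pure.mono_right (pure_le_pairNhds hf)).prodMk
          (Continuous.tendsto' (by fun_prop) _ _ rfl)
      refine ((key 0).2.comp h1).congr fun w' => ?_
      simp only [Function.comp_apply, hadamardHomotopy_zero]
    have := contMDiffWithinAt_of_chartRep (n := ∞) hc hw
      (mem_bundleChart_source_of_proj_eq (w := f.ext (zeroSection F V w.proj))
        (fiberDeriv_proj f w) (self_mem_bundleChart_source _))
      (contDiffWithinAt_infty.2 fun n => (hj n).mono (by
        rw [← range_prod_self]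
        exact inter_subset_left.trans (extChartAt_target_subset_range _)))
    exact contMDiffWithinAt_univ.1 this
  · simp only [fiberDeriv, LinearMap.comp_apply]
    rw [Trivialization.coe_linearMapAt_of_mem _ (FiberBundle.mem_baseSet_trivializationAt' b),
      Trivialization.coe_symmₗ (hb := FiberBundle.mem_baseSet_trivializationAt' _)]
    rfl

end Blocks

/-! ### The linearizing homotopy -/

theorem SmoothMapOn.toFun_injective {E : Type*} [NormedAddCommGroup E] [NormedSpace ℝ E]
    {H : Type*} [TopologicalSpace H] {I : ModelWithCorners ℝ E H}
    {M : Type*} [TopologicalSpace M] [ChartedSpace H M]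
    {E' : Type*} [NormedAddCommGroup E'] [NormedSpace ℝ E']
    {H' : Type*} [TopologicalSpace H'] {J : ModelWithCorners ℝ E' H'}
    {N : Set M} {Y : Type*} [TopologicalSpace Y] [ChartedSpace H' Y] :
    Function.Injective (SmoothMapOn.toFun : SmoothMapOn I J N Y → N → Y) := by
  rintro ⟨f, hf⟩ ⟨g, hg⟩ h
  cases h
  rfl

section Linearizing

variable
  {EB : Type*} [NormedAddCommGroup EB] [NormedSpace ℝ EB]
  {HB : Type*} [TopologicalSpace HB] {IB : ModelWithCorners ℝ EB HB}
  {B : Type*} [TopologicalSpace B] [ChartedSpace HB B]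
  {F : Type*} [NormedAddCommGroup F] [NormedSpace ℝ F]
  {V : B → Type*} [TopologicalSpace (TotalSpace F V)]
  [∀ b, NormedAddCommGroup (V b)] [∀ b, InnerProductSpace ℝ (V b)]
  [FiberBundle F V] [VectorBundle ℝ F V]
  {EC : Type*} [NormedAddCommGroup EC] [NormedSpace ℝ EC]
  {HC : Type*} [TopologicalSpace HC] {IC : ModelWithCorners ℝ EC HC}
  {C : Type*} [TopologicalSpace C] [ChartedSpace HC C]
  {G : Type*} [NormedAddCommGroup G] [NormedSpace ℝ G]
  {W : C → Type*} [TopologicalSpace (TotalSpace G W)]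
  [∀ c, AddCommGroup (W c)] [∀ c, Module ℝ (W c)] [∀ c, TopologicalSpace (W c)]
  [FiberBundle G W] [VectorBundle ℝ G W]
  {N : Set (TotalSpace F V)}
  [IsManifold IB ∞ B] [ContMDiffVectorBundle ∞ F V IB]
  [IsManifold IC ∞ C] [ContMDiffVectorBundle ∞ G W IC] [T2Space C]
  [T2Space B] [CompleteSpace G] [IsContMDiffRiemannianBundle IB ∞ F V]

variable {p : ℝ} {μ : ℝ → ℝ}

variable (F V) in
theorem continuous_cutoffScale (IB : ModelWithCorners ℝ EB HB) [IsManifold IB ∞ B]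
    [ContMDiffVectorBundle ∞ F V IB] [IsContMDiffRiemannianBundle IB ∞ F V]
    (hμ : Continuous μ) {δ₀ t₀ : ℝ} (hδ : δ₀ ≠ 0) (w₀ : TotalSpace F V) :
    Tendsto (fun q : (ℝ × ℝ) × TotalSpace F V => cutoffScale μ q.1.1 q.1.2 q.2)
      (𝓝 (δ₀, t₀) ×ˢ 𝓝 w₀) (𝓝 (cutoffScale μ δ₀ t₀ w₀)) := by
  rw [← nhds_prod_eq]
  have hn : ContinuousAt (fun q : (ℝ × ℝ) × TotalSpace F V => ‖q.2.2‖) ((δ₀, t₀), w₀) :=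
    ((continuous_fiberNorm F V IB).comp continuous_snd).continuousAt
  have h1 : ContinuousAt (fun q : (ℝ × ℝ) × TotalSpace F V => q.1.1) ((δ₀, t₀), w₀) := by fun_prop
  have h2 : ContinuousAt (fun q : (ℝ × ℝ) × TotalSpace F V => q.1.2) ((δ₀, t₀), w₀) := by fun_prop
  have h3 : ContinuousAt (fun q : (ℝ × ℝ) × TotalSpace F V => μ (‖q.2.2‖ / q.1.1)) ((δ₀, t₀), w₀) :=
    hμ.continuousAt.comp (hn.div h1 hδ)
  exact h2.add ((continuousAt_const.sub h2).mul h3)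

/-- Joint jet-continuity of the linearizing homotopy in the map, the width `δ > 0` and the time. -/
theorem jetConvergentAt_linearizing (hN : IsTubularDomain IB N) (hμ : IsCutoff p μ) {A : Type*}
    {l : Filter A} {r : ℕ∞} {n : ℕ} (hn : ((n + 1 : ℕ) : ℕ∞) ≤ r) {f₀ : BundleMap IB IC N G W}
    (hf₀ : f₀ ∈ pairMaps IB IC G W N) {f : A → BundleMap IB IC N G W}
    (hf : Tendsto f l (pairNhds IB IC G W N r f₀)) {δ : A → ℝ} {δ₀ : ℝ} (hδ : Tendsto δ l (𝓝 δ₀))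
    (hδ₀ : 0 < δ₀) {t : A → ℝ} {t₀ : ℝ} (ht : Tendsto t l (𝓝[Icc 0 1] t₀))
    (ht₀ : t₀ ∈ Icc (0 : ℝ) 1) {w₀ : TotalSpace F V} (hw₀ : w₀ ∈ N) {b : B} {c : C}
    (hb : w₀ ∈ (bundleChart IB F V b).source)
    (hc : f₀.ext (scale (cutoffScale μ δ₀ t₀ w₀) w₀) ∈ (bundleChart IC G W c).source) :
    JetConvergentAt l n (fun a => bundleRep IB IC b c fun w =>
        hadamardHomotopy (f a) (cutoffScale μ (δ a) (t a) w) w) (bundleDomain IB N b)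
        (bundleChart IB F V b w₀) ∧
      Tendsto (fun q : A × TotalSpace F V =>
        hadamardHomotopy (f q.1) (cutoffScale μ (δ q.1) (t q.1) q.2) q.2) (l ×ˢ 𝓝[N] w₀)
        (𝓝 (hadamardHomotopy f₀ (cutoffScale μ δ₀ t₀ w₀) w₀)) := by
  obtain ⟨h1, h2⟩ := jetConvergentAt_hadamardRep hN.isCompact hN.uniqueMDiffOn hN.mem_nhdsSet
    hN.isStarlike hn hf₀ (cutoffScale_mem hμ.mem_Icc δ₀ ht₀ w₀) hw₀ hb hc
  have hdt : Tendsto (fun a => (δ a, t a)) l (𝓝 (δ₀, t₀)) :=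
    hδ.prodMk_nhds (tendsto_nhds_of_tendsto_nhdsWithin ht)
  have hcut : Tendsto (fun q : A × TotalSpace F V => cutoffScale μ (δ q.1) (t q.1) q.2)
      (l ×ˢ 𝓝 w₀) (𝓝[Icc 0 1] (cutoffScale μ δ₀ t₀ w₀)) := by
    refine tendsto_nhdsWithin_iff.2 ⟨?_, ?_⟩
    · exact (continuous_cutoffScale F V IB hμ.contDiff.continuous hδ₀.ne' w₀).comp
        (hdt.prodMap tendsto_id)
    · filter_upwards [tendsto_fst.eventually (tendsto_nhdsWithin_iff.1 ht).2] with q hq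
      exact cutoffScale_mem hμ.mem_Icc _ hq _
  have hzD : bundleChart IB F V b w₀ ∈ bundleDomain IB N b := mem_chartDomain hw₀ hb
  have hDr : bundleDomain IB N b ⊆ range IB ×ˢ univ := by
    rw [← range_prod_self]
    exact inter_subset_left.trans (extChartAt_target_subset_range _)
  refine ⟨?_, ?_⟩
  · have h3 : JetConvergentAt l n (fun a z =>
        cutoffScale μ (δ a) (t a) ((bundleChart IB F V b).symm z)) (bundleDomain IB N b)
        (bundleChart IB F V b w₀) :=
      JetConvergentAt.of_uncurry (P := ℝ × ℝ) (SP := univ) (p₀ := (δ₀, t₀))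
        (f := fun q : (ℝ × ℝ) × (EB × F) =>
          cutoffScale μ q.1.1 q.1.2 ((bundleChart IB F V b).symm q.2))
        (((contDiffWithinAt_cutoffScale hμ.pos hμ.contDiff hμ.eq_zero hδ₀ t₀ hb).of_le
          (by exact_mod_cast le_top)).mono (prod_mono_right hDr)) (mem_univ _) hzD
        (by rwa [nhdsWithin_univ])
    refine JetConvergentAt.comp_hadamardRep (τ := fun a => cutoffScale μ (δ a) (t a)) h1 hf h3 ?_
      hzD
    refine hcut.comp (tendsto_id.prodMap ?_)
    have := tendsto_extChartAt_symm_chartDomain (N := N) hb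
    exact this.mono_right nhdsWithin_le_nhds
  · have h4 : Tendsto (fun q : A × TotalSpace F V =>
        (f q.1, (cutoffScale μ (δ q.1) (t q.1) q.2, q.2))) (l ×ˢ 𝓝[N] w₀)
        (pairNhds IB IC G W N r f₀ ×ˢ 𝓝[Icc 0 1 ×ˢ N] (cutoffScale μ δ₀ t₀ w₀, w₀)) := by
      rw [nhdsWithin_prod_eq]
      exact (hf.comp tendsto_fst).prodMk
        ((hcut.mono_left (prod_mono_right _ nhdsWithin_le_nhds)).prodMk tendsto_snd)
    exact h2.comp h4

theorem contMDiffOn_hadamardHomotopy (hN : IsTubularDomain IB N) (hμ : IsCutoff p μ)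
    {f : BundleMap IB IC N G W} (hf : f ∈ pairMaps IB IC G W N) {δ : ℝ} (hδ : 0 < δ) {t : ℝ}
    (ht : t ∈ Icc (0 : ℝ) 1) : ContMDiffOn (IB.prod 𝓘(ℝ, F)) (IC.prod 𝓘(ℝ, G)) ∞
      (fun w => hadamardHomotopy f (cutoffScale μ δ t w) w) N := fun w₀ hw₀ => by
  have hb := self_mem_bundleChart_source (IB := IB) w₀
  have hc := self_mem_bundleChart_source (IB := IC) (f.ext (scale (cutoffScale μ δ t w₀) w₀))
  have key := fun n : ℕ => jetConvergentAt_linearizing (A := Unit) (l := pure ()) (r := ⊤) (n := n)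
    hN hμ le_top hf (f := fun _ => f) (tendsto_const_pure.mono_right (pure_le_pairNhds hf))
    (δ := fun _ => δ) tendsto_const_nhds hδ (t := fun _ => t)
    (tendsto_nhdsWithin_iff.2 ⟨tendsto_const_nhds, Eventually.of_forall fun _ => ht⟩) ht hw₀ hb hc
  have h1 : Tendsto (fun w : TotalSpace F V => ((), w)) (𝓝[N] w₀) (pure () ×ˢ 𝓝[N] w₀) :=
    Tendsto.prodMk tendsto_const_pure tendsto_id
  have h2 : ContinuousWithinAt (fun w => hadamardHomotopy f (cutoffScale μ δ t w) w) N w₀ := by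
    have h2 := (key 0).2.comp h1
    simp only [Function.comp_def] at h2
    exact h2
  have h3 : ∀ n : ℕ, ContDiffWithinAt ℝ n (bundleRep IB IC w₀.proj
      (f.ext (scale (cutoffScale μ δ t w₀) w₀)).proj
      fun w => hadamardHomotopy f (cutoffScale μ δ t w) w) (bundleDomain IB N w₀.proj)
      (bundleChart IB F V w₀.proj w₀) := fun n =>
    (key n).1.contDiffWithinAt (a₀ := ()) le_rfl (mem_chartDomain hw₀ hb)
  have h4 := contDiffWithinAt_infty.2 h3
  have h5 := hadamardHomotopy_mem_source hc
  clear key h1 h3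
  exact contMDiffWithinAt_of_chartRep (n := ∞) (x := zeroSection F V w₀.proj)
    (y := zeroSection G W (f.ext (scale (cutoffScale μ δ t w₀) w₀)).proj) h2 hb h5 h4

/-- The linearizing homotopy at the map `f`, the width `δ` and the time `t`, as a smooth map. -/
noncomputable def linearizedMap (hN : IsTubularDomain IB N) (hμ : IsCutoff p μ)
    (f : BundleMap IB IC N G W) (hf : f ∈ pairMaps IB IC G W N) (δ : ℝ) (hδ : 0 < δ) (t : ℝ)
    (ht : t ∈ Icc (0 : ℝ) 1) : BundleMap IB IC N G W where
  toFun := linearizing μ f δ t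
  smooth' := ⟨fun w => hadamardHomotopy f (cutoffScale μ δ t w) w,
    contMDiffOn_hadamardHomotopy hN hμ hf hδ ht, fun _ => rfl⟩

section LinearizedMap

variable {hN : IsTubularDomain IB N} {hμ : IsCutoff p μ} {f : BundleMap IB IC N G W}
  {hf : f ∈ pairMaps IB IC G W N} {δ : ℝ} {hδ : 0 < δ} {t : ℝ} {ht : t ∈ Icc (0 : ℝ) 1}

theorem linearizedMap_ext {w : TotalSpace F V} (hw : w ∈ N) :
    (linearizedMap hN hμ f hf δ hδ t ht).ext w =
      hadamardHomotopy f (cutoffScale μ δ t w) w :=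
  (linearizedMap hN hμ f hf δ hδ t ht).ext_of_mem hw

theorem linearizedMap_ext_zeroSection (b : B) :
    (linearizedMap hN hμ f hf δ hδ t ht).ext (zeroSection F V b) = f.ext (zeroSection F V b) := by
  rw [linearizedMap_ext (zeroSection_mem hN.mem_nhdsSet b),
    hadamardHomotopy_zeroSection hN.mem_nhdsSet hf]

theorem linearizedMap_mem_pairMaps :
    linearizedMap hN hμ f hf δ hδ t ht ∈ pairMaps IB IC G W N := by
  rintro w ⟨b, hb⟩
  rw [← SmoothMapOn.ext_apply, ← hb, linearizedMap_ext_zeroSection,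
    ext_zeroSection hN.mem_nhdsSet hf]
  exact mem_range_self _

theorem linearizedMap_one {h1 : (1 : ℝ) ∈ Icc (0 : ℝ) 1} :
    linearizedMap hN hμ f hf δ hδ 1 h1 = f := by
  have : (linearizedMap hN hμ f hf δ hδ 1 h1).toFun = f.toFun := by
    funext w
    change hadamardHomotopy f (cutoffScale μ δ 1 _) _ = _
    rw [cutoffScale, sub_self, zero_mul, add_zero, hadamardHomotopy_one]
    exact f.ext_apply w
  exact SmoothMapOn.toFun_injective this

/-- With `φ` the cut-off scale, `τ⁻¹ H(f, t)(τ w) = α_f(φ(τ w) τ, w)`, where `φ(τ w) τ → 0`;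
hence the linearizing homotopy does not change the fibre derivative. -/
theorem fiberDeriv_linearizedMap :
    fiberDeriv (linearizedMap hN hμ f hf δ hδ t ht) = fiberDeriv f := by
  have := t2Space_totalSpace (F := G) (V := W)
  funext w
  refine tendsto_nhds_unique (tendsto_fiberDeriv hN.mem_nhdsSet linearizedMap_mem_pairMaps w) ?_
  have hs : Tendsto (fun τ : ℝ => scale τ w) (𝓝 0) (𝓝 (zeroSection F V w.proj)) := by
    have := ((continuous_scale F V IB).comp (continuous_id.prodMk continuous_const)).tendsto'
      (0 : ℝ) (zeroSection F V w.proj) (scale_zero w)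
    exact this
  have hmem : ∀ᶠ τ in 𝓝[>] (0 : ℝ), scale τ w ∈ N :=
    nhdsWithin_le_nhds (hs.eventually (mem_nhds_zeroSection hN.mem_nhdsSet _))
  have h0 : Tendsto (fun τ : ℝ => cutoffScale μ δ t (scale τ w) * τ) (𝓝[>] 0) (𝓝 0) := by
    refine squeeze_zero_norm' (a := fun τ => |τ|) ?_ ?_
    · refine Eventually.of_forall fun τ => ?_
      have := cutoffScale_mem hμ.mem_Icc δ ht (scale τ w)
      rw [norm_mul, Real.norm_eq_abs, Real.norm_eq_abs, abs_of_nonneg this.1]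
      exact mul_le_of_le_one_left (abs_nonneg _) this.2
    · exact (continuous_abs.tendsto' _ _ abs_zero).mono_left nhdsWithin_le_nhds
  refine ((tendsto_hadamardHomotopy_zero hN hf w).comp h0).congr' ?_
  filter_upwards [hmem, self_mem_nhdsWithin] with τ h1 h2
  rw [linearizedMap_ext h1, scale_inv_hadamardHomotopy _ _ (ne_of_gt h2)]
  rfl

theorem horizontalRank_linearizedMap (b : B) :
    horizontalRank (linearizedMap hN hμ f hf δ hδ t ht) b = horizontalRank f b := by
  rw [horizontalRank, horizontalBlock_congr hN.mem_nhdsSet hf linearizedMap_mem_pairMaps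
    (fun _ => linearizedMap_ext_zeroSection _)]
  rfl

theorem verticalRank_linearizedMap (b : B) :
    verticalRank (linearizedMap hN hμ f hf δ hδ t ht) b = verticalRank f b := by
  rw [verticalRank, verticalBlock_congr hN.mem_nhdsSet hf linearizedMap_mem_pairMaps
    fiberDeriv_linearizedMap]
  rfl

theorem linearizedMap_zero_mem {h0 : (0 : ℝ) ∈ Icc (0 : ℝ) 1} :
    linearizedMap hN hμ f hf δ hδ 0 h0 ∈ linearNearZero IB IC G W N := by
  refine ⟨linearizedMap_mem_pairMaps, fiberDeriv f, isBundleMorphism_fiberDeriv hN hf,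
    {w | ‖w.2‖ < p * δ}, ?_, fun w hw => ?_⟩
  · refine (isOpen_lt (continuous_fiberNorm F V IB) continuous_const).mem_nhdsSet.2 ?_
    rintro _ ⟨b, rfl⟩
    change ‖(0 : V b)‖ < p * δ
    rw [norm_zero]
    exact mul_pos hμ.pos hδ
  · change hadamardHomotopy f (cutoffScale μ δ 0 _) _ = _
    have : μ (‖(w : TotalSpace F V).2‖ / δ) = 0 := hμ.eq_zero _
      ⟨by positivity, ((div_lt_iff₀ hδ).2 hw).le⟩
    rw [cutoffScale, this, mul_zero, add_zero, hadamardHomotopy_zero]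

/-- The linearizing homotopy is stationary near the zero section at maps that are linear there. -/
theorem linearizedMap_mem_linearNearZero (hlin : f ∈ linearNearZero IB IC G W N) :
    linearizedMap hN hμ f hf δ hδ t ht ∈ linearNearZero IB IC G W N := by
  have := t2Space_totalSpace (F := G) (V := W)
  obtain ⟨-, g, hg, U, hU, hUg⟩ := hlin
  refine ⟨linearizedMap_mem_pairMaps, g, hg, {w | ∀ s ∈ Icc (0 : ℝ) 1, scale s w ∈ U}, ?_,
    fun w hw => ?_⟩
  · rw [mem_nhdsSet_iff_forall]
    rintro _ ⟨b, rfl⟩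
    refine isCompact_Icc.eventually_forall_of_forall_eventually fun s _ => ?_
    have h1 : Tendsto (fun q : TotalSpace F V × ℝ => scale q.2 q.1) (𝓝 (zeroSection F V b, s))
        (𝓝 (zeroSection F V b)) :=
      ((continuous_scale F V IB).comp continuous_swap).tendsto' _ _ (scale_zeroSection s b)
    exact h1.eventually (mem_nhdsSet_iff_forall.1 hU _ (mem_range_self b))
  · have hgs : ∀ (s : ℝ) (w : TotalSpace F V), g (scale s w) = scale s (g w) := by
      obtain ⟨φ, L, hL⟩ := hg.2
      intro s w
      have h1 := hL w.proj w.2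
      have h2 := hL w.proj (s • w.2)
      rw [map_smul] at h2
      change g w = _ at h1
      rw [h1]
      exact h2
    have hfw : ∀ s ∈ Icc (0 : ℝ) 1, f.ext (scale s w) = scale s (g w) := fun s hs => by
      rw [f.ext_of_mem (hN.isStarlike _ w.2 s hs), ← hgs]
      exact hUg ⟨_, hN.isStarlike _ w.2 s hs⟩ (hw s hs)
    have hτ := cutoffScale_mem hμ.mem_Icc δ ht (w : TotalSpace F V)
    change hadamardHomotopy f (cutoffScale μ δ t _) _ = _
    by_cases h0 : cutoffScale μ δ t (w : TotalSpace F V) = 0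
    · rw [h0, hadamardHomotopy_zero]
      refine tendsto_nhds_unique (tendsto_fiberDeriv hN.mem_nhdsSet hf w) ?_
      refine tendsto_const_nhds.congr' ?_
      filter_upwards [Ioo_mem_nhdsGT (zero_lt_one' ℝ)] with τ hτ
      rw [hfw τ ⟨hτ.1.le, hτ.2.le⟩, scale_scale, inv_mul_cancel₀ hτ.1.ne', scale_one]
    · rw [hadamardHomotopy_of_ne f h0, hfw _ hτ, scale_scale, inv_mul_cancel₀ h0, scale_one]

end LinearizedMap

end Linearizing

/-! ### Continuity and homotopy equivalence -/

theorem SmoothMapOn.whitney_anti {E : Type*} [NormedAddCommGroup E] [NormedSpace ℝ E]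
    {H : Type*} [TopologicalSpace H] {I : ModelWithCorners ℝ E H}
    {M : Type*} [TopologicalSpace M] [ChartedSpace H M]
    {E' : Type*} [NormedAddCommGroup E'] [NormedSpace ℝ E']
    {H' : Type*} [TopologicalSpace H'] {J : ModelWithCorners ℝ E' H'}
    {N : Set M} {Y : Type*} [TopologicalSpace Y] [ChartedSpace H' Y] {r s : ℕ∞} (h : r ≤ s) :
    (SmoothMapOn.whitney s : TopologicalSpace (SmoothMapOn I J N Y)) ≤ SmoothMapOn.whitney r := by
  refine TopologicalSpace.generateFrom_anti ?_
  rintro _ ⟨f, x, y, K, k, η, h1, h2, h3, h4, h5⟩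
  exact ⟨f, x, y, K, k, η, h1, h2, h3, h4.trans h, h5⟩

section HomotopyEquivalence

variable
  {EB : Type*} [NormedAddCommGroup EB] [NormedSpace ℝ EB]
  {HB : Type*} [TopologicalSpace HB] {IB : ModelWithCorners ℝ EB HB}
  {B : Type*} [TopologicalSpace B] [ChartedSpace HB B]
  {F : Type*} [NormedAddCommGroup F] [NormedSpace ℝ F]
  {V : B → Type*} [TopologicalSpace (TotalSpace F V)]
  [∀ b, NormedAddCommGroup (V b)] [∀ b, InnerProductSpace ℝ (V b)]
  [FiberBundle F V] [VectorBundle ℝ F V]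
  {EC : Type*} [NormedAddCommGroup EC] [NormedSpace ℝ EC]
  {HC : Type*} [TopologicalSpace HC] {IC : ModelWithCorners ℝ EC HC}
  {C : Type*} [TopologicalSpace C] [ChartedSpace HC C]
  {G : Type*} [NormedAddCommGroup G] [NormedSpace ℝ G]
  {W : C → Type*} [TopologicalSpace (TotalSpace G W)]
  [∀ c, AddCommGroup (W c)] [∀ c, Module ℝ (W c)] [∀ c, TopologicalSpace (W c)]
  [FiberBundle G W] [VectorBundle ℝ G W]
  {N : Set (TotalSpace F V)}
  [IsManifold IB ∞ B] [ContMDiffVectorBundle ∞ F V IB]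
  [IsManifold IC ∞ C] [ContMDiffVectorBundle ∞ G W IC] [T2Space C]
  [T2Space B] [CompleteSpace G] [IsContMDiffRiemannianBundle IB ∞ F V]

variable {p : ℝ} {μ : ℝ → ℝ}

/-- The linearizing homotopy of a continuous width is continuous for `W^∞`. -/
theorem continuous_linearizedMap (hN : IsTubularDomain IB N) (hμ : IsCutoff p μ)
    {X : Set (BundleMap IB IC N G W)} (hX : X ⊆ pairMaps IB IC G W N) {δ : X → ℝ}
    (hδ0 : ∀ f, 0 < δ f) (hδ : Continuous[SmoothMapOn.whitneyOn ⊤ X, inferInstance] δ) :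
    @Continuous (X × unitInterval) (BundleMap IB IC N G W)
      (@instTopologicalSpaceProd _ _ (SmoothMapOn.whitneyOn ⊤ X) inferInstance)
      (SmoothMapOn.whitney ⊤)
      fun q => linearizedMap hN hμ q.1 (hX q.1.2) (δ q.1) (hδ0 q.1) q.2 q.2.2 := by
  let : TopologicalSpace (BundleMap IB IC N G W) := SmoothMapOn.whitney ⊤
  let : TopologicalSpace X := SmoothMapOn.whitneyOn ⊤ X
  have := t2Space_totalSpace (F := F) (V := V)
  refine continuous_iff_continuousAt.2 fun a₀ => ?_
  have hf : Tendsto (fun q : X × unitInterval => (q.1 : BundleMap IB IC N G W)) (𝓝 a₀)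
      (pairNhds IB IC G W N ⊤ a₀.1) :=
    tendsto_inf.2 ⟨(continuous_induced_dom.comp continuous_fst).tendsto a₀,
      tendsto_principal.2 (Eventually.of_forall fun q => hX q.1.2)⟩
  have ht : Tendsto (fun q : X × unitInterval => (q.2 : ℝ)) (𝓝 a₀) (𝓝[Icc 0 1] (a₀.2 : ℝ)) :=
    tendsto_nhdsWithin_iff.2 ⟨(continuous_subtype_val.comp continuous_snd).tendsto a₀,
      Eventually.of_forall fun q => q.2.2⟩
  have key := fun (n : ℕ) (w : TotalSpace F V) (hw : w ∈ N) =>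
    jetConvergentAt_linearizing (l := 𝓝 a₀) (r := ⊤) (n := n) hN hμ le_top (hX a₀.1.2) hf
      ((hδ.comp continuous_fst).tendsto a₀) (hδ0 a₀.1) ht a₀.2.2 hw
      (self_mem_bundleChart_source (IB := IB) w)
      (self_mem_bundleChart_source (IB := IC)
        (a₀.1.1.ext (scale (cutoffScale μ (δ a₀.1) a₀.2 w) w)))
  refine tendsto_whitney_of_jetConvergentAt hN.uniqueMDiffOn (pure_le_nhds a₀)
    (fun w hw => ?_) (fun n _ w hw => ?_)
  · rw [linearizedMap_ext hw]
    refine (key 0 w hw).2.congr' ?_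
    filter_upwards [tendsto_snd.eventually (self_mem_nhdsWithin : ∀ᶠ w in 𝓝[N] w, w ∈ N)] with q hq
    exact (linearizedMap_ext hq).symm
  · refine ⟨zeroSection F V w.proj, zeroSection G W
      (a₀.1.1.ext (scale (cutoffScale μ (δ a₀.1) a₀.2 w) w)).proj,
      self_mem_bundleChart_source (IB := IB) w, ?_, (key n w hw).1.congr ?_⟩
    · rw [linearizedMap_ext hw]
      exact hadamardHomotopy_mem_source (self_mem_bundleChart_source _)
    · filter_upwards [tendsto_snd.eventually (self_mem_nhdsWithin : ∀ᶠ z in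
        𝓝[bundleDomain IB N w.proj] (bundleChart IB F V w.proj w), z ∈ bundleDomain IB N w.proj)]
        with q hq
      simp only [SmoothMapOn.localRep, bundleRep, chartRep, Function.comp_apply]
      rw [linearizedMap_ext hq.2]

/-- If the linearizing homotopy of a continuous width preserves a space of maps, then it is a
continuous homotopy, and the inclusion of the maps that are linear near the zero section is a
homotopy equivalence. -/
theorem linearizing_conclusion (hN : IsTubularDomain IB N) (hμ : IsCutoff p μ) {ε : ℝ}
    {X : Set (BundleMap IB IC N G W)} (hX : X ⊆ pairMaps IB IC G W N) (δ : X → Ioo (0 : ℝ) ε)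
    (hδ : Continuous[SmoothMapOn.whitneyOn 3 X, inferInstance] δ)
    (hH : ∀ (f : X) (t : ℝ) (ht : t ∈ Icc (0 : ℝ) 1),
      linearizedMap hN hμ f (hX f.2) (δ f) (δ f).2.1 t ht ∈ X) :
    (∃ δ : X → Ioo (0 : ℝ) ε,
      Continuous[SmoothMapOn.whitneyOn 3 X, inferInstance] δ ∧
      ∃ H : X × unitInterval → X,
        (∀ (f : X) (t : unitInterval) (w : N),
          (H (f, t)).1 w = linearizing μ f.1 (δ f) t w) ∧
        Continuous[@instTopologicalSpaceProd _ _ (SmoothMapOn.whitneyOn ⊤ X) inferInstance,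
          SmoothMapOn.whitneyOn ⊤ X] H) ∧
    IsHomotopyEquivalence
      (SmoothMapOn.whitneyOn ⊤ (X ∩ linearNearZero IB IC G W N)) (SmoothMapOn.whitneyOn ⊤ X)
      (inclusion (inter_subset_left : X ∩ linearNearZero IB IC G W N ⊆ X)) := by
  have hδ' : Continuous[SmoothMapOn.whitneyOn ⊤ X, inferInstance] fun f => (δ f : ℝ) :=
    continuous_le_dom (induced_mono (SmoothMapOn.whitney_anti le_top))
      (@Continuous.comp _ _ _ (SmoothMapOn.whitneyOn 3 X) _ _ _ _ continuous_subtype_val hδ)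
  have hc := continuous_linearizedMap hN hμ hX (fun f => (δ f).2.1) hδ'
  let : TopologicalSpace (BundleMap IB IC N G W) := SmoothMapOn.whitney ⊤
  let : TopologicalSpace X := SmoothMapOn.whitneyOn ⊤ X
  let : TopologicalSpace ↑(X ∩ linearNearZero IB IC G W N) :=
    SmoothMapOn.whitneyOn ⊤ (X ∩ linearNearZero IB IC G W N)
  let H : X × unitInterval → X := fun q =>
    ⟨linearizedMap hN hμ q.1 (hX q.1.2) (δ q.1) (δ q.1).2.1 q.2 q.2.2, hH q.1 q.2 q.2.2⟩
  have hHc : Continuous H := continuous_induced_rng.2 hc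
  refine ⟨⟨δ, hδ, H, fun f t w => rfl, hHc⟩, ?_⟩
  have hval : Continuous (Subtype.val : X → BundleMap IB IC N G W) := continuous_induced_dom
  have hval' : Continuous (Subtype.val : ↑(X ∩ linearNearZero IB IC G W N) →
    BundleMap IB IC N G W) := continuous_induced_dom
  let i : C(↑(X ∩ linearNearZero IB IC G W N), X) :=
    ⟨inclusion inter_subset_left, continuous_induced_rng.2 hval'⟩
  have h0 : ∀ f : X, (H (f, 0)).1 ∈ linearNearZero IB IC G W N := fun f =>
    linearizedMap_zero_mem (hN := hN) (hμ := hμ) (hf := hX f.2) (hδ := (δ f).2.1)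
      (h0 := ⟨le_rfl, zero_le_one⟩)
  have h1 : ∀ (f : ↑(X ∩ linearNearZero IB IC G W N)) (t : unitInterval),
      (H (i f, t)).1 ∈ linearNearZero IB IC G W N := fun f t =>
    linearizedMap_mem_linearNearZero (hN := hN) (hμ := hμ) (hf := hX f.2.1)
      (hδ := (δ (i f)).2.1) (ht := t.2) f.2.2
  have h2 : ∀ f : X, H (f, 1) = f := fun f => Subtype.ext (linearizedMap_one (hN := hN) (hμ := hμ)
    (hf := hX f.2) (hδ := (δ f).2.1) (h1 := ⟨zero_le_one, le_rfl⟩))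
  let r : C(X, ↑(X ∩ linearNearZero IB IC G W N)) :=
    ⟨fun f => ⟨(H (f, 0)).1, (H (f, 0)).2, h0 f⟩, continuous_induced_rng.2
      (hval.comp (hHc.comp (continuous_id.prodMk continuous_const)))⟩
  refine ⟨⟨i, r, ⟨⟨⟨fun q => ⟨(H (i q.2, q.1)).1, (H (i q.2, q.1)).2, h1 q.2 q.1⟩, ?_⟩, ?_, ?_⟩⟩,
    ⟨⟨⟨fun q => H (q.2, q.1), ?_⟩, ?_, ?_⟩⟩⟩, rfl⟩
  · exact continuous_induced_rng.2 (hval.comp (hHc.comp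
      ((i.continuous.comp continuous_snd).prodMk continuous_fst)))
  · intro f; rfl
  · intro f
    have h3 : (H (i f, 1)).1 = f.1 := congrArg Subtype.val (h2 (i f))
    exact Subtype.ext h3
  · exact hHc.comp (continuous_snd.prodMk continuous_fst)
  · intro f; rfl
  · intro f; exact h2 f

end HomotopyEquivalence

/-! ### Immersions and derivatives in block triangular form -/

/-- Injectivity of a derivative of block triangular form, from the injectivity of the two diagonal
blocks. -/
theorem injective_fderivWithin_of_triangular {E F E' F' : Type*}
    [NormedAddCommGroup E] [NormedSpace ℝ E] [NormedAddCommGroup F] [NormedSpace ℝ F]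
    [NormedAddCommGroup E'] [NormedSpace ℝ E'] [NormedAddCommGroup F'] [NormedSpace ℝ F']
    {R : Set E} (hR : UniqueDiffOn ℝ R) {g : E × F → E' × F'} {φ : E × F → E'} {x₀ : E} {v₀ : F}
    (hx : x₀ ∈ R) (hg : DifferentiableWithinAt ℝ g (R ×ˢ univ) (x₀, v₀))
    (hφ : DifferentiableWithinAt ℝ φ (R ×ˢ univ) (x₀, 0))
    (h1 : ∀ᶠ z in 𝓝[R ×ˢ univ] (x₀, v₀), (g z).1 = φ (z.1, 0))
    (hP : ∀ u, fderivWithin ℝ φ (R ×ˢ univ) (x₀, 0) (u, 0) = 0 → u = 0) {S : F →L[ℝ] F'}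
    (h2 : ∀ v, (g (x₀, v)).2 = S v) (hS : Function.Injective S) :
    Function.Injective (fderivWithin ℝ g (R ×ˢ univ) (x₀, v₀)) := by
  have hu : UniqueDiffWithinAt ℝ (R ×ˢ (univ : Set F)) (x₀, v₀) :=
    (hR.prod uniqueDiffOn_univ) _ ⟨hx, mem_univ _⟩
  set D := fderivWithin ℝ g (R ×ˢ univ) (x₀, v₀)
  have hD : HasFDerivWithinAt g D (R ×ˢ univ) (x₀, v₀) := hg.hasFDerivWithinAt
  refine (injective_iff_map_eq_zero D).2 ?_
  rintro ⟨u, v⟩ huv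
  have hD1 : (D (u, v)).1 = fderivWithin ℝ φ (R ×ˢ univ) (x₀, 0) (u, 0) := by
    have h3 : HasFDerivWithinAt (fun z : E × F => (z.1, (0 : F)))
        ((ContinuousLinearMap.inl ℝ E F).comp (ContinuousLinearMap.fst ℝ E F)) (R ×ˢ univ)
        (x₀, v₀) :=
      ((ContinuousLinearMap.inl ℝ E F).comp
        (ContinuousLinearMap.fst ℝ E F)).hasFDerivAt.hasFDerivWithinAt
    have h4 := hφ.hasFDerivWithinAt.comp (x₀, v₀) h3
      (fun z hz => (⟨hz.1, mem_univ _⟩ : (z.1, (0 : F)) ∈ R ×ˢ univ))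
    have h5 := h4.congr_of_eventuallyEq h1 (h1.self_of_nhdsWithin (⟨hx, mem_univ _⟩))
    have h6 := hu.eq hD.fst h5
    exact DFunLike.congr_fun h6 (u, v)
  have hu0 : u = 0 := hP u (by rw [← hD1, huv]; rfl)
  subst hu0
  have hD2 : (D (0, v)).2 = S v := by
    have h3 : HasFDerivWithinAt (fun v : F => (x₀, v)) (ContinuousLinearMap.inr ℝ E F) univ v₀ :=
      (hasFDerivAt_prodMk_right x₀ v₀).hasFDerivWithinAt
    have h4 := hD.snd.comp v₀ h3 (fun v _ => (⟨hx, mem_univ _⟩ : (x₀, v) ∈ R ×ˢ univ))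
    have h5 : HasFDerivWithinAt (fun v : F => (g (x₀, v)).2) S univ v₀ := by
      simp only [h2]
      exact S.hasFDerivWithinAt
    exact DFunLike.congr_fun (uniqueDiffWithinAt_univ.eq h4 h5) v
  rw [huv] at hD2
  have hv0 : v = 0 := hS (by rw [← hD2, map_zero]; rfl)
  rw [hv0]; rfl

theorem injective_of_finrank_le {E F : Type*} [AddCommGroup E] [Module ℝ E] [FiniteDimensional ℝ E]
    [AddCommGroup F] [Module ℝ F] {L : E →ₗ[ℝ] F}
    (h : Module.finrank ℝ E ≤ Module.finrank ℝ (LinearMap.range L)) : Function.Injective L := by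
  have h1 := LinearMap.finrank_range_add_finrank_ker L
  exact LinearMap.ker_eq_bot.1 (Submodule.finrank_eq_zero.1 (by omega))

/-- Injectivity of the tangent map can be tested in arbitrary charts. -/
theorem injective_mfderivWithin_of_chartRep {E : Type*} [NormedAddCommGroup E] [NormedSpace ℝ E]
    {H : Type*} [TopologicalSpace H] {I : ModelWithCorners ℝ E H}
    {M : Type*} [TopologicalSpace M] [ChartedSpace H M] [IsManifold I ∞ M]
    {E' : Type*} [NormedAddCommGroup E'] [NormedSpace ℝ E']
    {H' : Type*} [TopologicalSpace H'] {J : ModelWithCorners ℝ E' H'}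
    {Y : Type*} [TopologicalSpace Y] [ChartedSpace H' Y] [IsManifold J ∞ Y] {N : Set M}
    (hN : UniqueMDiffOn I N) {g : M → Y} {x w : M} {y : Y} (hw : w ∈ N)
    (hg : MDifferentiableWithinAt I J g N w) (hx : w ∈ (extChartAt I x).source)
    (hy : g w ∈ (extChartAt J y).source) (h : Function.Injective
      (fderivWithin ℝ (chartRep I J x y g) (SmoothMapOn.chartDomain I N x) (extChartAt I x w))) :
    Function.Injective (mfderivWithin I J g N w) := by
  have : IsManifold I 1 M := IsManifold.of_le (n := ∞) (by exact_mod_cast le_top)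
  have : IsManifold J 1 Y := IsManifold.of_le (n := ∞) (by exact_mod_cast le_top)
  obtain ⟨z, hz, rfl⟩ : ∃ z ∈ (extChartAt I x).target, (extChartAt I x).symm z = w :=
    ⟨_, (extChartAt I x).map_source hx, (extChartAt I x).left_inv hx⟩
  rw [(extChartAt I x).right_inv hz] at h
  have hD : UniqueDiffWithinAt ℝ (SmoothMapOn.chartDomain I N x) z :=
    hN.uniqueDiffOn_target_inter x _ ⟨hz, hw⟩
  have h1 := (mdifferentiableWithinAt_extChartAt_symm hz).hasMFDerivWithinAt.mono
    (inter_subset_left.trans (extChartAt_target_subset_range x) :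
      SmoothMapOn.chartDomain I N x ⊆ range I)
  have h3 := (mdifferentiableAt_extChartAt (I := J) (x := y)
    (by rwa [extChartAt_source] at hy)).hasMFDerivAt.hasMFDerivWithinAt (s := univ)
  have h4 := h3.comp _ hg.hasMFDerivWithinAt (fun _ _ => mem_univ _)
  have h5 : ∃ D : E →L[ℝ] E',
      HasFDerivWithinAt (chartRep I J x y g) D (SmoothMapOn.chartDomain I N x) z ∧
      ⇑D = ⇑(mfderiv J 𝓘(ℝ, E') (extChartAt J y) (g ((extChartAt I x).symm z))) ∘
        ⇑(mfderivWithin I J g N ((extChartAt I x).symm z)) ∘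
        ⇑(mfderivWithin 𝓘(ℝ, E) I (extChartAt I x).symm (range I) z) :=
    ⟨_, hasMFDerivWithinAt_iff_hasFDerivWithinAt.1 (h4.comp z h1 (fun z hz => hz.2)), rfl⟩
  obtain ⟨D, h6, h7⟩ := h5
  rw [h6.fderivWithin hD, h7] at h
  intro u v huv
  obtain ⟨u', rfl⟩ := (isInvertible_mfderivWithin_extChartAt_symm hz).surjective u
  obtain ⟨v', rfl⟩ := (isInvertible_mfderivWithin_extChartAt_symm hz).surjective v
  exact congrArg _ (h (congrArg (mfderiv J 𝓘(ℝ, E') (extChartAt J y)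
    (g ((extChartAt I x).symm z))) huv))

section Local

variable
  {EB : Type*} [NormedAddCommGroup EB] [NormedSpace ℝ EB]
  {HB : Type*} [TopologicalSpace HB] {IB : ModelWithCorners ℝ EB HB}
  {B : Type*} [TopologicalSpace B] [ChartedSpace HB B]
  {F : Type*} [NormedAddCommGroup F] [NormedSpace ℝ F]
  {V : B → Type*} [TopologicalSpace (TotalSpace F V)]
  [∀ b, NormedAddCommGroup (V b)] [∀ b, InnerProductSpace ℝ (V b)]
  [FiberBundle F V] [VectorBundle ℝ F V]
  {EC : Type*} [NormedAddCommGroup EC] [NormedSpace ℝ EC]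
  {HC : Type*} [TopologicalSpace HC] {IC : ModelWithCorners ℝ EC HC}
  {C : Type*} [TopologicalSpace C] [ChartedSpace HC C]
  {G : Type*} [NormedAddCommGroup G] [NormedSpace ℝ G]
  {W : C → Type*} [TopologicalSpace (TotalSpace G W)]
  [∀ c, AddCommGroup (W c)] [∀ c, Module ℝ (W c)] [∀ c, TopologicalSpace (W c)]
  [FiberBundle G W] [VectorBundle ℝ G W]
  {N : Set (TotalSpace F V)}
  [IsManifold IB ∞ B] [ContMDiffVectorBundle ∞ F V IB]
  [IsManifold IC ∞ C] [ContMDiffVectorBundle ∞ G W IC] [T2Space C]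
  [T2Space B] [CompleteSpace G] [IsContMDiffRiemannianBundle IB ∞ F V]
  [FiniteDimensional ℝ EB] [FiniteDimensional ℝ F]

variable {p : ℝ} {μ : ℝ → ℝ}

theorem injective_verticalBlock {f : BundleMap IB IC N G W}
    (hf : f ∈ bothRanksGE IB IC G W N (Module.finrank ℝ EB) (Module.finrank ℝ F)) (b : B) :
    Function.Injective (verticalBlock f b) := injective_of_finrank_le (hf.2.2 b)

theorem injective_horizontalBlock {f : BundleMap IB IC N G W}
    (hf : f ∈ bothRanksGE IB IC G W N (Module.finrank ℝ EB) (Module.finrank ℝ F)) (b : B) :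
    Function.Injective (horizontalBlock f b) := injective_of_finrank_le (hf.1.2 b)

theorem fiberDeriv_injective (hN : IsTubularDomain IB N) {f : BundleMap IB IC N G W}
    (hf : f ∈ maximalRankEmbeddings IB IC G W N) : Function.Injective (fiberDeriv f) := by
  have hp := hf.1.1.1
  intro w w' h
  have h1 : (f.ext (zeroSection F V w.proj)).proj = (f.ext (zeroSection F V w'.proj)).proj := by
    have := congrArg TotalSpace.proj h
    rwa [fiberDeriv_proj, fiberDeriv_proj] at this
  have h2 : w.proj = w'.proj := by
    have h3 : f.ext (zeroSection F V w.proj) = f.ext (zeroSection F V w'.proj) := by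
      rw [ext_zeroSection hN.mem_nhdsSet hp, h1, ← ext_zeroSection hN.mem_nhdsSet hp]
    rw [f.ext_of_mem (zeroSection_mem hN.mem_nhdsSet _),
      f.ext_of_mem (zeroSection_mem hN.mem_nhdsSet _)] at h3
    have h5 : zeroSection F V w.proj = zeroSection F V w'.proj :=
      congrArg Subtype.val (hf.2.1.injective h3)
    exact (congrArg TotalSpace.proj h5 : (zeroSection F V w.proj).proj = _)
  have hb : w ∈ (bundleChart IB F V w.proj).source := self_mem_bundleChart_source w
  have hb' : w' ∈ (bundleChart IB F V w.proj).source :=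
    mem_bundleChart_source_of_proj_eq h2.symm hb
  have key : ∀ w₁ : TotalSpace F V, w₁.proj = w.proj →
      (bundleChart IC G W (f.ext (zeroSection F V w.proj)).proj (fiberDeriv f w₁)).2 =
        verticalBlock f w.proj (bundleChart IB F V w.proj w₁).2 := fun w₁ h3 => by
    rw [fiberDeriv_chart hN.mem_nhdsSet hp (mem_bundleChart_source_of_proj_eq h3 hb)
      (c := (f.ext (zeroSection F V w.proj)).proj)
      (by rw [h3]; exact self_mem_bundleChart_source _), h3, verticalBlock_eq hN.mem_nhdsSet hp]
  have h4 := injective_verticalBlock hf.1 w.proj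
    ((key w rfl).symm.trans ((by rw [h]) : _ = _) |>.trans (key w' h2.symm))
  refine (bundleChart IB F V w.proj).injOn hb hb' (Prod.ext ?_ h4)
  rw [bundleChart_apply (mem_bundleChart_source.1 hb).1,
    bundleChart_apply (mem_bundleChart_source.1 hb').1, h2]

/-- The fibre derivative of an embedding of maximal ranks is an immersion. -/
theorem injective_fderivWithin_fiberDeriv (hN : IsTubularDomain IB N) {f : BundleMap IB IC N G W}
    (hf : f ∈ bothRanksGE IB IC G W N (Module.finrank ℝ EB) (Module.finrank ℝ F))
    (w : TotalSpace F V) : Function.Injective (fderivWithin ℝ (bundleRep IB IC w.proj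
      (f.ext (zeroSection F V w.proj)).proj (fiberDeriv f)) (range IB ×ˢ univ)
      (bundleChart IB F V w.proj w)) := by
  have hp := hf.1.1
  set b := w.proj with hbdef
  set c := (f.ext (zeroSection F V b)).proj with hc
  have hb : w ∈ (bundleChart IB F V b).source := self_mem_bundleChart_source w
  have hb0 : zeroSection F V b ∈ (bundleChart IB F V b).source :=
    self_mem_bundleChart_source (zeroSection F V b)
  have hcs : f.ext (zeroSection F V b) ∈ (bundleChart IC G W c).source :=
    self_mem_bundleChart_source (f.ext (zeroSection F V b))
  have hx₀ : extChartAt IB b b ∈ range IB := extChartAt_target_subset_range b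
    (mem_extChartAt_target b)
  obtain ⟨v₀, hv₀⟩ : ∃ v₀, bundleChart IB F V b w = (extChartAt IB b b, v₀) := by
    rw [bundleChart_apply (mem_bundleChart_source.1 hb).1]
    exact ⟨_, rfl⟩
  obtain ⟨R, hR, hRr, hRn⟩ := bundleChart_target (IB := IB) (F := F) (V := V) (b := b)
  have hrep : ∀ z ∈ (bundleChart IB F V b).target,
      f.ext (zeroSection F V ((bundleChart IB F V b).symm z).proj) ∈ (bundleChart IC G W c).source →
      bundleRep IB IC b c (fiberDeriv f) z = ((bundleRep IB IC b c f.ext (z.1, (0 : F))).1,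
        fderivWithin ℝ (fun z => (bundleRep IB IC b c f.ext z).2) (range IB ×ˢ univ) (z.1, 0)
          (0, z.2)) := fun z hz hcz => by
    have h1 := hadamardRep_eq (τ := 0) hN.mem_nhdsSet hp hz (by rwa [scale_zero])
    simp only [zero_smul, hadamardQuotient, if_true] at h1
    rw [← h1, hadamardRep, hadamardHomotopy_zero]
    rfl
  rw [hv₀]
  refine injective_fderivWithin_of_triangular IB.uniqueDiffOn
    (φ := fun z => (bundleRep IB IC b c f.ext z).1) (S := verticalBlock f b) hx₀ ?_ ?_ ?_ ?_ ?_
    (injective_verticalBlock hf b)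
  · have h1 := (jetConvergentAt_hadamardRep_zero hN.isCompact hN.uniqueMDiffOn hN.mem_nhdsSet
      (r := ⊤) (n := 1) le_top hp hb hcs).1
    rw [hv₀] at h1
    have h2 := (h1.mono_filter (pure_le_pairNhds hp)).contDiffWithinAt le_rfl
      ⟨mem_univ _, hx₀, mem_univ _⟩
    have h3 : DifferentiableWithinAt ℝ (fun z : EB × F => ((0 : ℝ), z)) (range IB ×ˢ univ)
        (extChartAt IB b b, v₀) := by fun_prop
    refine ((h2.differentiableWithinAt (by simp)).comp _ h3
      (fun z hz => ⟨mem_univ _, hz⟩)).congr (fun z _ => ?_) ?_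
    all_goals simp only [hadamardRep, Function.comp_apply, hadamardHomotopy_zero, bundleRep,
        chartRep]
  · exact ((contDiffWithinAt_bundleRep_zero hN.mem_nhdsSet f hb0 hcs).differentiableWithinAt
      (by simp)).fst
  · have hcont : Tendsto (fun z => f.ext (zeroSection F V ((bundleChart IB F V b).symm z).proj))
        (𝓝[range IB ×ˢ univ] (extChartAt IB b b, v₀)) (𝓝 (f.ext (zeroSection F V b))) := by
      have h1 : Tendsto (bundleChart IB F V b).symm (𝓝 (extChartAt IB b b, v₀)) (𝓝 w) := by
        have := (continuousAt_extChartAt_symm' hb).tendsto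
        rwa [(bundleChart IB F V b).left_inv hb, hv₀] at this
      have h2 : ContinuousAt f.ext (zeroSection F V b) :=
        (f.contMDiffOn_ext.continuousOn _ (zeroSection_mem hN.mem_nhdsSet b)).continuousAt
          (mem_nhds_zeroSection hN.mem_nhdsSet b)
      have h3 : Continuous (fun w : TotalSpace F V => zeroSection F V w.proj) := by
        have := (continuous_scale F V IB).comp (continuous_const.prodMk continuous_id :
          Continuous fun w : TotalSpace F V => ((0 : ℝ), w))
        simpa only [Function.comp_def, scale_zero] using this
      exact h2.tendsto.comp ((h3.tendsto w).comp (h1.mono_left nhdsWithin_le_nhds))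
    have hRx : R ∈ 𝓝[range IB] (extChartAt IB b b) := by have := hRn w hb; rwa [hv₀] at this
    have htar : ∀ᶠ z : EB × F in 𝓝[range IB ×ˢ univ] (extChartAt IB b b, v₀), z.1 ∈ R := by
      rw [nhdsWithin_prod_eq]
      exact tendsto_fst.eventually hRx
    filter_upwards [hcont.eventually (extChartAt_source_mem_nhds' hcs), htar] with z h1 h2
    rw [hrep z (by rw [hR]; exact ⟨h2, mem_univ _⟩) h1]
  · intro u hu
    rw [← horizontalBlock_eq hN.mem_nhdsSet hp] at hu
    exact injective_horizontalBlock hf b (hu.trans (map_zero _).symm)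
  · intro v
    have hz : (extChartAt IB b b, v) ∈ (bundleChart IB F V b).target := by
      have := (bundleChart IB F V b).map_source hb
      rw [hR, hv₀] at this
      rw [hR]; exact ⟨this.1, mem_univ _⟩
    have hws := (bundleChart IB F V b).map_target hz
    have hx := (bundleChart IB F V b).right_inv hz
    rw [bundleChart_apply (mem_bundleChart_source.1 hws).1] at hx
    have hproj : ((bundleChart IB F V b).symm (extChartAt IB b b, v)).proj = b :=
      (extChartAt IB b).injOn (mem_bundleChart_source.1 hws).2 (mem_extChartAt_source (I := IB) b)
        (congrArg Prod.fst hx)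
    rw [hrep _ hz (by rw [hproj]; exact hcs), verticalBlock_eq hN.mem_nhdsSet hp]

end Local

/-! ### Dilated homotopies -/

theorem eventually_ne_of_tendsto {X Y : Type*} [TopologicalSpace Y] [T2Space Y] {L : Filter X}
    {g₁ g₂ : X → Y} {y₁ y₂ : Y} (h₁ : Tendsto g₁ L (𝓝 y₁)) (h₂ : Tendsto g₂ L (𝓝 y₂))
    (h : y₁ ≠ y₂) : ∀ᶠ x in L, g₁ x ≠ g₂ x :=
  (h₁.prodMk_nhds h₂).eventually
    (isClosed_diagonal.isOpen_compl.mem_nhds h : ∀ᶠ p : Y × Y in 𝓝 (y₁, y₂), p.1 ≠ p.2)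

/-- Two families of maps with distinct limits at every point of a compact set eventually have
distinct values on it. -/
theorem eventually_forall_ne_of_isCompact {A X Y : Type*} [TopologicalSpace X] [TopologicalSpace Y]
    [T2Space Y] {K : Set X} (hK : IsCompact K) {l : Filter A} {g₁ g₂ : A → X → Y} {y₁ y₂ : X → Y}
    (h₁ : ∀ x ∈ K, Tendsto (fun q : A × X => g₁ q.1 q.2) (l ×ˢ 𝓝[K] x) (𝓝 (y₁ x)))
    (h₂ : ∀ x ∈ K, Tendsto (fun q : A × X => g₂ q.1 q.2) (l ×ˢ 𝓝[K] x) (𝓝 (y₂ x)))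
    (h : ∀ x ∈ K, y₁ x ≠ y₂ x) : ∀ᶠ a in l, ∀ x ∈ K, g₁ a x ≠ g₂ a x :=
  eventually_forall_mem_of_isCompact hK fun x hx => 
    eventually_ne_of_tendsto (h₁ x hx) (h₂ x hx) (h x hx)

theorem exists_pos_of_eventually_prod {A : Type*} {l : Filter A} {P : A → ℝ → Prop}
    (h : ∀ᶠ a : A × ℝ in l ×ˢ 𝓝[>] 0, P a.1 a.2) :
    ∃ c > 0, ∀ᶠ f in l, ∀ s, 0 < s → s ≤ c → P f s := by
  obtain ⟨pa, hpa, pb, hpb, hP⟩ := eventually_prod_iff.1 h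
  obtain ⟨c, hc, hcb⟩ := mem_nhdsGT_iff_exists_Ioc_subset.1 hpb
  exact ⟨c, hc, hpa.mono fun f hf s h0 h1 => hP hf (hcb ⟨h0, h1⟩)⟩

section Embeddings

variable
  {EB : Type*} [NormedAddCommGroup EB] [NormedSpace ℝ EB]
  {HB : Type*} [TopologicalSpace HB] {IB : ModelWithCorners ℝ EB HB}
  {B : Type*} [TopologicalSpace B] [ChartedSpace HB B]
  {F : Type*} [NormedAddCommGroup F] [NormedSpace ℝ F]
  {V : B → Type*} [TopologicalSpace (TotalSpace F V)]
  [∀ b, NormedAddCommGroup (V b)] [∀ b, InnerProductSpace ℝ (V b)]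
  [FiberBundle F V] [VectorBundle ℝ F V]
  {EC : Type*} [NormedAddCommGroup EC] [NormedSpace ℝ EC]
  {HC : Type*} [TopologicalSpace HC] {IC : ModelWithCorners ℝ EC HC}
  {C : Type*} [TopologicalSpace C] [ChartedSpace HC C]
  {G : Type*} [NormedAddCommGroup G] [NormedSpace ℝ G]
  {W : C → Type*} [TopologicalSpace (TotalSpace G W)]
  [∀ c, AddCommGroup (W c)] [∀ c, Module ℝ (W c)] [∀ c, TopologicalSpace (W c)]
  [FiberBundle G W] [VectorBundle ℝ G W]
  {N : Set (TotalSpace F V)}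
  [IsManifold IB ∞ B] [ContMDiffVectorBundle ∞ F V IB]
  [IsManifold IC ∞ C] [ContMDiffVectorBundle ∞ G W IC] [T2Space C]
  [T2Space B] [CompleteSpace G] [IsContMDiffRiemannianBundle IB ∞ F V]
  [FiniteDimensional ℝ EB] [FiniteDimensional ℝ F]

variable {p : ℝ} {μ : ℝ → ℝ}

theorem isCompact_closedTube (hN : IsTubularDomain IB N) {ε : ℝ} (hε : 0 < ε)
    (hεN : closedTube V ε ⊆ N) (ρ : ℝ) : IsCompact (closedTube V ρ : Set (TotalSpace F V)) := by
  have hn := continuous_fiberNorm F V IB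
  have h1 : IsCompact (closedTube V ε : Set (TotalSpace F V)) :=
    hN.isCompact.of_isClosed_subset (isClosed_le hn continuous_const) hεN
  rcases le_or_gt ρ 0 with hρ | hρ
  · exact h1.of_isClosed_subset (isClosed_le hn continuous_const)
      fun w hw => le_trans hw (hρ.trans hε.le)
  have h2 : (closedTube V ρ : Set (TotalSpace F V)) = scale (ρ / ε) '' closedTube V ε := by
    ext w
    refine ⟨fun hw => ⟨scale (ε / ρ) w, ?_, ?_⟩, ?_⟩
    · change ‖(scale (ε / ρ) w).2‖ ≤ ε
      rw [norm_scale, abs_of_pos (div_pos hε hρ), div_mul_eq_mul_div, div_le_iff₀ hρ]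
      exact mul_le_mul_of_nonneg_left hw hε.le
    · rw [scale_scale, div_mul_div_cancel₀ hε.ne', div_self hρ.ne', scale_one]
    · rintro ⟨w, hw, rfl⟩
      change ‖(scale (ρ / ε) w).2‖ ≤ ρ
      rw [norm_scale, abs_of_pos (div_pos hρ hε), div_mul_eq_mul_div, div_le_iff₀ hε]
      exact mul_le_mul_of_nonneg_left hw hρ.le
  rw [h2]
  exact h1.image ((continuous_scale F V IB).comp (continuous_const.prodMk continuous_id))

theorem tendsto_hadamardHomotopy_fiberDeriv (hN : IsTubularDomain IB N) {r : ℕ∞} (hr : 1 ≤ r)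
    {f₀ : BundleMap IB IC N G W} (hf₀ : f₀ ∈ pairMaps IB IC G W N) (w₀ : TotalSpace F V) :
    Tendsto (fun q : BundleMap IB IC N G W × (ℝ × TotalSpace F V) =>
      hadamardHomotopy q.1 q.2.1 q.2.2) (pairNhds IB IC G W N r f₀ ×ˢ 𝓝 (0, w₀))
      (𝓝 (fiberDeriv f₀ w₀)) :=
  (jetConvergentAt_hadamardRep_zero hN.isCompact hN.uniqueMDiffOn hN.mem_nhdsSet (n := 0)
    (by simpa using hr) hf₀ (self_mem_bundleChart_source w₀)
    (self_mem_bundleChart_source (f₀.ext (zeroSection F V w₀.proj)))).2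

theorem tendsto_hadamardHomotopy (hN : IsTubularDomain IB N) {r : ℕ∞} (hr : 1 ≤ r)
    {f₀ : BundleMap IB IC N G W} (hf₀ : f₀ ∈ pairMaps IB IC G W N) {τ₀ : ℝ}
    (hτ₀ : τ₀ ∈ Icc (0 : ℝ) 1) {w₀ : TotalSpace F V} (hw₀ : w₀ ∈ N) :
    Tendsto (fun q : BundleMap IB IC N G W × (ℝ × TotalSpace F V) =>
      hadamardHomotopy q.1 q.2.1 q.2.2)
      (pairNhds IB IC G W N r f₀ ×ˢ 𝓝[Icc 0 1 ×ˢ N] (τ₀, w₀)) (𝓝 (hadamardHomotopy f₀ τ₀ w₀)) :=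
  (jetConvergentAt_hadamardRep hN.isCompact hN.uniqueMDiffOn hN.mem_nhdsSet hN.isStarlike (n := 0)
    (by simpa using hr) hf₀ hτ₀ hw₀ (self_mem_bundleChart_source w₀)
    (self_mem_bundleChart_source (f₀.ext (scale τ₀ w₀)))).2

/-- The linearizing homotopy of width `s`, blown up by the factor `s⁻¹` in the fibres of the source
and the target. It is defined on all of `E`, and tends to `T_fib f` as `s → 0`. -/
noncomputable def scaledHomotopy (μ : ℝ → ℝ) (f : BundleMap IB IC N G W) (s t : ℝ)
    (w : TotalSpace F V) : TotalSpace G W :=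
  hadamardHomotopy f (s * cutoffScale μ 1 t w) w

theorem linearizedMap_ext_eq_scale {hN : IsTubularDomain IB N} {hμ : IsCutoff p μ}
    {f : BundleMap IB IC N G W} {hf : f ∈ pairMaps IB IC G W N} {δ : ℝ} {hδ : 0 < δ} {t : ℝ}
    {ht : t ∈ Icc (0 : ℝ) 1} {w : TotalSpace F V} (hw : w ∈ N) :
    (linearizedMap hN hμ f hf δ hδ t ht).ext w =
      scale δ (scaledHomotopy μ f δ t (scale δ⁻¹ w)) := by
  have h1 : cutoffScale μ 1 t (scale δ⁻¹ w) = cutoffScale μ δ t w := by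
    rw [cutoffScale, cutoffScale, norm_scale, abs_of_pos (inv_pos.2 hδ), div_one, div_eq_inv_mul]
  have h2 := scale_inv_hadamardHomotopy f (δ * cutoffScale μ δ t w) (inv_ne_zero hδ.ne') w
  rw [inv_inv, mul_right_comm, mul_inv_cancel₀ hδ.ne', one_mul] at h2
  rw [linearizedMap_ext hw, scaledHomotopy, h1, h2]

variable (IB IC) in
/-- Injectivity of the differential of a map between total spaces, expressed in bundle charts. -/
def IsImmersiveAt (g : TotalSpace F V → TotalSpace G W) (w : TotalSpace F V) : Prop :=
  ∃ (b : B) (c : C), w ∈ (bundleChart IB F V b).source ∧ g w ∈ (bundleChart IC G W c).source ∧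
    DifferentiableWithinAt ℝ (bundleRep IB IC b c g) (range IB ×ˢ univ) (bundleChart IB F V b w) ∧
    Function.Injective
      (fderivWithin ℝ (bundleRep IB IC b c g) (range IB ×ˢ univ) (bundleChart IB F V b w))

/-- The rescaled homotopies converge to `T_fib f₀` with their first derivatives. -/
theorem jetConvergentAt_scaledHomotopy (hN : IsTubularDomain IB N) (hμ : IsCutoff p μ) {r : ℕ∞}
    {n : ℕ} (hn : ((n + 1 : ℕ) : ℕ∞) ≤ r) {f₀ : BundleMap IB IC N G W}
    (hf₀ : f₀ ∈ pairMaps IB IC G W N) (t₀ : ℝ) (w₀ : TotalSpace F V) :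
    JetConvergentAt ((pairNhds IB IC G W N r f₀ ×ˢ 𝓝 0) ×ˢ 𝓝[Icc 0 1] t₀) n
        (fun a => bundleRep IB IC w₀.proj (f₀.ext (zeroSection F V w₀.proj)).proj
          (scaledHomotopy μ a.1.1 a.1.2 a.2)) (range IB ×ˢ univ) (bundleChart IB F V w₀.proj w₀) ∧
      Tendsto (fun q : ((BundleMap IB IC N G W × ℝ) × ℝ) × TotalSpace F V =>
        scaledHomotopy μ q.1.1.1 q.1.1.2 q.1.2 q.2)
        (((pairNhds IB IC G W N r f₀ ×ˢ 𝓝 0) ×ˢ 𝓝[Icc 0 1] t₀) ×ˢ 𝓝 w₀)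
        (𝓝 (fiberDeriv f₀ w₀)) := by
  set l := (pairNhds IB IC G W N r f₀ ×ˢ 𝓝 (0 : ℝ)) ×ˢ 𝓝[Icc 0 1] t₀ with hl
  have hb := self_mem_bundleChart_source (IB := IB) w₀
  obtain ⟨h1, h2⟩ := jetConvergentAt_hadamardRep_zero hN.isCompact hN.uniqueMDiffOn hN.mem_nhdsSet
    hn hf₀ hb (self_mem_bundleChart_source (f₀.ext (zeroSection F V w₀.proj)))
  have hf : Tendsto (fun a : (BundleMap IB IC N G W × ℝ) × ℝ => a.1.1) l
      (pairNhds IB IC G W N r f₀) := tendsto_fst.comp tendsto_fst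
  have hs : Tendsto (fun a : (BundleMap IB IC N G W × ℝ) × ℝ => a.1.2) l (𝓝 0) :=
    tendsto_snd.comp tendsto_fst
  have ht : Tendsto (fun a : (BundleMap IB IC N G W × ℝ) × ℝ => a.2) l (𝓝 t₀) :=
    tendsto_nhds_of_tendsto_nhdsWithin tendsto_snd
  have hcut : Tendsto (fun q : ((BundleMap IB IC N G W × ℝ) × ℝ) × TotalSpace F V =>
      q.1.1.2 * cutoffScale μ 1 q.1.2 q.2) (l ×ˢ 𝓝 w₀) (𝓝 0) := by
    have h3 := (continuous_cutoffScale F V IB hμ.contDiff.continuous (t₀ := t₀)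
      (one_ne_zero (α := ℝ)) w₀).comp
      ((tendsto_const_nhds.prodMk_nhds ht : Tendsto (fun a : (BundleMap IB IC N G W × ℝ) × ℝ =>
        ((1 : ℝ), a.2)) l (𝓝 (1, t₀))).prodMap (tendsto_id (x := 𝓝 w₀)))
    have h4 := (hs.comp tendsto_fst).mul h3
    rw [zero_mul] at h4
    exact h4
  have hzr : bundleChart IB F V w₀.proj w₀ ∈ range IB ×ˢ (univ : Set F) := by
    rw [← range_prod_self]
    exact extChartAt_target_subset_range _ ((bundleChart IB F V w₀.proj).map_source hb)
  refine ⟨?_, ?_⟩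
  · have h3 : ContDiffWithinAt ℝ n (fun q : (ℝ × ℝ) × (EB × F) =>
        q.1.1 * cutoffScale μ 1 q.1.2 ((bundleChart IB F V w₀.proj).symm q.2))
        (univ ×ˢ (range IB ×ˢ univ)) ((0, t₀), bundleChart IB F V w₀.proj w₀) := by
      have h4 := (contDiffWithinAt_cutoffScale hμ.pos hμ.contDiff hμ.eq_zero one_pos t₀ hb).of_le
        (m := n) (by exact_mod_cast le_top)
      have h5 : ContDiffWithinAt ℝ n (fun q : (ℝ × ℝ) × (EB × F) => (((1 : ℝ), q.1.2), q.2))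
        (univ ×ˢ (range IB ×ˢ univ)) ((0, t₀), bundleChart IB F V w₀.proj w₀) := by fun_prop
      have h6 : ContDiffWithinAt ℝ n (fun q : (ℝ × ℝ) × (EB × F) => q.1.1)
        (univ ×ˢ (range IB ×ˢ univ)) ((0, t₀), bundleChart IB F V w₀.proj w₀) := by fun_prop
      exact h6.mul (ContDiffWithinAt.comp (t := univ ×ˢ (range IB ×ˢ univ))
        (f := fun q : (ℝ × ℝ) × (EB × F) => (((1 : ℝ), q.1.2), q.2))
        ((0, t₀), bundleChart IB F V w₀.proj w₀) h4 h5
        fun q hq => ⟨mem_univ _, hq.2⟩)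
    have h7 := JetConvergentAt.of_uncurry (l := l) h3 (mem_univ _) hzr
      (c := fun a : (BundleMap IB IC N G W × ℝ) × ℝ => (a.1.2, a.2))
      (by rw [nhdsWithin_univ]; exact hs.prodMk_nhds ht)
    refine JetConvergentAt.comp_hadamardRep
      (τ := fun (a : (BundleMap IB IC N G W × ℝ) × ℝ) w => a.1.2 * cutoffScale μ 1 a.2 w)
      h1 hf h7 ?_ hzr
    rw [nhdsWithin_univ]
    refine hcut.comp (tendsto_id.prodMap ?_)
    have := (continuousAt_extChartAt_symm' hb).tendsto
    rw [(bundleChart IB F V w₀.proj).left_inv hb] at this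
    exact this.mono_left nhdsWithin_le_nhds
  · have h4 : Tendsto (fun q : ((BundleMap IB IC N G W × ℝ) × ℝ) × TotalSpace F V =>
        (q.1.1.1, (q.1.1.2 * cutoffScale μ 1 q.1.2 q.2, q.2))) (l ×ˢ 𝓝 w₀)
        (pairNhds IB IC G W N r f₀ ×ˢ 𝓝 (0, w₀)) := by
      rw [nhds_prod_eq]
      exact (hf.comp tendsto_fst).prodMk (hcut.prodMk tendsto_snd)
    exact h2.comp h4

/-- Near a maximal rank embedding, small rescaled homotopies are locally injective immersions,
uniformly in the parameters. -/
theorem exists_nhds_injOn_scaledHomotopy (hN : IsTubularDomain IB N) (hμ : IsCutoff p μ)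
    {f₀ : BundleMap IB IC N G W} (hf₀ : f₀ ∈ maximalRankEmbeddings IB IC G W N) {t₀ : ℝ}
    (ht₀ : t₀ ∈ Icc (0 : ℝ) 1) (w₀ : TotalSpace F V) :
    ∃ U ∈ 𝓝 w₀, ∀ᶠ a : (BundleMap IB IC N G W × ℝ) × ℝ in
      (pairNhds IB IC G W N 3 f₀ ×ˢ 𝓝 0) ×ˢ 𝓝[Icc 0 1] t₀,
      InjOn (scaledHomotopy μ a.1.1 a.1.2 a.2) U ∧
        ∀ w ∈ U, IsImmersiveAt IB IC (scaledHomotopy μ a.1.1 a.1.2 a.2) w := by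
  have hp := hf₀.1.1.1
  obtain ⟨h1, h2⟩ := jetConvergentAt_scaledHomotopy (r := 3) (n := 1) hN hμ
    (by norm_num) hp t₀ w₀
  have hb := self_mem_bundleChart_source (IB := IB) w₀
  have hc : fiberDeriv f₀ w₀ ∈
      (bundleChart IC G W (f₀.ext (zeroSection F V w₀.proj)).proj).source :=
    mem_bundleChart_source_of_proj_eq (w := f₀.ext (zeroSection F V w₀.proj))
      (fiberDeriv_proj f₀ w₀)
      (self_mem_bundleChart_source _)
  have hzr : bundleChart IB F V w₀.proj w₀ ∈ range IB ×ˢ (univ : Set F) := by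
    rw [← range_prod_self]
    exact extChartAt_target_subset_range _ ((bundleChart IB F V w₀.proj).map_source hb)
  have hpure : pure ((f₀, (0 : ℝ)), t₀) ≤
      (pairNhds IB IC G W N 3 f₀ ×ˢ 𝓝 (0 : ℝ)) ×ˢ 𝓝[Icc 0 1] t₀ := by
    rw [← prod_pure_pure, ← prod_pure_pure]
    exact prod_mono (prod_mono (pure_le_pairNhds hp) (pure_le_nhds _)) (pure_le_nhdsWithin ht₀)
  have h0 : scaledHomotopy μ f₀ 0 t₀ = fiberDeriv f₀ := by
    funext w
    rw [scaledHomotopy, zero_mul, hadamardHomotopy_zero]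
  obtain ⟨u, hu, h3⟩ := h1.exists_injOn (IB.convex_range.prod convex_univ)
    (IB.uniqueDiffOn.prod uniqueDiffOn_univ) hzr hpure
    (by simp only [h0]; exact injective_fderivWithin_fiberDeriv hN hf₀.1 w₀)
  obtain ⟨P, hP, Q, hQ, hPQ⟩ := eventually_prod_iff.1
    (h2.eventually (extChartAt_source_mem_nhds' hc))
  have hu' : ∀ᶠ w in 𝓝 w₀, bundleChart IB F V w₀.proj w ∈ u := by
    have h4 : Tendsto (bundleChart IB F V w₀.proj) (𝓝 w₀)
        (𝓝[range IB ×ˢ univ] (bundleChart IB F V w₀.proj w₀)) := by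
      refine tendsto_nhdsWithin_iff.2 ⟨(continuousAt_extChartAt' hb).tendsto, ?_⟩
      filter_upwards [extChartAt_source_mem_nhds' hb] with w hw
      rw [← range_prod_self]
      exact extChartAt_target_subset_range _ ((bundleChart IB F V w₀.proj).map_source hw)
    exact h4 hu
  refine ⟨_, inter_mem (inter_mem hu' hQ) (extChartAt_source_mem_nhds' hb), ?_⟩
  filter_upwards [h3, hP] with a ha hPa
  have hrep : ∀ w ∈ (bundleChart IB F V w₀.proj).source,
      bundleRep IB IC w₀.proj (f₀.ext (zeroSection F V w₀.proj)).proj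
        (scaledHomotopy μ a.1.1 a.1.2 a.2) (bundleChart IB F V w₀.proj w) =
      bundleChart IC G W (f₀.ext (zeroSection F V w₀.proj)).proj
        (scaledHomotopy μ a.1.1 a.1.2 a.2 w) := fun w hw => by
    simp only [bundleRep, chartRep, Function.comp_apply,
      (bundleChart IB F V w₀.proj).left_inv hw]
  refine ⟨fun w hw w' hw' h => ?_, fun w hw => ⟨_, _, hw.2, hPQ hPa hw.1.2, ha.2 _ hw.1.1⟩⟩
  refine (bundleChart IB F V w₀.proj).injOn hw.2 hw'.2 (ha.1 hw.1.1 hw'.1.1 ?_)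
  rw [hrep w hw.2, hrep w' hw'.2, h]

/-- Near a maximal rank embedding, small rescaled homotopies are injective immersions on compact
sets. -/
theorem eventually_injOn_scaledHomotopy (hN : IsTubularDomain IB N) (hμ : IsCutoff p μ)
    {f₀ : BundleMap IB IC N G W} (hf₀ : f₀ ∈ maximalRankEmbeddings IB IC G W N)
    {K : Set (TotalSpace F V)} (hK : IsCompact K) :
    ∀ᶠ a : BundleMap IB IC N G W × ℝ in pairNhds IB IC G W N 3 f₀ ×ˢ 𝓝 0,
      ∀ t ∈ Icc (0 : ℝ) 1, InjOn (scaledHomotopy μ a.1 a.2 t) K ∧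
        ∀ w ∈ K, IsImmersiveAt IB IC (scaledHomotopy μ a.1 a.2 t) w := by
  have := t2Space_totalSpace (F := G) (V := W)
  have h := eventually_forall_mem_of_isCompact (l := pairNhds IB IC G W N 3 f₀ ×ˢ 𝓝 (0 : ℝ))
    (P := fun a (x : ℝ × (TotalSpace F V × TotalSpace F V)) =>
      (scaledHomotopy μ a.1 a.2 x.1 x.2.1 = scaledHomotopy μ a.1 a.2 x.1 x.2.2 → x.2.1 = x.2.2) ∧
        IsImmersiveAt IB IC (scaledHomotopy μ a.1 a.2 x.1) x.2.1)
    ((isCompact_Icc (a := (0 : ℝ)) (b := 1)).prod (hK.prod hK)) ?_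
  · filter_upwards [h] with a ha t ht
    exact ⟨fun w hw w' hw' => (ha (t, (w, w')) ⟨ht, hw, hw'⟩).1,
      fun w hw => (ha (t, (w, w)) ⟨ht, hw, hw⟩).2⟩
  rintro ⟨t₀, w₀, w₀'⟩ ⟨ht₀, -, -⟩
  have e : 𝓝[Icc (0 : ℝ) 1 ×ˢ K ×ˢ K] (t₀, (w₀, w₀')) ≤
      𝓝[Icc (0 : ℝ) 1] t₀ ×ˢ (𝓝 w₀ ×ˢ 𝓝 w₀') := by
    rw [nhdsWithin_prod_eq, nhdsWithin_prod_eq]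
    exact prod_mono_right _ (prod_mono nhdsWithin_le_nhds nhdsWithin_le_nhds)
  refine Filter.Eventually.filter_mono (prod_mono_right _ e) ?_
  obtain ⟨U, hU, h1⟩ := exists_nhds_injOn_scaledHomotopy hN hμ hf₀ ht₀ w₀
  have m1 : Tendsto (fun q : (BundleMap IB IC N G W × ℝ) ×
      (ℝ × (TotalSpace F V × TotalSpace F V)) =>
      (q.1, q.2.1)) ((pairNhds IB IC G W N 3 f₀ ×ˢ 𝓝 0) ×ˢ (𝓝[Icc (0 : ℝ) 1] t₀ ×ˢ (𝓝 w₀ ×ˢ 𝓝 w₀')))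
      ((pairNhds IB IC G W N 3 f₀ ×ˢ 𝓝 0) ×ˢ 𝓝[Icc (0 : ℝ) 1] t₀) :=
    tendsto_fst.prodMk (tendsto_fst.comp tendsto_snd)
  have m2 : Tendsto (fun q : (BundleMap IB IC N G W × ℝ) ×
      (ℝ × (TotalSpace F V × TotalSpace F V)) =>
      q.2.2.1) ((pairNhds IB IC G W N 3 f₀ ×ˢ 𝓝 0) ×ˢ (𝓝[Icc (0 : ℝ) 1] t₀ ×ˢ (𝓝 w₀ ×ˢ 𝓝 w₀')))
      (𝓝 w₀) := tendsto_fst.comp (tendsto_snd.comp tendsto_snd)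
  have m3 : Tendsto (fun q : (BundleMap IB IC N G W × ℝ) ×
      (ℝ × (TotalSpace F V × TotalSpace F V)) =>
      q.2.2.2) ((pairNhds IB IC G W N 3 f₀ ×ˢ 𝓝 0) ×ˢ (𝓝[Icc (0 : ℝ) 1] t₀ ×ˢ (𝓝 w₀ ×ˢ 𝓝 w₀')))
      (𝓝 w₀') := tendsto_snd.comp (tendsto_snd.comp tendsto_snd)
  rcases eq_or_ne w₀ w₀' with rfl | hne
  · filter_upwards [m1.eventually h1, m2.eventually hU, m3.eventually hU] with q h2 h3 h4
    exact ⟨fun h => h2.1 h3 h4 h, h2.2 _ h3⟩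
  · have h2 := fun w : TotalSpace F V => (jetConvergentAt_scaledHomotopy (r := 3) (n := 0) hN hμ
      (by norm_num) hf₀.1.1.1 t₀ w).2
    have h3 := eventually_ne_of_tendsto ((h2 w₀).comp (m1.prodMk m2)) ((h2 w₀').comp (m1.prodMk m3))
      (fun h => hne (fiberDeriv_injective hN hf₀ h))
    filter_upwards [m1.eventually h1, m2.eventually hU, h3] with q h2 h3 h4
    exact ⟨fun h => absurd h h4, h2.2 _ h3⟩

end Embeddings

/-! ### Locally uniform widths for embeddings -/

section Width

variable
  {EB : Type*} [NormedAddCommGroup EB] [NormedSpace ℝ EB]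
  {HB : Type*} [TopologicalSpace HB] {IB : ModelWithCorners ℝ EB HB}
  {B : Type*} [TopologicalSpace B] [ChartedSpace HB B]
  {F : Type*} [NormedAddCommGroup F] [NormedSpace ℝ F]
  {V : B → Type*} [TopologicalSpace (TotalSpace F V)]
  [∀ b, NormedAddCommGroup (V b)] [∀ b, InnerProductSpace ℝ (V b)]
  [FiberBundle F V] [VectorBundle ℝ F V]
  {EC : Type*} [NormedAddCommGroup EC] [NormedSpace ℝ EC]
  {HC : Type*} [TopologicalSpace HC] {IC : ModelWithCorners ℝ EC HC}
  {C : Type*} [TopologicalSpace C] [ChartedSpace HC C]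
  {G : Type*} [NormedAddCommGroup G] [NormedSpace ℝ G]
  {W : C → Type*} [TopologicalSpace (TotalSpace G W)]
  [∀ c, AddCommGroup (W c)] [∀ c, Module ℝ (W c)] [∀ c, TopologicalSpace (W c)]
  [FiberBundle G W] [VectorBundle ℝ G W]
  {N : Set (TotalSpace F V)}
  [IsManifold IB ∞ B] [ContMDiffVectorBundle ∞ F V IB]
  [IsManifold IC ∞ C] [ContMDiffVectorBundle ∞ G W IC] [T2Space C]
  [T2Space B] [CompleteSpace G] [IsContMDiffRiemannianBundle IB ∞ F V]
  [FiniteDimensional ℝ EB] [FiniteDimensional ℝ F]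

variable {p : ℝ} {μ : ℝ → ℝ}

theorem hadamardHomotopy_mul_scale_inv (f : BundleMap IB IC N G W) (σ : ℝ) {s : ℝ} (hs : s ≠ 0)
    (w : TotalSpace F V) :
    hadamardHomotopy f (s * σ) (scale s⁻¹ w) = scale s⁻¹ (hadamardHomotopy f σ w) := by
  have h := scale_inv_hadamardHomotopy f (s * σ) (inv_ne_zero hs) w
  rw [inv_inv, mul_right_comm, mul_inv_cancel₀ hs, one_mul] at h
  rw [← h, scale_scale, inv_mul_cancel₀ hs, scale_one]

/-- Conjugation by a dilation of the fibres preserves immersions. -/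
theorem injective_mfderivWithin_of_isImmersiveAt (hNu : UniqueMDiffOn (IB.prod 𝓘(ℝ, F)) N)
    {g k : TotalSpace F V → TotalSpace G W} {s : ℝ} (hs : s ≠ 0)
    (hk : ContMDiffOn (IB.prod 𝓘(ℝ, F)) (IC.prod 𝓘(ℝ, G)) ∞ k N)
    (hkg : ∀ w ∈ N, k w = scale s (g (scale s⁻¹ w))) {w : TotalSpace F V} (hw : w ∈ N)
    (hg : IsImmersiveAt IB IC g (scale s⁻¹ w)) :
    Function.Injective (mfderivWithin (IB.prod 𝓘(ℝ, F)) (IC.prod 𝓘(ℝ, G)) k N w) := by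
  obtain ⟨b, c, hb', hc', hd, hinj⟩ := hg
  have hb : w ∈ (bundleChart IB F V b).source :=
    mem_bundleChart_source_of_proj_eq (w := scale s⁻¹ w) rfl hb'
  have hc : k w ∈ (bundleChart IC G W c).source := by
    rw [hkg w hw]; exact scale_mem_bundleChart_source hc'
  refine injective_mfderivWithin_of_chartRep hNu hw ((hk w hw).mdifferentiableWithinAt (by simp))
    hb hc ?_
  let L : EB × F →L[ℝ] EB × F :=
    (ContinuousLinearMap.id ℝ EB).prodMap (s⁻¹ • ContinuousLinearMap.id ℝ F)
  let L' : EC × G →L[ℝ] EC × G :=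
    (ContinuousLinearMap.id ℝ EC).prodMap (s • ContinuousLinearMap.id ℝ G)
  have hL : Function.Injective L := by
    rintro ⟨a₁, a₂⟩ ⟨b₁, b₂⟩ h
    have h1 : a₁ = b₁ := congrArg Prod.fst h
    have h2 : s⁻¹ • a₂ = s⁻¹ • b₂ := congrArg Prod.snd h
    exact Prod.ext h1 (smul_right_injective F (inv_ne_zero hs) h2)
  have hL' : Function.Injective L' := by
    rintro ⟨a₁, a₂⟩ ⟨b₁, b₂⟩ h
    have h1 : a₁ = b₁ := congrArg Prod.fst h
    have h2 : s • a₂ = s • b₂ := congrArg Prod.snd h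
    exact Prod.ext h1 (smul_right_injective G hs h2)
  have hDr : bundleDomain IB N b ⊆ range IB ×ˢ univ := by
    rw [← range_prod_self]
    exact inter_subset_left.trans (extChartAt_target_subset_range _)
  have hzD : bundleChart IB F V b w ∈ bundleDomain IB N b := mem_chartDomain hw hb
  have hLw : L (bundleChart IB F V b w) = bundleChart IB F V b (scale s⁻¹ w) := by
    rw [bundleChart_scale hb]; rfl
  have h1 : HasFDerivWithinAt (fun z => L' (bundleRep IB IC b c g (L z)))
      (L'.comp ((fderivWithin ℝ (bundleRep IB IC b c g) (range IB ×ˢ univ)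
        (bundleChart IB F V b (scale s⁻¹ w))).comp L)) (bundleDomain IB N b)
      (bundleChart IB F V b w) := by
    have h2 := hd.hasFDerivWithinAt
    rw [← hLw] at h2
    rw [← hLw]
    exact L'.hasFDerivAt.comp_hasFDerivWithinAt _ (h2.comp _ L.hasFDerivWithinAt
      fun z hz => (⟨(hDr hz).1, mem_univ _⟩ : L z ∈ range IB ×ˢ univ))
  have hsrc : ∀ᶠ z in 𝓝[bundleDomain IB N b] (bundleChart IB F V b w),
      k ((bundleChart IB F V b).symm z) ∈ (bundleChart IC G W c).source :=
    ((hk w hw).continuousWithinAt.tendsto.comp (tendsto_extChartAt_symm_chartDomain hb)).eventually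
      (extChartAt_source_mem_nhds' hc)
  have e : ∀ z ∈ bundleDomain IB N b,
      k ((bundleChart IB F V b).symm z) ∈ (bundleChart IC G W c).source →
      bundleRep IB IC b c k z = L' (bundleRep IB IC b c g (L z)) := fun z hz hzc => by
    have h3 : (bundleChart IB F V b).symm (L z) = scale s⁻¹ ((bundleChart IB F V b).symm z) :=
      bundleChart_symm_smul hz.1 s⁻¹
    have h4 : g (scale s⁻¹ ((bundleChart IB F V b).symm z)) ∈ (bundleChart IC G W c).source := by
      rw [hkg _ hz.2] at hzc
      exact mem_bundleChart_source_of_proj_eq (w := scale s _) rfl hzc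
    have h5 := bundleChart_scale (t := s) h4
    simp only [bundleRep, chartRep, Function.comp_apply, h3]
    rw [hkg _ hz.2, h5]
    rfl
  have h6 := h1.congr_of_eventuallyEq
    (by filter_upwards [hsrc, self_mem_nhdsWithin] with z h1 h2 using e z h2 h1)
    (e _ hzD (by rwa [(bundleChart IB F V b).left_inv hb]))
  rw [h6.fderivWithin (hNu.uniqueDiffOn_target_inter _ _ hzD)]
  exact hL'.comp (hinj.comp hL)

theorem linearizedMap_ext_of_le {q : ℝ} (hμ1 : ∀ s, q ≤ s → μ s = 1) {hN : IsTubularDomain IB N}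
    {hμ : IsCutoff p μ} {f : BundleMap IB IC N G W} {hf : f ∈ pairMaps IB IC G W N} {δ : ℝ}
    {hδ : 0 < δ} {t : ℝ} {ht : t ∈ Icc (0 : ℝ) 1} {w : TotalSpace F V} (hw : w ∈ N)
    (hwq : q * δ ≤ ‖w.2‖) : (linearizedMap hN hμ f hf δ hδ t ht).ext w = f.ext w := by
  rw [linearizedMap_ext hw, cutoffScale, hμ1 _ ((le_div_iff₀ hδ).2 hwq), mul_one,
    add_sub_cancel, hadamardHomotopy_one]

/-- An injective immersion of a compact set is an embedding. -/
theorem isSmoothEmbedding_of_injOn (hN : IsTubularDomain IB N) {k : BundleMap IB IC N G W}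
    (h1 : InjOn k.ext N) (h2 : ∀ w ∈ N, Function.Injective (k.tangentMapAt w)) :
    k.IsSmoothEmbedding := by
  have := t2Space_totalSpace (F := G) (V := W)
  have : CompactSpace N := isCompact_iff_compactSpace.1 hN.isCompact
  refine ⟨(Continuous.isClosedEmbedding ?_ ?_).isEmbedding, h2⟩
  · have h3 := continuousOn_iff_continuous_domRestrict.1 k.contMDiffOn_ext.continuousOn
    exact h3.congr fun w => k.ext_apply w
  · intro w w' h
    refine Subtype.ext (h1 w.2 w'.2 ?_)
    rw [k.ext_apply, k.ext_apply, h]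

/-- A width that works for all maximal rank embeddings near a given one. On `‖w‖ ≤ 2qδ` the
linearized map is conjugate by the dilation `δ⁻¹` to the rescaled homotopy on a fixed tube, which is
`C¹` close to the injective immersion `T_fib f₀`; on `‖w‖ ≥ qδ` it coincides with `f`. This leaves
a pair of points of norms less than `qδ` and greater than `2qδ`. If the far point is also close to
the zero section, then after dilation by a multiple of its norm both images are close to
those under `T_fib f₀`; otherwise they are close to the images under `f₀` of a point of the zero
section and of a point of a compact set disjoint from it. In both cases injectivity and compactness keep the images apart. -/
theorem exists_width_of_maximalRankEmbedding (hN : IsTubularDomain IB N) (hμ : IsCutoff p μ)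
    {q : ℝ} (hq : 0 < q) (hμ1 : ∀ s, q ≤ s → μ s = 1) {ε : ℝ} (hε : 0 < ε)
    (hεN : closedTube V ε ⊆ N) {f₀ : BundleMap IB IC N G W}
    (hf₀ : f₀ ∈ maximalRankEmbeddings IB IC G W N) :
    ∃ c > 0, ∀ᶠ f in pairNhds IB IC G W N 3 f₀, ∀ (hf : f ∈ maximalRankEmbeddings IB IC G W N)
      (δ : ℝ) (hδ : 0 < δ), δ ≤ c → ∀ (t : ℝ) (ht : t ∈ Icc (0 : ℝ) 1),
      linearizedMap hN hμ f hf.1.1.1 δ hδ t ht ∈ maximalRankEmbeddings IB IC G W N := by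
  have := t2Space_totalSpace (F := G) (V := W)
  have hp₀ := hf₀.1.1.1
  have hnorm := continuous_fiberNorm F V IB
  have hK := isCompact_closedTube hN hε hεN
  set l := pairNhds IB IC G W N 3 f₀ with hl
  -- points near the zero section, at the scale of the width
  obtain ⟨c₁, hc₁, h1⟩ := exists_pos_of_eventually_prod (P := fun f s => ∀ t ∈ Icc (0 : ℝ) 1,
      InjOn (scaledHomotopy μ f s t) (closedTube V (2 * q)) ∧
        ∀ w ∈ closedTube V (2 * q), IsImmersiveAt IB IC (scaledHomotopy μ f s t) w)
    ((eventually_injOn_scaledHomotopy hN hμ hf₀ (hK (2 * q))).filter_mono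
      (prod_mono_right l nhdsWithin_le_nhds))
  -- a point near the zero section and a point far from it, at the scale of the far one
  have h2' : ∀ᶠ a : BundleMap IB IC N G W × ℝ in l ×ˢ 𝓝[>] 0,
      ∀ x ∈ Icc (0 : ℝ) 1 ×ˢ ((closedTube V q : Set (TotalSpace F V)) ×ˢ
        {w : TotalSpace F V | ‖w.2‖ = 2 * q}),
      hadamardHomotopy a.1 (a.2 * x.1) x.2.1 ≠ hadamardHomotopy a.1 a.2 x.2.2 := by
    have hS : IsCompact {w : TotalSpace F V | ‖w.2‖ = 2 * q} :=
      (hK (2 * q)).of_isClosed_subset (isClosed_eq hnorm continuous_const) fun w hw => hw.le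
    refine eventually_forall_ne_of_isCompact (isCompact_Icc.prod ((hK q).prod hS))
      (g₁ := fun (a : BundleMap IB IC N G W × ℝ)
        (x : ℝ × (TotalSpace F V × TotalSpace F V)) => hadamardHomotopy a.1 (a.2 * x.1) x.2.1)
      (g₂ := fun a x => hadamardHomotopy a.1 a.2 x.2.2)
      (y₁ := fun x => fiberDeriv f₀ x.2.1) (y₂ := fun x => fiberDeriv f₀ x.2.2)
      (fun x _ => ?_) (fun x _ => ?_) (fun x hx h => ?_)
    · refine (tendsto_hadamardHomotopy_fiberDeriv hN (r := 3) (by norm_num) hp₀ x.2.1).comp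
        (g := fun q : BundleMap IB IC N G W × (ℝ × TotalSpace F V) =>
          hadamardHomotopy q.1 q.2.1 q.2.2)
        (f := fun q : (BundleMap IB IC N G W × ℝ) × (ℝ × (TotalSpace F V × TotalSpace F V)) =>
          (q.1.1, (q.1.2 * q.2.1, q.2.2.1))) ?_
      refine (tendsto_fst.comp tendsto_fst).prodMk (Tendsto.prodMk_nhds ?_ ?_)
      · have h3 : Tendsto (fun q : (BundleMap IB IC N G W × ℝ) ×
            (ℝ × (TotalSpace F V × TotalSpace F V)) => q.1.2) ((l ×ˢ 𝓝[>] 0) ×ˢ 𝓝 x) (𝓝 0) :=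
          tendsto_nhds_of_tendsto_nhdsWithin (tendsto_snd.comp tendsto_fst)
        have h4 := h3.mul ((continuous_fst.tendsto x).comp tendsto_snd)
        rw [zero_mul] at h4
        exact h4.mono_left (prod_mono_right _ nhdsWithin_le_nhds)
      · exact (((continuous_fst.comp continuous_snd).tendsto x).comp tendsto_snd).mono_left
          (prod_mono_right _ nhdsWithin_le_nhds)
    · refine (tendsto_hadamardHomotopy_fiberDeriv hN (r := 3) (by norm_num) hp₀ x.2.2).comp
        (g := fun q : BundleMap IB IC N G W × (ℝ × TotalSpace F V) =>
          hadamardHomotopy q.1 q.2.1 q.2.2)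
        (f := fun q : (BundleMap IB IC N G W × ℝ) × (ℝ × (TotalSpace F V × TotalSpace F V)) =>
          (q.1.1, (q.1.2, q.2.2.2))) ?_
      refine (tendsto_fst.comp tendsto_fst).prodMk (Tendsto.prodMk_nhds
        (tendsto_nhds_of_tendsto_nhdsWithin (tendsto_snd.comp tendsto_fst)) ?_)
      exact (((continuous_snd.comp continuous_snd).tendsto x).comp tendsto_snd).mono_left
        (prod_mono_right _ nhdsWithin_le_nhds)
    · have h3 : ‖x.2.1.2‖ ≤ q := hx.2.1
      have h4 : ‖x.2.2.2‖ = 2 * q := hx.2.2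
      rw [fiberDeriv_injective hN hf₀ h, h4] at h3
      linarith
  obtain ⟨c₂, hc₂, h2⟩ := exists_pos_of_eventually_prod (P := fun f s =>
    ∀ x ∈ Icc (0 : ℝ) 1 ×ˢ ((closedTube V q : Set (TotalSpace F V)) ×ˢ
        {w : TotalSpace F V | ‖w.2‖ = 2 * q}),
      hadamardHomotopy f (s * x.1) x.2.1 ≠ hadamardHomotopy f s x.2.2) h2'
  -- a point near the zero section and a point at a definite distance from it
  have h3' : ∀ᶠ a : BundleMap IB IC N G W × ℝ in l ×ˢ 𝓝[>] 0,
      ∀ x ∈ Icc (0 : ℝ) 1 ×ˢ ((closedTube V q : Set (TotalSpace F V)) ×ˢ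
        (N ∩ {w : TotalSpace F V | 2 * q * c₂ ≤ ‖w.2‖})),
      hadamardHomotopy a.1 x.1 (scale a.2 x.2.1) ≠ a.1.ext x.2.2 := by
    have hS : IsCompact (N ∩ {w : TotalSpace F V | 2 * q * c₂ ≤ ‖w.2‖}) :=
      hN.isCompact.inter_right (isClosed_le continuous_const hnorm)
    refine eventually_forall_ne_of_isCompact (isCompact_Icc.prod ((hK q).prod hS))
      (g₁ := fun (a : BundleMap IB IC N G W × ℝ)
        (x : ℝ × (TotalSpace F V × TotalSpace F V)) => hadamardHomotopy a.1 x.1 (scale a.2 x.2.1))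
      (g₂ := fun a x => a.1.ext x.2.2)
      (y₁ := fun x => f₀.ext (zeroSection F V x.2.1.proj)) (y₂ := fun x => f₀.ext x.2.2)
      (fun x hx => ?_) (fun x hx => ?_) (fun x hx h => ?_)
    · have h3 := tendsto_hadamardHomotopy hN (r := 3) (by norm_num) hp₀ hx.1
        (zeroSection_mem hN.mem_nhdsSet x.2.1.proj)
      rw [hadamardHomotopy_zeroSection hN.mem_nhdsSet hp₀, nhdsWithin_prod_eq,
        nhdsWithin_eq_nhds.2 (mem_nhds_zeroSection hN.mem_nhdsSet _)] at h3
      refine h3.comp (g := fun q : BundleMap IB IC N G W × (ℝ × TotalSpace F V) =>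
          hadamardHomotopy q.1 q.2.1 q.2.2)
        (f := fun q : (BundleMap IB IC N G W × ℝ) × (ℝ × (TotalSpace F V × TotalSpace F V)) =>
          (q.1.1, (q.2.1, scale q.1.2 q.2.2.1))) ?_
      rw [nhdsWithin_prod_eq, nhdsWithin_prod_eq]
      refine (tendsto_fst.comp tendsto_fst).prodMk ((tendsto_fst.comp tendsto_snd).prodMk ?_)
      have h4 : Tendsto (fun q : ℝ × TotalSpace F V => scale q.1 q.2) (𝓝 0 ×ˢ 𝓝 x.2.1)
          (𝓝 (zeroSection F V x.2.1.proj)) := by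
        rw [← nhds_prod_eq]
        exact (continuous_scale F V IB).tendsto' _ _ (scale_zero _)
      refine h4.comp (Tendsto.prodMk (tendsto_nhds_of_tendsto_nhdsWithin
        (tendsto_snd.comp tendsto_fst)) ?_)
      exact tendsto_nhds_of_tendsto_nhdsWithin (tendsto_fst.comp (tendsto_snd.comp tendsto_snd))
    · have h3 := tendsto_hadamardHomotopy hN (r := 3) (by norm_num) hp₀
        (⟨zero_le_one, le_rfl⟩ : (1 : ℝ) ∈ Icc (0 : ℝ) 1) hx.2.2.1
      simp only [hadamardHomotopy_one] at h3
      rw [nhdsWithin_prod_eq] at h3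
      have h4 := h3.comp (g := fun q : BundleMap IB IC N G W × (ℝ × TotalSpace F V) =>
          hadamardHomotopy q.1 q.2.1 q.2.2)
        (f := fun q : (BundleMap IB IC N G W × ℝ) × (ℝ × (TotalSpace F V × TotalSpace F V)) =>
          (q.1.1, ((1 : ℝ), q.2.2.2))) (x := (l ×ˢ 𝓝[>] 0) ×ˢ 𝓝[Icc (0 : ℝ) 1 ×ˢ
            ((closedTube V q : Set (TotalSpace F V)) ×ˢ
              (N ∩ {w : TotalSpace F V | 2 * q * c₂ ≤ ‖w.2‖}))] x) ?_
      · simpa only [Function.comp_def, hadamardHomotopy_one] using h4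
      · rw [nhdsWithin_prod_eq, nhdsWithin_prod_eq]
        refine (tendsto_fst.comp tendsto_fst).prodMk (Tendsto.prodMk ?_ ?_)
        · exact (tendsto_pure_pure (fun _ : Unit => (1 : ℝ)) ()).comp
            (tendsto_const_pure : Tendsto (fun _ => ()) _ _) |>.mono_right
            (pure_le_nhdsWithin ⟨zero_le_one, le_rfl⟩)
        · exact (tendsto_snd.comp (tendsto_snd.comp tendsto_snd)).mono_right
            (nhdsWithin_mono _ inter_subset_left)
    · rw [f₀.ext_of_mem (zeroSection_mem hN.mem_nhdsSet _), f₀.ext_of_mem hx.2.2.1] at h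
      have h3 : zeroSection F V x.2.1.proj = x.2.2 := congrArg Subtype.val (hf₀.2.1.injective h)
      have h4 : 2 * q * c₂ ≤ ‖x.2.2.2‖ := hx.2.2.2
      rw [← h3] at h4
      have h5 : ‖(zeroSection F V x.2.1.proj).2‖ = 0 := norm_zero
      rw [h5] at h4
      have : 0 < 2 * q * c₂ := by positivity
      linarith
  obtain ⟨c₃, hc₃, h3⟩ := exists_pos_of_eventually_prod (P := fun f s =>
    ∀ x ∈ Icc (0 : ℝ) 1 ×ˢ ((closedTube V q : Set (TotalSpace F V)) ×ˢ
        (N ∩ {w : TotalSpace F V | 2 * q * c₂ ≤ ‖w.2‖})),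
      hadamardHomotopy f x.1 (scale s x.2.1) ≠ f.ext x.2.2) h3'
  refine ⟨min c₁ c₃, lt_min hc₁ hc₃, ?_⟩
  filter_upwards [h1, h2, h3] with f g1 g2 g3 hf δ hδ hδc t ht
  have hp := hf.1.1.1
  obtain ⟨k1, k2⟩ := g1 δ hδ (hδc.trans (min_le_left _ _)) t ht
  have k3 := g3 δ hδ (hδc.trans (min_le_right _ _))
  set k := linearizedMap hN hμ f hp δ hδ t ht with hk
  have hscale : ∀ w : TotalSpace F V, ‖w.2‖ ≤ 2 * q * δ →
      scale δ⁻¹ w ∈ (closedTube V (2 * q) : Set (TotalSpace F V)) := fun w hw => by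
    change ‖(scale δ⁻¹ w).2‖ ≤ 2 * q
    rw [norm_scale, abs_of_pos (inv_pos.2 hδ), inv_mul_le_iff₀ hδ, mul_comm]
    exact hw
  -- a point close to the zero section and a point far from it have different images
  have hasym : ∀ w ∈ N, ∀ w' ∈ N, ‖w.2‖ < q * δ → 2 * q * δ < ‖w'.2‖ → k.ext w ≠ k.ext w' := by
    intro w hw w' hw' hwδ hwδ'
    have hψ := cutoffScale_mem hμ.mem_Icc δ ht w
    have hqδ : q * δ ≤ ‖w'.2‖ := by nlinarith
    rw [linearizedMap_ext_of_le hμ1 hw' hqδ, linearizedMap_ext hw]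
    rcases le_or_gt (2 * q * c₂) ‖w'.2‖ with hc | hc
    · have h4 := k3 (cutoffScale μ δ t w, (scale δ⁻¹ w, w')) ⟨hψ, ?_, hw', hc⟩
      · simp only [scale_scale, mul_inv_cancel₀ hδ.ne', scale_one] at h4
        exact h4
      · change ‖(scale δ⁻¹ w).2‖ ≤ q
        rw [norm_scale, abs_of_pos (inv_pos.2 hδ), inv_mul_le_iff₀ hδ, mul_comm]
        exact hwδ.le
    · have hq2 : 0 < 2 * q := by positivity
      have hw'0 : 0 < ‖w'.2‖ := lt_trans (by positivity) hwδ'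
      set s := ‖w'.2‖ / (2 * q) with hs
      have hs0 : 0 < s := div_pos hw'0 hq2
      have hsδ : δ < s := by rw [hs, lt_div_iff₀ hq2]; linarith
      have hsc : s ≤ c₂ := by rw [hs, div_le_iff₀ hq2]; linarith
      have hsw : s * (2 * q) = ‖w'.2‖ := div_mul_cancel₀ _ hq2.ne'
      have h4 := g2 s hs0 hsc (cutoffScale μ δ t w, (scale s⁻¹ w, scale s⁻¹ w')) ⟨hψ, ?_, ?_⟩
      · intro h5
        apply h4
        change hadamardHomotopy f (s * cutoffScale μ δ t w) (scale s⁻¹ w) =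
          hadamardHomotopy f s (scale s⁻¹ w')
        have h6 := hadamardHomotopy_mul_scale_inv f 1 hs0.ne' w'
        rw [mul_one, hadamardHomotopy_one] at h6
        rw [hadamardHomotopy_mul_scale_inv f _ hs0.ne', h5, h6]
      · change ‖(scale s⁻¹ w).2‖ ≤ q
        rw [norm_scale, abs_of_pos (inv_pos.2 hs0), inv_mul_le_iff₀ hs0]
        nlinarith
      · change ‖(scale s⁻¹ w').2‖ = 2 * q
        rw [norm_scale, abs_of_pos (inv_pos.2 hs0), ← hsw, inv_mul_cancel_left₀ hs0.ne']
  have hinj : InjOn k.ext N := by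
    intro w hw w' hw' h
    rcases le_or_gt ‖w.2‖ (2 * q * δ) with hc | hc
    · rcases le_or_gt ‖w'.2‖ (2 * q * δ) with hc' | hc'
      · have h4 : scaledHomotopy μ f δ t (scale δ⁻¹ w) =
            scaledHomotopy μ f δ t (scale δ⁻¹ w') := by
          rw [hk, linearizedMap_ext_eq_scale hw, linearizedMap_ext_eq_scale hw'] at h
          have h5 := congrArg (scale δ⁻¹) h
          rwa [scale_scale, scale_scale, inv_mul_cancel₀ hδ.ne', scale_one, scale_one] at h5
        have h5 := congrArg (scale δ) (k1 (hscale w hc) (hscale w' hc') h4)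
        rwa [scale_scale, scale_scale, mul_inv_cancel₀ hδ.ne', scale_one, scale_one] at h5
      · rcases lt_or_ge ‖w.2‖ (q * δ) with hd | hd
        · exact absurd h (hasym w hw w' hw' hd hc')
        · rw [hk, linearizedMap_ext_of_le hμ1 hw hd,
            linearizedMap_ext_of_le hμ1 hw' (by nlinarith), f.ext_of_mem hw, f.ext_of_mem hw'] at h
          exact congrArg Subtype.val (hf.2.1.injective h)
    · rcases lt_or_ge ‖w'.2‖ (q * δ) with hd | hd
      · exact absurd h.symm (hasym w' hw' w hw hd hc)
      · rw [hk, linearizedMap_ext_of_le hμ1 hw (by nlinarith),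
          linearizedMap_ext_of_le hμ1 hw' hd, f.ext_of_mem hw, f.ext_of_mem hw'] at h
        exact congrArg Subtype.val (hf.2.1.injective h)
  have himm : ∀ w ∈ N, Function.Injective (k.tangentMapAt w) := by
    intro w hw
    rcases le_or_gt ‖w.2‖ (2 * q * δ) with hc | hc
    · exact injective_mfderivWithin_of_isImmersiveAt hN.uniqueMDiffOn hδ.ne' k.contMDiffOn_ext
        (fun w hw => linearizedMap_ext_eq_scale hw) hw (k2 _ (hscale w hc))
    · have h4 : k.ext =ᶠ[𝓝[N] w] f.ext := by
        have h5 : ∀ᶠ w' in 𝓝 w, q * δ < ‖w'.2‖ :=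
          hnorm.continuousAt.eventually_const_lt (by nlinarith)
        filter_upwards [nhdsWithin_le_nhds h5, self_mem_nhdsWithin] with w' h6 h7
        exact linearizedMap_ext_of_le hμ1 h7 h6.le
      have h5 := h4.mfderivWithin_eq_of_mem (I := IB.prod 𝓘(ℝ, F)) (I' := IC.prod 𝓘(ℝ, G)) hw
      have h6 := hf.2.2 w hw
      intro u v huv
      exact h6 ((DFunLike.congr_fun h5 u).symm.trans (huv.trans (DFunLike.congr_fun h5 v)))
  refine ⟨⟨⟨linearizedMap_mem_pairMaps, fun b => ?_⟩, ⟨linearizedMap_mem_pairMaps, fun b => ?_⟩⟩,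
    isSmoothEmbedding_of_injOn hN hinj himm⟩
  · rw [hk, horizontalRank_linearizedMap]; exact hf.1.1.2 b
  · rw [hk, verticalRank_linearizedMap]; exact hf.1.2.2 b

end Width

/-! ### Embeddings in equal dimensions -/

section EqualDimensions

variable
  {EB : Type*} [NormedAddCommGroup EB] [NormedSpace ℝ EB]
  {HB : Type*} [TopologicalSpace HB] {IB : ModelWithCorners ℝ EB HB}
  {B : Type*} [TopologicalSpace B] [ChartedSpace HB B]
  {F : Type*} [NormedAddCommGroup F] [NormedSpace ℝ F]
  {V : B → Type*} [TopologicalSpace (TotalSpace F V)]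
  [∀ b, AddCommGroup (V b)] [∀ b, Module ℝ (V b)] [∀ b, TopologicalSpace (V b)]
  [FiberBundle F V] [VectorBundle ℝ F V]
  {EC : Type*} [NormedAddCommGroup EC] [NormedSpace ℝ EC]
  {HC : Type*} [TopologicalSpace HC] {IC : ModelWithCorners ℝ EC HC}
  {C : Type*} [TopologicalSpace C] [ChartedSpace HC C]
  {G : Type*} [NormedAddCommGroup G] [NormedSpace ℝ G]
  {W : C → Type*} [TopologicalSpace (TotalSpace G W)]
  [∀ c, AddCommGroup (W c)] [∀ c, Module ℝ (W c)] [∀ c, TopologicalSpace (W c)]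
  [FiberBundle G W] [VectorBundle ℝ G W]
  {N : Set (TotalSpace F V)}
  [IsManifold IB ∞ B] [ContMDiffVectorBundle ∞ F V IB]
  [IsManifold IC ∞ C] [ContMDiffVectorBundle ∞ G W IC] [T2Space C]
  [T2Space B] [CompleteSpace G]

/-- The lower left block of the Jacobi matrix of a map of pairs vanishes along the zero section. -/
theorem tangentMapAt_zeroSection_inl_snd (hN : N ∈ 𝓝ˢ (range (zeroSection F V)))
    {f : BundleMap IB IC N G W} (hf : f ∈ pairMaps IB IC G W N) (b : B) (u : EB) :
    ((f.tangentMapAt (zeroSection F V b) : EB × F →L[ℝ] EC × G) (u, 0)).2 = 0 := by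
  have hb : zeroSection F V b ∈ (bundleChart IB F V b).source :=
    self_mem_bundleChart_source (IB := IB) (zeroSection F V b)
  have hc := self_mem_bundleChart_source (IB := IC) (f.ext (zeroSection F V b))
  rw [mfderivWithin_zeroSection hN f hf b]
  set c := (f.ext (zeroSection F V b)).proj
  set φ := bundleRep IB IC b c f.ext with hφ
  have hx : extChartAt IB b b ∈ range IB :=
    extChartAt_target_subset_range b (mem_extChartAt_target b)
  have hd := ((contDiffWithinAt_bundleRep_zero hN f hb hc).differentiableWithinAt
    (by simp)).hasFDerivWithinAt
  have hι : HasFDerivWithinAt (fun x : EB => (x, (0 : F))) (ContinuousLinearMap.inl ℝ EB F)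
      (range IB) (extChartAt IB b b) := (ContinuousLinearMap.inl ℝ EB F).hasFDerivWithinAt
  have h1 := (hd.snd).comp (extChartAt IB b b) hι
    (fun x hx => (⟨hx, mem_univ _⟩ : (x, (0 : F)) ∈ range IB ×ˢ (univ : Set F)))
  have hsymm : ContinuousAt (bundleChart IB F V b).symm (extChartAt IB b b, (0 : F)) := by
    rw [← bundleChart_zeroSection hb]; exact continuousAt_extChartAt_symm' hb
  have hf₀ : ContinuousAt f.ext ((bundleChart IB F V b).symm (extChartAt IB b b, (0 : F))) := by
    rw [← bundleChart_zeroSection hb, (bundleChart IB F V b).left_inv hb]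
    exact (f.contMDiffOn_ext.continuousOn _ (zeroSection_mem hN b)).continuousAt
      (mem_nhds_zeroSection hN b)
  have hsrc : ∀ᶠ x in 𝓝 (extChartAt IB b b),
      f.ext ((bundleChart IB F V b).symm (x, (0 : F))) ∈ (bundleChart IC G W c).source := by
    have h2 : ContinuousAt (fun x : EB => f.ext ((bundleChart IB F V b).symm (x, (0 : F))))
        (extChartAt IB b b) :=
      ContinuousAt.comp (g := f.ext) (f := fun x : EB => (bundleChart IB F V b).symm (x, (0 : F)))
        hf₀ (ContinuousAt.comp (g := (bundleChart IB F V b).symm) hsymm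
          (continuous_id.prodMk continuous_const).continuousAt)
    refine h2.eventually_mem ?_
    rw [← bundleChart_zeroSection hb, (bundleChart IB F V b).left_inv hb]
    exact extChartAt_source_mem_nhds' hc
  obtain ⟨R, hR, -, hRn⟩ := bundleChart_target (IB := IB) (F := F) (V := V) (b := b)
  have hRx : R ∈ 𝓝[range IB] (extChartAt IB b b) := by
    have := hRn _ hb; rwa [bundleChart_zeroSection hb] at this
  have h0 : ∀ x ∈ R, f.ext ((bundleChart IB F V b).symm (x, (0 : F))) ∈
      (bundleChart IC G W c).source → (φ (x, 0)).2 = 0 := fun x hx hs => by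
    have hz : (x, (0 : F)) ∈ (bundleChart IB F V b).target := by rw [hR]; exact ⟨hx, mem_univ _⟩
    have h3 := bundleRep_smul (IC := IC) (c := c) (g := f.ext) hz 0
    have h4 := bundleChart_symm_smul hz 0
    simp only [zero_smul] at h3 h4
    rw [h4, scale_zero, ext_zeroSection hN hf] at hs
    rw [hφ, h3, scale_zero, ext_zeroSection hN hf, bundleChart_zeroSection hs]
  have h5 : HasFDerivWithinAt (fun _ : EB => (0 : G)) (0 : EB →L[ℝ] G) (range IB)
      (extChartAt IB b b) := hasFDerivWithinAt_const _ _ _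
  have h6 := (h1.congr_of_eventuallyEq (f₁ := fun _ => (0 : G)) (by
    filter_upwards [hRx, nhdsWithin_le_nhds hsrc] with x h7 h8 using (h0 x h7 h8).symm)
    (h0 _ (mem_of_mem_nhdsWithin hx hRx) hsrc.self_of_nhds).symm)
  exact DFunLike.congr_fun ((IB.uniqueDiffOn _ hx).eq h6 h5) u

/-- Over bases of the same dimension an embedding of pairs has maximal horizontal and vertical rank:
its Jacobi matrix along the zero section is injective and block triangular, so the square block `P`
is injective, hence invertible, and then `S` is injective too. -/
theorem embeddings_eq_maximalRankEmbeddings [FiniteDimensional ℝ EB] [FiniteDimensional ℝ F]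
    [FiniteDimensional ℝ EC] (hN : N ∈ 𝓝ˢ (range (zeroSection F V)))
    (hdim : Module.finrank ℝ EB = Module.finrank ℝ EC) :
    embeddings IB IC G W N = maximalRankEmbeddings IB IC G W N := by
  refine Subset.antisymm (fun f hf => ?_) fun f hf => ⟨hf.1.1.1, hf.2⟩
  have hp := hf.1
  have hA : ∀ b : B, Function.Injective (horizontalBlock f b) ∧
      Function.Injective (verticalBlock f b) := fun b => by
    have hinj : Function.Injective
        (f.tangentMapAt (zeroSection F V b) : EB × F →L[ℝ] EC × G) :=
      hf.2.2 _ (zeroSection_mem hN b)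
    have hR := tangentMapAt_zeroSection_inl_snd hN hp b
    have hP : ∀ u, horizontalBlock f b u =
        ((f.tangentMapAt (zeroSection F V b) : EB × F →L[ℝ] EC × G) (u, 0)).1 := fun _ => rfl
    have hS : ∀ v, verticalBlock f b v =
        ((f.tangentMapAt (zeroSection F V b) : EB × F →L[ℝ] EC × G) (0, v)).2 := fun _ => rfl
    generalize (f.tangentMapAt (zeroSection F V b) : EB × F →L[ℝ] EC × G) = A at *
    have h1 : Function.Injective (horizontalBlock f b) := fun u u' h => by
      rw [hP, hP] at h
      have h2 : A (u, 0) = A (u', 0) := Prod.ext h ((hR u).trans (hR u').symm)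
      exact congrArg Prod.fst (hinj h2)
    refine ⟨h1, (injective_iff_map_eq_zero _).2 fun v hv => ?_⟩
    have hsurj : Function.Surjective (horizontalBlock f b) :=
      (LinearMap.injective_iff_surjective_of_finrank_eq_finrank hdim).1 h1
    obtain ⟨u, hu⟩ := hsurj (A (0, v)).1
    rw [hP] at hu
    rw [hS] at hv
    have h2 : A (u, 0) = A (0, v) := Prod.ext hu ((hR u).trans hv.symm)
    exact (congrArg Prod.snd (hinj h2)).symm
  exact ⟨⟨⟨hp, fun b => (LinearMap.finrank_range_of_inj (hA b).1).ge⟩,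
    ⟨hp, fun b => (LinearMap.finrank_range_of_inj (hA b).2).ge⟩⟩, hf.2⟩

end EqualDimensions

/-! ### Pseudometrizability of the weak Whitney topologies -/

theorem pseudoMetrizableSpace_induced_pi {A ι : Type*} [Countable ι] {Z : ι → Type*}
    [∀ i, PseudoMetricSpace (Z i)] (Φ : A → ∀ i, Z i) :
    @TopologicalSpace.PseudoMetrizableSpace A (TopologicalSpace.induced Φ inferInstance) := by
  have : TopologicalSpace.PseudoMetrizableSpace (∀ i, Z i) := UniformSpace.pseudoMetrizableSpace
  let : TopologicalSpace A := TopologicalSpace.induced Φ inferInstance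
  exact (IsInducing.mk rfl : IsInducing Φ).pseudoMetrizableSpace

namespace SmoothMapOn

variable {E : Type*} [NormedAddCommGroup E] [NormedSpace ℝ E]
  {H : Type*} [TopologicalSpace H] {I : ModelWithCorners ℝ E H}
  {M : Type*} [TopologicalSpace M] [ChartedSpace H M]
  {E' : Type*} [NormedAddCommGroup E'] [NormedSpace ℝ E']
  {H' : Type*} [TopologicalSpace H'] {J : ModelWithCorners ℝ E' H'}
  {N : Set M} {Y : Type*} [TopologicalSpace Y] [ChartedSpace H' Y]
  [T2Space M] [IsManifold I ∞ M] [IsManifold J ∞ Y] [FiniteDimensional ℝ E']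

variable (J) in
/-- Some smooth bump function at `y`. -/
noncomputable def chartBump (y : Y) : SmoothBumpFunction J y := Classical.choice inferInstance

variable (J) in
/-- A smooth function on `Y` that determines the chart at `y` near `y`: a bump function `ρ` at `y`
together with its product `ρ • φ` with the chart `φ`. -/
noncomputable def chartProbe (y : Y) (z : Y) : ℝ × E' :=
  ((chartBump J y) z, (chartBump J y) z • extChartAt J y z)

theorem contMDiff_chartProbe [T2Space Y] (y : Y) :
    ContMDiff J 𝓘(ℝ, ℝ × E') ∞ (chartProbe J y) := by
  have h1 : ContMDiff J 𝓘(ℝ, ℝ) ∞ (chartBump J y) :=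
    (chartBump J y).contMDiff
  refine h1.prodMk_space ((chartBump J y).contMDiff_smul ?_)
  exact contMDiffOn_extChartAt

variable (I) in
/-- The local representation of `θ ∘ f` in the chart at `x`. -/
noncomputable def probeRep {P : Type*} (θ : Y → P) (x : M) (f : SmoothMapOn I J N Y) (z : E) : P :=
  θ (f.ext ((extChartAt I x).symm z))

section Probe

variable {P : Type*} [NormedAddCommGroup P] [NormedSpace ℝ P] {θ : Y → P}

theorem contDiffOn_probeRep (hθ : ContMDiff J 𝓘(ℝ, P) ∞ θ) (x : M) (f : SmoothMapOn I J N Y) :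
    ContDiffOn ℝ ∞ (probeRep I θ x f) (chartDomain I N x) := by
  have h1 : ContMDiffOn 𝓘(ℝ, E) I ∞ (extChartAt I x).symm (chartDomain I N x) :=
    (contMDiffOn_extChartAt_symm x).mono inter_subset_left
  exact ((hθ.comp_contMDiffOn f.contMDiffOn_ext).comp h1 fun z hz => hz.2).contDiffOn

theorem jetConvergentAt_probeRep (hN : IsCompact N) (hNu : UniqueMDiffOn I N) {r : ℕ∞} {n : ℕ}
    (hn : (n : ℕ∞) ≤ r) (hθ : ContMDiff J 𝓘(ℝ, P) ∞ θ) (f₀ : SmoothMapOn I J N Y) {x w : M}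
    (hw : w ∈ N) (hx : w ∈ (extChartAt I x).source) :
    JetConvergentAt (@nhds _ (whitney r) f₀) n (probeRep I θ x) (chartDomain I N x)
      (extChartAt I x w) := by
  set y := f₀.ext w with hy
  have hys : f₀.ext w ∈ (extChartAt J y).source := mem_extChartAt_source y
  obtain ⟨h1, h2⟩ := jetConvergentAt_localRep hN hNu hn f₀ hw hx hys
  have h3 : ContDiffWithinAt ℝ n (θ ∘ (extChartAt J y).symm) (range J) (extChartAt J y y) :=
    ((contMDiffAt_iff.1 (hθ y)).2).of_le (by exact_mod_cast le_top)
  have h4 : Tendsto (fun q : SmoothMapOn I J N Y × E => q.1.ext ((extChartAt I x).symm q.2))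
      (@nhds _ (whitney r) f₀ ×ˢ 𝓝[chartDomain I N x] (extChartAt I x w)) (𝓝 y) :=
    h2.comp (tendsto_id.prodMap (tendsto_extChartAt_symm_chartDomain hx))
  have h5 : Tendsto (fun q : SmoothMapOn I J N Y × E => q.1.localRep x y q.2)
      (@nhds _ (whitney r) f₀ ×ˢ 𝓝[chartDomain I N x] (extChartAt I x w))
      (𝓝[range J] (extChartAt J y y)) :=
    tendsto_nhdsWithin_iff.2 ⟨((continuousAt_extChartAt y).tendsto).comp h4,
      Eventually.of_forall fun q => mem_range_self _⟩
  refine (JetConvergentAt.comp_contDiffWithinAt h3 (mem_range_self _) h1 h5).congr ?_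
  filter_upwards [h4.eventually (extChartAt_source_mem_nhds (I := J) y)] with q hq
  simp only [probeRep, localRep, Function.comp_apply, (extChartAt J y).left_inv hq]

/-- The derivatives of order `d` of `θ ∘ f` along a compact set `K`. -/
noncomputable def probeJet (hNu : UniqueMDiffOn I N) (hθ : ContMDiff J 𝓘(ℝ, P) ∞ θ) {x : M}
    {K : Set M} (hKN : K ⊆ N ∩ (extChartAt I x).source) (d : ℕ) (f : SmoothMapOn I J N Y) :
    C(K, E [×d]→L[ℝ] P) where
  toFun w := iteratedFDerivWithin ℝ d (probeRep I θ x f) (chartDomain I N x) (extChartAt I x w)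
  continuous_toFun := by
    have : IsManifold I 1 M := IsManifold.of_le (n := ∞) (by norm_cast)
    have h1 := (contDiffOn_probeRep hθ x f).continuousOn_iteratedFDerivWithin (m := d)
      (by exact_mod_cast le_top) (hNu.uniqueDiffOn_target_inter x)
    refine h1.comp_continuous ((continuousOn_extChartAt x).comp_continuous continuous_subtype_val
      fun w => (hKN w.2).2) fun w => mem_chartDomain (hKN w.2).1 (hKN w.2).2

theorem continuous_probeJet (hN : IsCompact N) (hNu : UniqueMDiffOn I N) {r : ℕ∞} {d : ℕ}
    (hd : (d : ℕ∞) ≤ r) (hθ : ContMDiff J 𝓘(ℝ, P) ∞ θ) {x : M} {K : Set M}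
    (hKN : K ⊆ N ∩ (extChartAt I x).source) :
    Continuous[whitney r, inferInstance] (probeJet (J := J) hNu hθ hKN d) := by
  have : IsManifold I 1 M := IsManifold.of_le (n := ∞) (by norm_cast)
  let : TopologicalSpace (SmoothMapOn I J N Y) := whitney r
  refine ContinuousMap.continuous_of_continuous_uncurry _ (continuous_iff_continuousAt.2 ?_)
  rintro ⟨f₀, w₀⟩
  have hw₀ := hKN w₀.2
  obtain ⟨q, hq⟩ := (jetConvergentAt_probeRep hN hNu hd hθ f₀ hw₀.1 hw₀.2
    ).exists_tendsto_iteratedFDerivWithin (hNu.uniqueDiffOn_target_inter x) le_rfl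
  have h1 : Tendsto (fun w : K => extChartAt I x w) (𝓝 w₀)
      (𝓝[chartDomain I N x] (extChartAt I x w₀)) := by
    refine (tendsto_extChartAt_chartDomain hw₀.2).comp (tendsto_nhdsWithin_iff.2
      ⟨continuous_subtype_val.tendsto w₀, Eventually.of_forall fun w => (hKN w.2).1⟩)
  have h2 := hq.comp ((tendsto_id (x := 𝓝 f₀)).prodMap h1)
  rw [← nhds_prod_eq] at h2
  have h3 := tendsto_nhds_unique (h2.mono_left (pure_le_nhds _)) (tendsto_pure_nhds _ _)
  rw [h3] at h2
  exact h2

end Probe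

theorem exists_countable_chartProbe [T2Space Y] [SecondCountableTopology Y] :
    ∃ s : Set Y, s.Countable ∧ ∀ z : Y, ∃ y ∈ s, (chartProbe J y z).1 = 1 := by
  obtain ⟨s, hs, hsu⟩ := TopologicalSpace.countable_cover_nhds
    (f := fun y : Y => {z | (chartBump J y) z = 1})
    fun y => (chartBump J y).eventuallyEq_one
  refine ⟨s, hs, fun z => ?_⟩
  obtain ⟨y, hy, hz⟩ := mem_iUnion₂.1 (hsu ▸ mem_univ z)
  exact ⟨y, hy, hz⟩

theorem exists_finite_compact_cover (hN : IsCompact N) :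
    ∃ (t : Finset M) (K : M → Set M), (∀ x ∈ t, IsCompact (K x)) ∧
      (∀ x ∈ t, K x ⊆ N ∩ (extChartAt I x).source) ∧ ∀ w ∈ N, ∃ x ∈ t, K x ∈ 𝓝[N] w := by
  have h1 : ∀ x : M, ∃ K, x ∈ N → IsCompact K ∧ K ⊆ N ∩ (extChartAt I x).source ∧ K ∈ 𝓝[N] x :=
    fun x => by
      by_cases hx : x ∈ N
      · obtain ⟨K, hK, hKN, hKO, hKn⟩ := exists_isCompact_subset_inter hN hx
          (mem_nhdsWithin_of_mem_nhds (extChartAt_source_mem_nhds (I := I) x))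
        exact ⟨K, fun _ => ⟨hK, subset_inter hKN hKO, hKn⟩⟩
      · exact ⟨∅, fun h => absurd h hx⟩
  choose K hK using h1
  obtain ⟨t, htN, ht⟩ := hN.elim_nhdsWithin_subcover (fun x => {w | K x ∈ 𝓝[N] w})
    fun x hx => eventually_eventually_nhdsWithin.2 (hK x hx).2.2
  refine ⟨t, K, fun x hx => (hK x (htN x hx)).1, fun x hx => (hK x (htN x hx)).2.1,
    fun w hw => ?_⟩
  simpa using ht hw

/-- Convergence of the derivatives of `ρ` and `ρ • φ` along `f`, for a bump function `ρ` equal to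
`1` at `f₀ w₀` and a chart `φ`, implies convergence of `f`. -/
theorem jetConvergentAt_localRep_of_chartProbe {l : Filter (SmoothMapOn I J N Y)}
    {f₀ : SmoothMapOn I J N Y} (hl : pure f₀ ≤ l) {n : ℕ} {x w : M} {y : Y} (hw : w ∈ N)
    (hx : w ∈ (extChartAt I x).source) (hy : (chartProbe J y (f₀.ext w)).1 = 1)
    (h : JetConvergentAt l n (probeRep I (chartProbe J y) x) (chartDomain I N x)
      (extChartAt I x w)) :
    f₀.ext w ∈ (extChartAt J y).source ∧
    JetConvergentAt l n (fun f => f.localRep x y) (chartDomain I N x) (extChartAt I x w) ∧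
      Tendsto (fun q : SmoothMapOn I J N Y × M => q.1.ext q.2) (l ×ˢ 𝓝[N] w) (𝓝 (f₀.ext w)) := by
  have hsrc : ∀ z : Y, (chartProbe J y z).1 ≠ 0 → z ∈ (extChartAt J y).source := fun z hz => by
    rw [extChartAt_source]
    exact (chartBump J y).support_subset_source hz
  have hys : f₀.ext w ∈ (extChartAt J y).source := hsrc _ (by rw [hy]; exact one_ne_zero)
  have hz := mem_chartDomain hw hx
  have h1 := h.tendsto_of_pure hl hz
  have hval : probeRep I (chartProbe J y) x f₀ (extChartAt I x w) =
      (1, extChartAt J y (f₀.ext w)) := by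
    rw [probeRep, (extChartAt I x).left_inv hx]
    refine Prod.ext hy ?_
    change (chartProbe J y (f₀.ext w)).1 • _ = _
    rw [hy, one_smul]
  rw [hval] at h1
  have hne : ∀ᶠ q : SmoothMapOn I J N Y × E in l ×ˢ 𝓝[chartDomain I N x] (extChartAt I x w),
      (probeRep I (chartProbe J y) x q.1 q.2).1 ≠ 0 :=
    ((continuous_fst.tendsto _).comp h1).eventually_ne one_ne_zero
  have hinv : ContDiffAt ℝ n (fun p : ℝ × E' => p.1⁻¹ • p.2) (1, extChartAt J y (f₀.ext w)) :=
    (contDiffAt_fst.inv one_ne_zero).smul contDiffAt_snd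
  have h2 : JetConvergentAt l n (fun f => f.localRep x y) (chartDomain I N x)
      (extChartAt I x w) := by
    refine (JetConvergentAt.comp_contDiffWithinAt (T := univ) hinv.contDiffWithinAt (mem_univ _) h
      (by rwa [nhdsWithin_univ])).congr ?_
    filter_upwards [hne] with q hq
    exact (inv_smul_smul₀ hq _).symm
  refine ⟨hys, h2, tendsto_of_tendsto_chartRep (g := fun f : SmoothMapOn I J N Y => f.ext) ?_ hx
    hys ?_⟩
  · have h3 := h2.tendsto_of_pure hl hz
    have h4 : f₀.localRep x y (extChartAt I x w) = extChartAt J y (f₀.ext w) := by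
      simp only [localRep, Function.comp_apply, (extChartAt I x).left_inv hx]
    rwa [h4] at h3
  · have h5 := ((tendsto_id (x := l)).prodMap (tendsto_extChartAt_chartDomain (N := N)
      hx)).eventually hne
    filter_upwards [h5, (tendsto_snd (f := l)).eventually
      (mem_nhdsWithin_of_mem_nhds (extChartAt_source_mem_nhds' hx))] with q hq hq'
    refine hsrc _ ?_
    have h6 : probeRep I (chartProbe J y) x q.1 (extChartAt I x q.2) =
        chartProbe J y (q.1.ext q.2) := by
      rw [probeRep, (extChartAt I x).left_inv hq']
    rw [← h6]
    exact hq

/-- The weak Whitney topologies on the smooth maps from a compact set to a second countable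
manifold are pseudometrizable: they are induced by countably many maps into spaces of continuous
functions. -/
theorem pseudoMetrizableSpace_whitney [T2Space Y] [SecondCountableTopology Y] (hN : IsCompact N)
    (hNu : UniqueMDiffOn I N) (r : ℕ∞) :
    @TopologicalSpace.PseudoMetrizableSpace (SmoothMapOn I J N Y) (whitney r) := by
  have : IsManifold I 1 M := IsManifold.of_le (n := ∞) (by norm_cast)
  obtain ⟨s, hs, hsY⟩ := exists_countable_chartProbe (J := J) (Y := Y)
  obtain ⟨t, K, hK, hKN, ht⟩ := exists_finite_compact_cover (I := I) hN
  have := hs.to_subtype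
  have hKc : ∀ x : t, CompactSpace (K x) := fun x => isCompact_iff_compactSpace.1 (hK x x.2)
  let Φ : SmoothMapOn I J N Y → ∀ i : s × t × {d : ℕ // (d : ℕ∞) ≤ r},
      C(K i.2.1, E [×i.2.2]→L[ℝ] (ℝ × E')) := fun f i =>
    probeJet hNu (contMDiff_chartProbe i.1.1) (hKN i.2.1 i.2.1.2) i.2.2 f
  let T : TopologicalSpace (SmoothMapOn I J N Y) := TopologicalSpace.induced Φ inferInstance
  have hT : (whitney r : TopologicalSpace (SmoothMapOn I J N Y)) = T := by
    refine le_antisymm ?_ ?_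
    · rw [← continuous_iff_le_induced]
      refine @continuous_pi _ _ _ (whitney r) _ _ fun i => ?_
      exact continuous_probeJet hN hNu i.2.2.2 (contMDiff_chartProbe i.1.1) (hKN i.2.1 i.2.1.2)
    · rw [← continuous_id_iff_le, @continuous_iff_continuousAt]
      intro f₀
      have key : ∀ n : ℕ, (n : ℕ∞) ≤ r → ∀ w ∈ N, ∃ x y, w ∈ (extChartAt I x).source ∧
          f₀.ext w ∈ (extChartAt J y).source ∧
          JetConvergentAt (@nhds _ T f₀) n (fun f => f.localRep x y) (chartDomain I N x)
            (extChartAt I x w) ∧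
          Tendsto (fun q : SmoothMapOn I J N Y × M => q.1.ext q.2) (@nhds _ T f₀ ×ˢ 𝓝[N] w)
            (𝓝 (f₀.ext w)) := by
        intro n hn w hw
        obtain ⟨y, hys, hy⟩ := hsY (f₀.ext w)
        obtain ⟨x, hxt, hxK⟩ := ht w hw
        have hwK : w ∈ K x := mem_of_mem_nhdsWithin hw hxK
        have hx := (hKN x hxt hwK).2
        have hKw : 𝓝[N] w = map Subtype.val (𝓝 (⟨w, hwK⟩ : K x)) := by
          rw [← nhdsWithin_eq_map_subtype_coe hwK]
          exact le_antisymm (nhdsWithin_le_iff.2 hxK)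
            (nhdsWithin_mono _ fun v hv => (hKN x hxt hv).1)
        refine ⟨x, y, hx, jetConvergentAt_localRep_of_chartProbe (pure_le_nhds f₀) hw hx hy ?_⟩
        refine JetConvergentAt.of_iteratedFDerivWithin (hNu.uniqueDiffOn_target_inter x)
          isOpen_univ (mem_univ _) (Eventually.of_forall fun f =>
            ((contDiffOn_probeRep (contMDiff_chartProbe y) x f).of_le
              (by exact_mod_cast le_top)).mono inter_subset_left) fun j hj => ?_
        let i : s × t × {d : ℕ // (d : ℕ∞) ≤ r} :=
          (⟨y, hys⟩, ⟨x, hxt⟩, ⟨j, le_trans (by exact_mod_cast hj) hn⟩)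
        have h1 : Continuous fun f => Φ f i := 
          (continuous_apply (A := fun i : s × t × {d : ℕ // (d : ℕ∞) ≤ r} =>
            C(K i.2.1, E [×i.2.2]→L[ℝ] (ℝ × E'))) i).comp (continuous_induced_dom (f := Φ))
        have h2 : Continuous fun q : SmoothMapOn I J N Y × K x => Φ q.1 i q.2 :=
          (h1.comp continuous_fst).eval continuous_snd
        have h3 := h2.tendsto (f₀, ⟨w, hwK⟩)
        rw [nhds_prod_eq] at h3
        have h4 : Tendsto (fun q : SmoothMapOn I J N Y × M => iteratedFDerivWithin ℝ j
            (probeRep I (chartProbe J y) x q.1) (chartDomain I N x) (extChartAt I x q.2))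
            (@nhds _ T f₀ ×ˢ 𝓝[N] w) (𝓝 (Φ f₀ i ⟨w, hwK⟩)) := by
          rw [hKw, ← map_id (f := @nhds _ T f₀), prod_map_map_eq, tendsto_map'_iff]
          exact h3
        have h5 := h4.comp ((tendsto_id (x := @nhds _ T f₀)).prodMap
          (tendsto_extChartAt_symm_chartDomain (N := N) hx))
        refine ⟨_, h5.congr' ?_⟩
        filter_upwards [(tendsto_snd (f := @nhds _ T f₀)).eventually self_mem_nhdsWithin]
          with q hq
        change iteratedFDerivWithin ℝ j _ _ (extChartAt I x ((extChartAt I x).symm q.2)) = _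
        rw [(extChartAt I x).right_inv (inter_subset_left hq)]
        rfl
      refine tendsto_whitney_of_jetConvergentAt (g := id) hNu (pure_le_nhds f₀) (fun w hw => ?_)
        fun n hn w hw => ?_
      · obtain ⟨x, y, -, -, -, h⟩ := key 0 (by simp) w hw
        exact h
      · obtain ⟨x, y, h1, h2, h3, -⟩ := key n hn w hw
        exact ⟨x, y, h1, h2, h3⟩
  rw [hT]
  exact pseudoMetrizableSpace_induced_pi Φ

end SmoothMapOn

/-! ### Continuous widths -/

theorem secondCountableTopology_totalSpace {EC : Type*} [NormedAddCommGroup EC] [NormedSpace ℝ EC]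
    [FiniteDimensional ℝ EC] {HC : Type*} [TopologicalSpace HC] (IC : ModelWithCorners ℝ EC HC)
    {C : Type*} [TopologicalSpace C] [ChartedSpace HC C] [SecondCountableTopology C]
    {G : Type*} [NormedAddCommGroup G] [NormedSpace ℝ G] [FiniteDimensional ℝ G]
    {W : C → Type*} [TopologicalSpace (TotalSpace G W)] [∀ c, TopologicalSpace (W c)]
    [∀ c, AddCommGroup (W c)]
    [∀ c, Module ℝ (W c)] [FiberBundle G W] : SecondCountableTopology (TotalSpace G W) := by
  have := FiniteDimensional.proper_real EC
  have := FiniteDimensional.proper_real G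
  have := IC.secondCountableTopology
  have : SecondCountableTopology (ModelProd HC G) :=
    inferInstanceAs (SecondCountableTopology (HC × G))
  obtain ⟨s, hs, hsu⟩ := TopologicalSpace.countable_cover_nhds
    (f := fun c : C => (trivializationAt G W c).baseSet ∩ (extChartAt IC c).source) fun c =>
      inter_mem ((trivializationAt G W c).open_baseSet.mem_nhds
        (mem_baseSet_trivializationAt G W c)) (extChartAt_source_mem_nhds c)
  refine ChartedSpace.secondCountable_of_countable_cover (ModelProd HC G)
    (s := zeroSection G W '' s) (eq_univ_of_forall fun w => ?_) (hs.image _)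
  obtain ⟨c, hc, hw⟩ := mem_iUnion₂.1 (hsu ▸ mem_univ w.proj)
  refine mem_iUnion₂.2 ⟨zeroSection G W c, mem_image_of_mem _ hc, ?_⟩
  rw [← extChartAt_source (IC.prod 𝓘(ℝ, G)), extChartAt_eq_bundleChart]
  exact mem_bundleChart_source.2 hw

section ContinuousWidth

variable
  {EB : Type*} [NormedAddCommGroup EB] [NormedSpace ℝ EB]
  {HB : Type*} [TopologicalSpace HB] {IB : ModelWithCorners ℝ EB HB}
  {B : Type*} [TopologicalSpace B] [ChartedSpace HB B]
  {F : Type*} [NormedAddCommGroup F] [NormedSpace ℝ F]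
  {V : B → Type*} [TopologicalSpace (TotalSpace F V)]
  [∀ b, NormedAddCommGroup (V b)] [∀ b, InnerProductSpace ℝ (V b)]
  [FiberBundle F V] [VectorBundle ℝ F V]
  {EC : Type*} [NormedAddCommGroup EC] [NormedSpace ℝ EC]
  {HC : Type*} [TopologicalSpace HC] {IC : ModelWithCorners ℝ EC HC}
  {C : Type*} [TopologicalSpace C] [ChartedSpace HC C]
  {G : Type*} [NormedAddCommGroup G] [NormedSpace ℝ G]
  {W : C → Type*} [TopologicalSpace (TotalSpace G W)]
  [∀ c, AddCommGroup (W c)] [∀ c, Module ℝ (W c)] [∀ c, TopologicalSpace (W c)]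
  [FiberBundle G W] [VectorBundle ℝ G W]
  {N : Set (TotalSpace F V)}
  [IsManifold IB ∞ B] [ContMDiffVectorBundle ∞ F V IB]
  [IsManifold IC ∞ C] [ContMDiffVectorBundle ∞ G W IC] [T2Space C]
  [T2Space B] [CompleteSpace G] [IsContMDiffRiemannianBundle IB ∞ F V]
  [FiniteDimensional ℝ EB] [FiniteDimensional ℝ F] [FiniteDimensional ℝ EC]
  [FiniteDimensional ℝ G] [SecondCountableTopology C]

/-- The widths that work locally are glued with a partition of unity: at a given map, the widths
that work, together with all the smaller ones, form an interval. -/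
theorem exists_continuous_width {p : ℝ} {μ : ℝ → ℝ} (hN : IsTubularDomain IB N)
    (hμ : IsCutoff p μ) {q : ℝ} (hq : 0 < q) (hμ1 : ∀ s, q ≤ s → μ s = 1) {ε : ℝ} (hε : 0 < ε)
    (hεN : closedTube V ε ⊆ N) : ∃ δ : maximalRankEmbeddings IB IC G W N → Ioo (0 : ℝ) ε,
      Continuous[SmoothMapOn.whitneyOn 3 _, inferInstance] δ ∧
      ∀ (f : maximalRankEmbeddings IB IC G W N) (t : ℝ) (ht : t ∈ Icc (0 : ℝ) 1),
        linearizedMap hN hμ f f.2.1.1.1 (δ f) (δ f).2.1 t ht ∈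
          maximalRankEmbeddings IB IC G W N := by
  have := t2Space_totalSpace (F := F) (V := V)
  have := t2Space_totalSpace (F := G) (V := W)
  have := secondCountableTopology_totalSpace (G := G) (W := W) IC
  let tA : TopologicalSpace (BundleMap IB IC N G W) := SmoothMapOn.whitney 3
  have hA : TopologicalSpace.PseudoMetrizableSpace (BundleMap IB IC N G W) :=
    SmoothMapOn.pseudoMetrizableSpace_whitney hN.isCompact hN.uniqueMDiffOn 3
  let tX : TopologicalSpace (maximalRankEmbeddings IB IC G W N) := SmoothMapOn.whitneyOn 3 _
  have hXm : TopologicalSpace.PseudoMetrizableSpace (maximalRankEmbeddings IB IC G W N) :=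
    (IsInducing.mk rfl :
      IsInducing (Subtype.val : maximalRankEmbeddings IB IC G W N → _)).pseudoMetrizableSpace
  let := TopologicalSpace.pseudoMetrizableSpacePseudoMetric
    (maximalRankEmbeddings IB IC G W N)
  let S : maximalRankEmbeddings IB IC G W N → Set ℝ := fun f =>
    {δ | 0 < δ ∧ δ < ε ∧ ∀ (δ' : ℝ) (hδ' : 0 < δ'), δ' ≤ δ → ∀ (t : ℝ) (ht : t ∈ Icc (0 : ℝ) 1),
      linearizedMap hN hμ f f.2.1.1.1 δ' hδ' t ht ∈ maximalRankEmbeddings IB IC G W N}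
  suffices h : ∃ g : C(maximalRankEmbeddings IB IC G W N, ℝ), ∀ f, g f ∈ S f by
    obtain ⟨g, hg⟩ := h
    refine ⟨fun f => ⟨g f, (hg f).1, (hg f).2.1⟩, ?_, fun f t ht => ?_⟩
    · exact g.continuous.subtype_mk _
    · exact (hg f).2.2 _ _ le_rfl t ht
  refine exists_continuous_forall_mem_convex_of_local_const (fun f => ?_) (fun f₀ => ?_)
  · refine OrdConnected.convex ⟨fun x hx y hy z hz => ?_⟩
    exact ⟨hx.1.trans_le hz.1, hz.2.trans_lt hy.2.1,
      fun δ' hδ' h => hy.2.2 δ' hδ' (h.trans hz.2)⟩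
  · obtain ⟨c, hc, h⟩ := exists_width_of_maximalRankEmbedding hN hμ hq hμ1 hε hεN f₀.2
    refine ⟨min c (ε / 2), ?_⟩
    have h1 : Tendsto (Subtype.val : maximalRankEmbeddings IB IC G W N → BundleMap IB IC N G W)
        (𝓝 f₀) (pairNhds IB IC G W N 3 f₀) :=
      tendsto_inf.2 ⟨continuous_induced_dom.tendsto f₀,
        tendsto_principal.2 (Eventually.of_forall fun f => f.2.1.1.1)⟩
    filter_upwards [h1.eventually h] with f hf
    exact ⟨lt_min hc (half_pos hε), (min_le_right _ _).trans_lt (half_lt_self hε),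
      fun δ' hδ' hle => hf f.2 δ' hδ' (hle.trans (min_le_left _ _))⟩

end ContinuousWidth

end FiberLinearization

open FiberLinearization in
theorem theorem6p11
    -- the compact base manifold `B` (boundary and corners allowed)
    {EB : Type*} [NormedAddCommGroup EB] [NormedSpace ℝ EB] [FiniteDimensional ℝ EB]
    {HB : Type*} [TopologicalSpace HB] (IB : ModelWithCorners ℝ EB HB)
    {B : Type*} [TopologicalSpace B] [ChartedSpace HB B] [IsManifold IB ∞ B]
    [T2Space B] [CompactSpace B]
    -- the smooth vector bundle `E → B` with its orthogonal structure
    {F : Type*} [NormedAddCommGroup F] [NormedSpace ℝ F] [FiniteDimensional ℝ F]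
    {V : B → Type*} [TopologicalSpace (TotalSpace F V)]
    [∀ b, NormedAddCommGroup (V b)] [∀ b, InnerProductSpace ℝ (V b)]
    [FiberBundle F V] [VectorBundle ℝ F V] [ContMDiffVectorBundle ∞ F V IB]
    [IsContMDiffRiemannianBundle IB ∞ F V]
    -- the manifold `C`
    {EC : Type*} [NormedAddCommGroup EC] [NormedSpace ℝ EC] [FiniteDimensional ℝ EC]
    {HC : Type*} [TopologicalSpace HC] (IC : ModelWithCorners ℝ EC HC)
    {C : Type*} [TopologicalSpace C] [ChartedSpace HC C] [IsManifold IC ∞ C]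
    [T2Space C] [SecondCountableTopology C]
    -- the smooth vector bundle `F → C`
    {G : Type*} [NormedAddCommGroup G] [NormedSpace ℝ G] [FiniteDimensional ℝ G]
    {W : C → Type*} [TopologicalSpace (TotalSpace G W)]
    [∀ c, AddCommGroup (W c)] [∀ c, Module ℝ (W c)] [∀ c, TopologicalSpace (W c)]
    [FiberBundle G W] [VectorBundle ℝ G W] [ContMDiffVectorBundle ∞ G W IC]
    -- the compact star-like neighbourhood `N` of the zero section; the last condition holds for
    -- every submanifold of codimension zero, with or without boundary and corners
    (N : Set (TotalSpace F V)) (hN_compact : IsCompact N) (hN_star : IsStarlike N)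
    (hN_nhds : N ∈ 𝓝ˢ (range (zeroSection F V)))
    (hN_smooth : UniqueMDiffOn (IB.prod 𝓘(ℝ, F)) N)
    (ε : ℝ) (hε : 0 < ε) (hεN : closedTube V ε ⊆ N)
    -- the fixed cut-off function
    (p q : ℝ) (hp : 0 < p) (hpq : p < q)
    (μ : ℝ → ℝ) (hμ_smooth : ContDiff ℝ ∞ μ) (hμ_mem : ∀ s, μ s ∈ Icc (0 : ℝ) 1)
    (hμ_zero : ∀ s ∈ Icc 0 p, μ s = 0) (hμ_one : ∀ s, q ≤ s → μ s = 1)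
    -- the space of maps
    (X : Set (BundleMap IB IC N G W))
    (hX : (∃ a : ℕ, X = horizontalRankGE IB IC G W N a) ∨
      (∃ b : ℕ, X = verticalRankGE IB IC G W N b) ∨
      (∃ a b : ℕ, X = bothRanksGE IB IC G W N a b) ∨
      X = maximalRankEmbeddings IB IC G W N ∨
      (Module.finrank ℝ EB = Module.finrank ℝ EC ∧
        Module.finrank ℝ (EB × F) = Module.finrank ℝ (EC × G) ∧
        X = embeddings IB IC G W N)) :
    (∃ δ : X → Ioo (0 : ℝ) ε,
      Continuous[SmoothMapOn.whitneyOn 3 X, inferInstance] δ ∧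
      -- the `δ`-linearizing homotopy takes values in `X`, and is continuous for `W^∞`
      ∃ H : X × unitInterval → X,
        (∀ (f : X) (t : unitInterval) (w : N),
          (H (f, t)).1 w = linearizing μ f.1 (δ f) t w) ∧
        Continuous[@instTopologicalSpaceProd _ _ (SmoothMapOn.whitneyOn ⊤ X) inferInstance,
          SmoothMapOn.whitneyOn ⊤ X] H) ∧
    IsHomotopyEquivalence
      (SmoothMapOn.whitneyOn ⊤ (X ∩ linearNearZero IB IC G W N)) (SmoothMapOn.whitneyOn ⊤ X)
      (inclusion (inter_subset_left : X ∩ linearNearZero IB IC G W N ⊆ X)) := by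
  have := FiniteDimensional.complete ℝ G
  have hN : IsTubularDomain IB N := ⟨hN_compact, hN_star, hN_nhds, hN_smooth⟩
  have hμ : IsCutoff p μ := ⟨hp, hμ_smooth, hμ_mem, hμ_zero⟩
  have hq : 0 < q := hp.trans hpq
  have hXp : X ⊆ pairMaps IB IC G W N := by
    rcases hX with ⟨a, rfl⟩ | ⟨b, rfl⟩ | ⟨a, b, rfl⟩ | rfl | ⟨-, -, rfl⟩
    exacts [fun f hf => hf.1, fun f hf => hf.1, fun f hf => hf.1.1, fun f hf => hf.1.1.1,
      fun f hf => hf.1]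
  -- conditions on the ranks are preserved for any width
  have hconst : (∀ (f : X) (δ : ℝ) (hδ : 0 < δ) (t : ℝ) (ht : t ∈ Icc (0 : ℝ) 1),
      linearizedMap hN hμ f (hXp f.2) δ hδ t ht ∈ X) → _ := fun h =>
    linearizing_conclusion hN hμ hXp (fun _ => ⟨ε / 2, half_pos hε, half_lt_self hε⟩)
      (@continuous_const _ _ (SmoothMapOn.whitneyOn 3 X) _ _) fun f t ht => h f _ _ t ht
  rcases hX with ⟨a, rfl⟩ | ⟨b, rfl⟩ | ⟨a, b, rfl⟩ | rfl | ⟨hd, -, rfl⟩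
  · refine hconst fun f δ hδ t ht => ⟨linearizedMap_mem_pairMaps, fun b => ?_⟩
    rw [horizontalRank_linearizedMap]; exact f.2.2 b
  · refine hconst fun f δ hδ t ht => ⟨linearizedMap_mem_pairMaps, fun b => ?_⟩
    rw [verticalRank_linearizedMap]; exact f.2.2 b
  · refine hconst fun f δ hδ t ht => ⟨⟨linearizedMap_mem_pairMaps, fun b => ?_⟩,
      ⟨linearizedMap_mem_pairMaps, fun b => ?_⟩⟩
    · rw [horizontalRank_linearizedMap]; exact f.2.1.2 b
    · rw [verticalRank_linearizedMap]; exact f.2.2.2 b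
  · obtain ⟨δ, hδ, h⟩ := exists_continuous_width (IC := IC) (G := G) (W := W) hN hμ hq hμ_one hε hεN
    exact linearizing_conclusion hN hμ hXp δ hδ h
  · rw [embeddings_eq_maximalRankEmbeddings hN.mem_nhdsSet hd] at hXp ⊢
    obtain ⟨δ, hδ, h⟩ := exists_continuous_width (IC := IC) (G := G) (W := W) hN hμ hq hμ_one hε hεN
    exact linearizing_conclusion hN hμ hXp δ hδ h
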